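/- Let $n\ge 1$, $m\in\mathbb N$, and identify $\mathbb R^n$ with $\mathbb R^n\times\{0\}=\partial\mathbb R^{n+1}_+$, where $\mathbb R^{n+1}_+=\mathbb R^n\times(0,\infty)$. Put $\gamma_n:=\Gamma\big(\tfrac{n+1}{2}\big)\pi^{-\frac{n+1}{2}}$. For $\omega\subset\mathbb R^n$ bounded and open, let $$\mathcal E(v,\omega):=\frac{\gamma_n}{4}\iint_{\omega\times\omega}\frac{|v(x)-v(y)|^2}{|x-y|^{n+1}}\,dx\,dy+\frac{\gamma_n}{2}\iint_{\omega\times(\mathbb R^n\setminus\omega)}\frac{|v(x)-v(y)|^2}{|x-y|^{n+1}}\,dx\,dy ,$$ $$\widehat H^{1/2}(\omega;\mathbb R^m):=\{v\in L^2_{\rm loc}(\mathbb R^n;\mathbb R^m):\mathcal E(v,\omega)<\infty\},$$ and let $$v^{\rm e}(x',x_{n+1}):=\gamma_n\int_{\mathbb R^n}\frac{x_{n+1}\,v(z)}{(|x'-z|^2+x_{n+1}^2)^{\frac{n+1}{2}}}\,dz\qquad (x'\in\mathbb R^n,\ x_{n+1}>0)$$ be the harmonic extension of $v$ to $\mathbb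 R^{n+1}_+$. For $\Omega\subset\mathbb R^{n+1}_+$ bounded and open, let $\partial^0\Omega$ be the set of all $x\in\partial\Omega\cap\mathbb R^n$ such that $B_r(x)\cap\mathbb R^{n+1}_+\subset\Omega$ for some $r>0$. Call $\Omega$ admissible if $\partial\Omega$ is Lipschitz, $\partial^0\Omega$ is non-empty with Lipschitz boundary in $\mathbb R^n$, and $\partial\Omega=(\partial\Omega\cap\mathbb R^{n+1}_+)\cup\overline{\partial^0\Omega}$. Let $\omega\subset\mathbb R^n$ be a bounded open set, let $\Omega\subset\mathbb R^{n+1}_+$ be an admissible bounded open set with $\overline{\partial^0\Omega}\subset\omega$, and let $v\in\widehat H^{1/2}(\omega;\mathbb R^m)$. (i) Let $X\in C^1(\mathbb R^n;\mathbb R^n)$ be compactly supported in $\partial^0\Omega$, and let $\{\phi_t\}_{t\in\mathbb R}$ be the flow generated by $X$. Then $v\circ\phi_t\in\widehat H^{1/2}(\omega;\mathbb R^m)$ for every $t$. Moreover, for every vector field $\mathbf X=(\mathbf X_1,\dots,\mathbf X_{n+1})\in C^1(\overline\Omega;\mathbb R^{n+1})$ compactly supported in $\Omega\cup\partial^0\Omega$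 with $\mathbf X=(X,0)$ on $\partial^0\Omega$, the function $t\mapsto\mathcal E(v\circ\phi_t,\omega)$ is differentiable at $t=0$, the integrand on the right-hand side below is integrable on $\Omega$, and $$\left[\frac{d}{dt}\,\mathcal E(v\circ\phi_t,\omega)\right]_{t=0}=-\frac12\int_\Omega\Big(|\nabla v^{\rm e}|^2\,{\rm div}\,\mathbf X-2\sum_{i,j=1}^{n+1}(\partial_iv^{\rm e}\cdot\partial_jv^{\rm e})\,\partial_j\mathbf X_i\Big)\,dx .$$ (ii) Here a smooth one-parameter group on $\mathbb R^k$ means a family $\{\psi_t\}_{t\in\mathbb R}$ of maps $\mathbb R^k\to\mathbb R^k$, jointly $C^\infty$ in $(t,x)$, with $\psi_0={\rm id}$, $\psi_{s+t}=\psi_s\circ\psi_t$, and $\psi_t-{\rm id}$ compactly supported for each $t$. Suppose that $v$ is stationary in $\omega$, that is, $\big[\frac{d}{dt}\mathcal E(v\circ\psi_t,\omega)\big]_{t=0}=0$ for every smooth one-parameter group on $\mathbb R^n$ such that ${\rm supp}(\psi_t-{\rm id})\subset\omega$ for all $t$. Then $v^{\rm e}$ is stationary in $\Omega$ up to $\partial^0\Omega$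 for the Dirichlet energy: for every smooth one-parameter group $\{\Phi_t\}$ on $\mathbb R^{n+1}$ such that, for all $t$, $\Phi_t(\mathbb R^n)\subset\mathbb R^n$ and ${\rm supp}(\Phi_t-{\rm id})\cap\overline{\mathbb R}{}^{n+1}_+\subset\Omega\cup\partial^0\Omega$, the integral $\int_\Omega|\nabla(v^{\rm e}\circ\Phi_t)|^2\,dx$ is finite for all $t$ and $$\left[\frac{d}{dt}\,\frac12\int_\Omega|\nabla(v^{\rm e}\circ\Phi_t)|^2\,dx\right]_{t=0}=0 .$$ -/

import Mathlib

open MeasureTheory Set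
open scoped ENNReal

noncomputable section

namespace HalfHarmonic

/-- The Euclidean space `ℝⁿ`. -/
abbrev Rn (n : ℕ) : Type := EuclideanSpace ℝ (Fin n)

/-- The normalising constant `γ_n = Γ((n+1)/2) / π^((n+1)/2)`. -/
def gammaConst (n : ℕ) : ℝ :=
  Real.Gamma (((n : ℝ) + 1) / 2) / Real.pi ^ (((n : ℝ) + 1) / 2)

/-- The horizontal part `x'` of `x = (x', x_{n+1}) ∈ ℝⁿ⁺¹`. -/
def horiz {n : ℕ} (x : Rn (n + 1)) : Rn n := WithLp.toLp 2 (fun i : Fin n => x i.castSucc)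

/-- The vertical coordinate `x_{n+1}` of `x ∈ ℝⁿ⁺¹`. -/
def height {n : ℕ} (x : Rn (n + 1)) : ℝ := x (Fin.last n)

/-- The identification of `ℝⁿ` with `ℝⁿ × {0} ⊆ ℝⁿ⁺¹`. -/
def emb {n : ℕ} (x : Rn n) : Rn (n + 1) :=
  WithLp.toLp 2 (Fin.snoc (α := fun _ => ℝ) (fun i : Fin n => x i) 0)

/-- The open upper half-space `ℝⁿ⁺¹₊`. -/
def upperHalf (n : ℕ) : Set (Rn (n + 1)) := {x | 0 < height x}

/-- The (two-point) energy density `|v(x) - v(y)|² / |x - y|ⁿ⁺¹`. -/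
def pairDensity {n m : ℕ} (v : Rn n → Rn m) (p : Rn n × Rn n) : ℝ≥0∞ :=
  ENNReal.ofReal (‖v p.1 - v p.2‖ ^ 2 / ‖p.1 - p.2‖ ^ (n + 1))

/-- The `1/2`-Dirichlet energy `𝓔(v, ω)`, with values in `[0, ∞]`. -/
def halfEnergy {n m : ℕ} (v : Rn n → Rn m) (ω : Set (Rn n)) : ℝ≥0∞ :=
  ENNReal.ofReal (gammaConst n / 4) * (∫⁻ p in ω ×ˢ ω, pairDensity v p) +
    ENNReal.ofReal (gammaConst n / 2) * (∫⁻ p in ω ×ˢ ωᶜ, pairDensity v p)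

/-- The class `Ĥ^{1/2}(ω; ℝᵐ)` of maps in `L²_loc(ℝⁿ; ℝᵐ)` with `𝓔(v, ω) < ∞`. -/
structure MemHhat {n m : ℕ} (v : Rn n → Rn m) (ω : Set (Rn n)) : Prop where
  memLp_two_of_isCompact : ∀ K : Set (Rn n), IsCompact K → MemLp v 2 (volume.restrict K)
  energy_lt_top : halfEnergy v ω < ∞

/-- The harmonic extension `vᵉ` of `v` to the upper half-space, by the Poisson kernel. -/
def harmExt {n m : ℕ} (v : Rn n → Rn m) (x : Rn (n + 1)) : Rn m :=
  gammaConst n • ∫ z : Rn n,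
    (height x / (‖horiz x - z‖ ^ 2 + height x ^ 2) ^ (((n : ℝ) + 1) / 2)) • v z

/-- The partial derivative `∂_j u (x)`. -/
def pderiv {k m : ℕ} (u : Rn k → Rn m) (j : Fin k) (x : Rn k) : Rn m :=
  fderiv ℝ u x (EuclideanSpace.single j 1)

/-- `|∇u|² = ∑_j |∂_j u|²`. -/
def gradSq {k m : ℕ} (u : Rn k → Rn m) (x : Rn k) : ℝ :=
  ∑ j : Fin k, ‖pderiv u j x‖ ^ 2

/-- The divergence `∑_i ∂_i Y_i`. -/
def divergence {k : ℕ} (Y : Rn k → Rn k) (x : Rn k) : ℝ :=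
  ∑ i : Fin k, pderiv Y i x i

/-- The integrand `|∇u|² div Y - 2 ∑_{i,j} (∂_i u · ∂_j u) ∂_j Y_i`. -/
def stressIntegrand {k m : ℕ} (u : Rn k → Rn m) (Y : Rn k → Rn k) (x : Rn k) : ℝ :=
  gradSq u x * divergence Y x -
    2 * ∑ i : Fin k, ∑ j : Fin k, inner ℝ (pderiv u i x) (pderiv u j x) * pderiv Y j x i

/-- Lipschitz regular boundary: near each boundary point `p` the set `U` is, for some unit
vector `e`, the region above the graph of a Lipschitz function over `e^⊥`, in the direction `e`
(`x - ⟪e, x⟫ e` is the orthogonal projection of `x` to `e^⊥`; a Lipschitz function on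
`e^⊥` is the restriction of one on the whole space). -/
def HasLipschitzBoundary {k : ℕ} (U : Set (Rn k)) : Prop :=
  ∀ p ∈ frontier U, ∃ (e : Rn k) (r : ℝ) (K : NNReal) (g : Rn k → ℝ),
    ‖e‖ = 1 ∧ 0 < r ∧ LipschitzWith K g ∧
      ∀ x ∈ Metric.ball p r, (x ∈ U ↔ g (x - inner ℝ e x • e) < inner ℝ e x)

/-- The flat part `∂⁰Ω ⊆ ℝⁿ` of the boundary of `Ω ⊆ ℝⁿ⁺¹₊`: the `x ∈ ∂Ω ∩ ℝⁿ` such that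
`B_r⁺(x) ⊆ Ω` for some `r > 0`. -/
def flatBdry {n : ℕ} (Ω : Set (Rn (n + 1))) : Set (Rn n) :=
  {x | emb x ∈ frontier Ω ∧ ∃ r : ℝ, 0 < r ∧ Metric.ball (emb x) r ∩ upperHalf n ⊆ Ω}

/-- Admissible bounded open subsets of `ℝⁿ⁺¹₊`. -/
structure IsAdmissible {n : ℕ} (Ω : Set (Rn (n + 1))) : Prop where
  isOpen : IsOpen Ω
  isBounded : Bornology.IsBounded Ω
  subset_upperHalf : Ω ⊆ upperHalf n
  lipschitz_frontier : HasLipschitzBoundary Ω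
  flatBdry_nonempty : (flatBdry Ω).Nonempty
  lipschitz_flatBdry : HasLipschitzBoundary (flatBdry Ω)
  frontier_eq : frontier Ω = (frontier Ω ∩ upperHalf n) ∪ emb '' closure (flatBdry Ω)

/-- `φ` is the flow generated by the vector field `X`. -/
structure IsFlow {k : ℕ} (X : Rn k → Rn k) (φ : ℝ → Rn k → Rn k) : Prop where
  map_zero : ∀ x, φ 0 x = x
  hasDerivAt : ∀ t x, HasDerivAt (fun s => φ s x) (X (φ t x)) t

/-- `Y ∈ C¹(Ω̄; ℝⁿ⁺¹)` is compactly supported in `Ω ∪ ∂⁰Ω` and `Y = (X, 0)` on `∂⁰Ω`. -/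
structure IsExtensionField {n : ℕ} (Ω : Set (Rn (n + 1))) (X : Rn n → Rn n)
    (Y : Rn (n + 1) → Rn (n + 1)) : Prop where
  contDiffOn : ContDiffOn ℝ 1 Y (closure Ω)
  compact_support : ∃ K : Set (Rn (n + 1)), IsCompact K ∧ K ⊆ Ω ∪ emb '' flatBdry Ω ∧
    ∀ x ∈ closure Ω \ K, Y x = 0
  eq_on_flatBdry : ∀ x ∈ flatBdry Ω, Y (emb x) = emb (X x)

/-- A smooth one-parameter group of (smooth, compactly supported) diffeomorphisms of `ℝᵏ`;
`φ t` has the inverse `φ (-t)`. -/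
structure IsDiffeoGroup {k : ℕ} (φ : ℝ → Rn k → Rn k) : Prop where
  contDiff : ContDiff ℝ ((⊤ : ℕ∞) : WithTop ℕ∞) (fun p : ℝ × Rn k => φ p.1 p.2)
  map_zero : ∀ x, φ 0 x = x
  map_add : ∀ s t x, φ (s + t) x = φ s (φ t x)
  compact_support : ∀ t, HasCompactSupport (fun x => φ t x - x)

/-- `v` is stationary in `ω` for the `1/2`-Dirichlet energy: its first inner variations
with support in `ω` vanish. -/
def IsHalfStationary {n m : ℕ} (v : Rn n → Rn m) (ω : Set (Rn n)) : Prop :=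
  ∀ φ : ℝ → Rn n → Rn n, IsDiffeoGroup φ → (∀ t, tsupport (fun x => φ t x - x) ⊆ ω) →
    HasDerivAt (fun t => (halfEnergy (fun x => v (φ t x)) ω).toReal) 0 0

/-- `u` is stationary in `Ω` up to `∂⁰Ω` for the Dirichlet energy: along the one-parameter
groups that preserve `ℝⁿ` and whose support meets the closed half-space within `Ω ∪ ∂⁰Ω`, the
Dirichlet energy in `Ω` is finite and has derivative zero at `t = 0`. The gradient is the
classical one: the definition is meant for `u` that are smooth in the open half-space. -/
def IsDirichletStationary {n m : ℕ} (u : Rn (n + 1) → Rn m) (Ω : Set (Rn (n + 1))) : Prop :=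
  ∀ Φ : ℝ → Rn (n + 1) → Rn (n + 1), IsDiffeoGroup Φ →
    (∀ t x, Φ t (emb x) ∈ range (emb : Rn n → Rn (n + 1))) →
    (∀ t, tsupport (fun x => Φ t x - x) ∩ {x | 0 ≤ height x} ⊆ Ω ∪ emb '' flatBdry Ω) →
    (∀ t, IntegrableOn (gradSq (fun x => u (Φ t x))) Ω) ∧
      HasDerivAt (fun t => 1 / 2 * ∫ x in Ω, gradSq (fun x => u (Φ t x)) x) 0 0

end HalfHarmonic

end

open HalfHarmonic

/-! # The half-Laplacian energy and inner variations of the harmonic extension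

Up to the factor `γ_n / 4`, the energy `𝓔(v, ω)` is the integral `pairEnergy v ω` of
`|v x - v y|² / |x - y|^{n+1}` over the pairs of points at least one of which lies in `ω`.

*First variation of the energy.* Two functionals of `v` are compared: the difference quotients of
`t ↦ 𝓔(v ∘ φ_t, ω)`, and the stress functional `-½ ∫_Ω (|∇vᵉ|² div Y - 2 ∑ ⟨∂ᵢvᵉ, ∂ⱼvᵉ⟩ ∂ⱼYᵢ)`. Both are
quadratic in `v` and bounded by the energy, uniformly in `t`: the difference quotients because `φ_t` is
bi-Lipschitz with constant `exp(L|t|)` (`abs_energy_quotient_le`), the stress functional because the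
Dirichlet integral of `vᵉ` over `Ω` is controlled by the energy (`exists_dirichlet_bound`). By
polarisation both are then continuous in `v`, uniformly in `t` (`tendsto_of_isQuadratic`), and it
suffices to compare them for `v` smooth with compact support; such maps are dense for the energy of a
slightly smaller set, by cutting off and mollifying (`exists_smooth_approx`). For a smooth `v` put
`N = ∂_{n+1} vᵉ(·, 0)`, given by an absolutely convergent integral of second differences of `v`.
Expanding the square, the derivative of the energy along the flow of `X` is a multiple of
`-∫ ⟨Dv X, N⟩` (`tendsto_energy_quotient`). On the other side, since `vᵉ` is harmonic, its stress-energy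
tensor contracted with `Y` has divergence `-½` times the stress integrand; the divergence theorem leaves
only the flux through `ℝⁿ`, where `Y = (X, 0)`, and this flux is the same integral
(`stressFunctional_smooth`). The result is `hasDerivAt_halfEnergy`.

*Stationarity.* A one-parameter group `Φ` of `ℝⁿ⁺¹` preserving `ℝⁿ` induces a group on `ℝⁿ`. The
supports of all `Φ_t - id` lie in one compact set, the union of the supports at the times `1` and `√2`,
since these times generate a dense subgroup of `ℝ`. Hence the induced group is a competitor for the stationarity of `v`,
and the generator of `Φ` is an admissible extension of its generator. The change of variables `y = Φ_t x`
gives the derivative of the Dirichlet energy of `vᵉ ∘ Φ_t` with no regularity of `vᵉ` beyond finite energy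
(`hasDerivAt_dirichlet`): it is the same stress integral, so it equals the derivative of `𝓔`, which is
zero. -/

namespace HalfHarmonic

variable {n m : ℕ}

/-! ### Coordinates on the half-space -/

/-- The point `(x, s)` of `ℝⁿ⁺¹ = ℝⁿ × ℝ`. -/
def up (x : Rn n) (s : ℝ) : Rn (n + 1) :=
  WithLp.toLp 2 (Fin.snoc (α := fun _ => ℝ) (fun i : Fin n => x i) s)

@[simp] lemma up_castSucc (x : Rn n) (s : ℝ) (i : Fin n) : up x s i.castSucc = x i := by
  simp [up]

@[simp] lemma up_last (x : Rn n) (s : ℝ) : up x s (Fin.last n) = s := by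
  simp [up]

@[simp] lemma horiz_up (x : Rn n) (s : ℝ) : horiz (up x s) = x := by
  ext i; simp [horiz]

@[simp] lemma height_up (x : Rn n) (s : ℝ) : height (up x s) = s := by
  simp [height]

@[simp] lemma up_horiz_height (x : Rn (n + 1)) : up (horiz x) (height x) = x := by
  ext i
  refine Fin.lastCases ?_ (fun j => ?_) i <;> simp [horiz, height]

lemma emb_eq_up (x : Rn n) : emb x = up x 0 := rfl

@[simp] lemma horiz_emb (x : Rn n) : horiz (emb x) = x := horiz_up x 0

@[simp] lemma height_emb (x : Rn n) : height (emb x) = 0 := height_up x 0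

lemma emb_horiz {x : Rn (n + 1)} (h : height x = 0) : emb (horiz x) = x := by
  rw [emb_eq_up, ← h, up_horiz_height]

lemma norm_sq_eq_horiz_add_height (x : Rn (n + 1)) : ‖x‖ ^ 2 = ‖horiz x‖ ^ 2 + height x ^ 2 := by
  rw [EuclideanSpace.norm_sq_eq, EuclideanSpace.norm_sq_eq, Fin.sum_univ_castSucc]
  simp [horiz, height]

lemma norm_sq_up (x : Rn n) (s : ℝ) : ‖up x s‖ ^ 2 = ‖x‖ ^ 2 + s ^ 2 := by
  rw [norm_sq_eq_horiz_add_height]; simp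

/-- The linear splitting `x ↦ (x', x_{n+1})` of `ℝⁿ⁺¹`. -/
noncomputable def splitL (n : ℕ) : Rn (n + 1) ≃L[ℝ] Rn n × ℝ :=
  LinearEquiv.toContinuousLinearEquiv
    { toFun := fun x => (horiz x, height x)
      invFun := fun p => up p.1 p.2
      map_add' := fun x y => by
        ext <;> simp [horiz, height]
      map_smul' := fun c x => by
        ext <;> simp [horiz, height]
      left_inv := fun x => up_horiz_height x
      right_inv := fun p => by simp }

lemma splitL_symm_apply (p : Rn n × ℝ) : (splitL n).symm p = up p.1 p.2 := rfl

/-- The horizontal projection as a continuous linear map. -/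
noncomputable def horizL (n : ℕ) : Rn (n + 1) →L[ℝ] Rn n :=
  (ContinuousLinearMap.fst ℝ _ _).comp (splitL n : Rn (n + 1) →L[ℝ] Rn n × ℝ)

/-- The vertical coordinate as a continuous linear map. -/
noncomputable def heightL (n : ℕ) : Rn (n + 1) →L[ℝ] ℝ :=
  (ContinuousLinearMap.snd ℝ _ _).comp (splitL n : Rn (n + 1) →L[ℝ] Rn n × ℝ)

/-- The inclusion of `ℝⁿ` in `ℝⁿ⁺¹` as a continuous linear map. -/
noncomputable def embL (n : ℕ) : Rn n →L[ℝ] Rn (n + 1) :=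
  ((splitL n).symm : Rn n × ℝ →L[ℝ] Rn (n + 1)).comp (ContinuousLinearMap.inl ℝ _ _)

lemma heightL_apply (x : Rn (n + 1)) : heightL n x = height x := rfl
lemma embL_apply (x : Rn n) : embL n x = emb x := rfl

lemma continuous_horiz : Continuous (horiz : Rn (n + 1) → Rn n) := (horizL n).continuous
lemma continuous_height : Continuous (height : Rn (n + 1) → ℝ) := (heightL n).continuous
lemma continuous_emb : Continuous (emb : Rn n → Rn (n + 1)) := (embL n).continuous
lemma continuous_up : Continuous (fun p : Rn n × ℝ => up p.1 p.2) := (splitL n).symm.continuous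

lemma horiz_sub (x y : Rn (n + 1)) : horiz (x - y) = horiz x - horiz y := (horizL n).map_sub x y
lemma height_sub (x y : Rn (n + 1)) : height (x - y) = height x - height y :=
  (heightL n).map_sub x y
lemma height_add (x y : Rn (n + 1)) : height (x + y) = height x + height y :=
  (heightL n).map_add x y

lemma norm_emb (x : Rn n) : ‖emb x‖ = ‖x‖ := by
  have h := norm_sq_up x 0
  rw [← emb_eq_up] at h
  simpa using h

lemma emb_injective : Function.Injective (emb : Rn n → Rn (n + 1)) := fun x y h => by
  simpa using congrArg horiz h

lemma isOpen_upperHalf : IsOpen (upperHalf n) := isOpen_lt continuous_const continuous_height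

lemma abs_height_le (x : Rn (n + 1)) : |height x| ≤ ‖x‖ := by
  apply abs_le_of_sq_le_sq _ (norm_nonneg _)
  rw [norm_sq_eq_horiz_add_height]; nlinarith [sq_nonneg ‖horiz x‖]

lemma norm_horiz_le (x : Rn (n + 1)) : ‖horiz x‖ ≤ ‖x‖ := by
  apply le_of_sq_le_sq _ (norm_nonneg _)
  rw [norm_sq_eq_horiz_add_height]; nlinarith [sq_nonneg (height x)]

lemma measurePreserving_split :
    MeasurePreserving (fun x : Rn (n + 1) => (horiz x, height x)) volume
      ((volume : Measure (Rn n)).prod volume) := by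
  have h1 := (EuclideanSpace.volume_preserving_symm_measurableEquiv_toLp (Fin (n + 1)))
  have h2 := volume_preserving_piFinSuccAbove (fun _ : Fin (n + 1) => ℝ) (Fin.last n)
  have h3 := (EuclideanSpace.volume_preserving_symm_measurableEquiv_toLp (Fin n)).symm
  have h4 : MeasurePreserving (Prod.swap : ℝ × (Fin n → ℝ) → _)
    ((volume : Measure ℝ).prod volume) ((volume : Measure (Fin n → ℝ)).prod volume) :=
      Measure.measurePreserving_swap
  have h5 := (h3.prod (MeasurePreserving.id (volume : Measure ℝ))).comp (h4.comp (h2.comp h1))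
  refine ⟨(continuous_horiz.prodMk continuous_height).measurable, ?_⟩
  rw [← h5.map_eq]
  congr 1
  funext x
  exact Prod.ext (PiLp.ext fun i => congrArg x (Fin.succAbove_last_apply i).symm) rfl

/-- Lebesgue measure on `ℝⁿ⁺¹` is the product measure in the coordinates `(x, s)`. -/
lemma measurePreserving_up :
    MeasurePreserving (fun p : Rn n × ℝ => up p.1 p.2)
      ((volume : Measure (Rn n)).prod volume) volume := by
  have := (measurePreserving_split (n := n)).symm (e := (splitL n).toHomeomorph.toMeasurableEquiv)
  exact this

lemma integral_eq_integral_up {E : Type*} [NormedAddCommGroup E] [NormedSpace ℝ E]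
    (f : Rn (n + 1) → E) : ∫ x, f x = ∫ p : Rn n × ℝ, f (up p.1 p.2) :=
  ((measurePreserving_up (n := n)).integral_comp
    (splitL n).symm.toHomeomorph.measurableEmbedding f).symm

lemma integrable_iff_integrable_up {E : Type*} [NormedAddCommGroup E] (f : Rn (n + 1) → E) :
    Integrable f ↔ Integrable (fun p : Rn n × ℝ => f (up p.1 p.2)) :=
  ((measurePreserving_up (n := n)).integrable_comp_emb
    (splitL n).symm.toHomeomorph.measurableEmbedding).symm

lemma lintegral_eq_lintegral_up (f : Rn (n + 1) → ℝ≥0∞) :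
    ∫⁻ x, f x = ∫⁻ p : Rn n × ℝ, f (up p.1 p.2) :=
  ((measurePreserving_up (n := n)).lintegral_comp_emb
    (splitL n).symm.toHomeomorph.measurableEmbedding f).symm

/-! ### The Poisson kernel -/

lemma gammaConst_pos (n : ℕ) : 0 < gammaConst n :=
  div_pos (Real.Gamma_pos_of_pos (by positivity)) (Real.rpow_pos_of_pos Real.pi_pos _)

/-- The Poisson kernel of the half-space, with pole at the origin. -/
noncomputable def pk (x : Rn (n + 1)) : ℝ :=
  gammaConst n * (height x * (‖x‖ ^ 2) ^ (-(((n : ℝ) + 1) / 2)))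

lemma harmExt_eq_integral_pk (v : Rn n → Rn m) (x : Rn (n + 1)) :
    harmExt v x = ∫ z, pk (x - emb z) • v z := by
  rw [harmExt, ← integral_smul]
  refine integral_congr_ae (Filter.Eventually.of_forall fun z => ?_)
  simp only [pk, smul_smul]
  rw [norm_sq_eq_horiz_add_height, horiz_sub, height_sub, horiz_emb, height_emb, sub_zero,
    Real.rpow_neg (by positivity), div_eq_mul_inv]

lemma sq_norm_rpow (x : Rn (n + 1)) :
    (‖x‖ ^ 2) ^ (-(((n : ℝ) + 1) / 2)) = (‖x‖ ^ (n + 1))⁻¹ := by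
  rw [Real.rpow_neg (by positivity), ← Real.rpow_natCast, ← Real.rpow_mul (norm_nonneg _),
    ← Real.rpow_natCast]
  congr 2
  push_cast; ring

lemma inner_single_one {k : ℕ} (x : Rn k) (i : Fin k) :
    inner ℝ x (EuclideanSpace.single i (1 : ℝ)) = x i := by
  simp [EuclideanSpace.inner_single_right]

lemma hasFDerivAt_sq_norm_rpow {k : ℕ} (p : ℝ) {x : Rn k} (hx : x ≠ 0) :
    HasFDerivAt (fun y : Rn k => (‖y‖ ^ 2) ^ p) ((2 * p * (‖x‖ ^ 2) ^ (p - 1)) • innerSL ℝ x) x := by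
  have h1 := (hasStrictFDerivAt_norm_sq x).hasFDerivAt
  have h2 := h1.rpow_const (p := p) (Or.inl (by positivity))
  refine h2.congr_fderiv ?_
  ext y
  simp
  ring

/-- The gradient of the Poisson kernel. -/
noncomputable def pkGrad (x : Rn (n + 1)) : Rn (n + 1) →L[ℝ] ℝ :=
  gammaConst n • ((‖x‖ ^ 2) ^ (-(((n : ℝ) + 1) / 2)) • heightL n +
    (height x * (-((n : ℝ) + 1) * (‖x‖ ^ 2) ^ (-(((n : ℝ) + 1) / 2) - 1))) • innerSL ℝ x)

lemma hasFDerivAt_pk {x : Rn (n + 1)} (hx : x ≠ 0) : HasFDerivAt pk (pkGrad x) x := by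
  have h := ((heightL n).hasFDerivAt (x := x)).mul
    (hasFDerivAt_sq_norm_rpow (-(((n : ℝ) + 1) / 2)) hx)
  have h' := h.const_mul (gammaConst n)
  refine HasFDerivAt.congr_fderiv (f := pk) h' ?_
  ext y
  simp [pkGrad, heightL_apply]
  ring

lemma norm_pkGrad_le {x : Rn (n + 1)} (hx : x ≠ 0) :
    ‖pkGrad x‖ ≤ gammaConst n * (n + 2) / ‖x‖ ^ (n + 1) := by
  have hγ := gammaConst_pos n
  have hx' : 0 < ‖x‖ := norm_pos_iff.mpr hx
  have hq : (‖x‖ ^ 2) ^ (-(((n : ℝ) + 1) / 2) - 1) = (‖x‖ ^ (n + 1))⁻¹ / ‖x‖ ^ 2 := by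
    rw [Real.rpow_sub_one (by positivity), sq_norm_rpow]
  have hh : ‖heightL n‖ ≤ 1 := ContinuousLinearMap.opNorm_le_bound _ zero_le_one fun y => by
    simpa [heightL_apply] using abs_height_le y
  rw [pkGrad, norm_smul, Real.norm_of_nonneg hγ.le, mul_div_assoc]
  refine mul_le_mul_of_nonneg_left ((norm_add_le _ _).trans ?_) hγ.le
  rw [hq, sq_norm_rpow, norm_smul, norm_smul, innerSL_apply_norm, Real.norm_eq_abs, Real.norm_eq_abs,
    abs_mul, abs_mul, abs_neg, abs_of_nonneg (by positivity : (0 : ℝ) ≤ (n : ℝ) + 1),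
    abs_of_nonneg (by positivity : 0 ≤ (‖x‖ ^ (n + 1))⁻¹),
    abs_of_nonneg (by positivity : 0 ≤ (‖x‖ ^ (n + 1))⁻¹ / ‖x‖ ^ 2)]
  have h1 : |height x| * (((n : ℝ) + 1) * ((‖x‖ ^ (n + 1))⁻¹ / ‖x‖ ^ 2)) * ‖x‖ ≤
      (n + 1) * (‖x‖ ^ (n + 1))⁻¹ := by
    calc _ ≤ ‖x‖ * (((n : ℝ) + 1) * ((‖x‖ ^ (n + 1))⁻¹ / ‖x‖ ^ 2)) * ‖x‖ := by
          gcongr; exact abs_height_le x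
      _ = _ := by field_simp
  have h2 : (‖x‖ ^ (n + 1))⁻¹ * ‖heightL n‖ ≤ (‖x‖ ^ (n + 1))⁻¹ :=
    mul_le_of_le_one_right (by positivity) hh
  calc _ ≤ (‖x‖ ^ (n + 1))⁻¹ + (n + 1) * (‖x‖ ^ (n + 1))⁻¹ := add_le_add h2 h1
    _ = _ := by ring

lemma contDiffOn_pk : ContDiffOn ℝ ((⊤ : ℕ∞) : WithTop ℕ∞) (pk (n := n)) {0}ᶜ := by
  intro x hx
  have hx : x ≠ 0 := hx
  refine ContDiffAt.contDiffWithinAt ?_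
  refine contDiffAt_const.mul (((heightL n).contDiff.contDiffAt).mul ?_)
  exact ((contDiff_norm_sq ℝ).contDiffAt).rpow_const_of_ne (by positivity)

/-- The Poisson kernel is harmonic away from its pole. -/
lemma sum_pderiv_pkGrad {x : Rn (n + 1)} (hx : x ≠ 0) :
    ∑ i, fderiv ℝ (fun y => pkGrad y (EuclideanSpace.single i 1)) x
      (EuclideanSpace.single i 1) = 0 := by
  set a : ℝ := -(((n : ℝ) + 1) / 2) with ha
  have hγ : ∀ i : Fin (n + 1),
      fderiv ℝ (fun y => pkGrad y (EuclideanSpace.single i 1)) x (EuclideanSpace.single i 1) =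
      gammaConst n * ((heightL n (EuclideanSpace.single i 1)) * (2 * a * (‖x‖ ^ 2) ^ (a - 1) * x i)
        + 2 * a * (height x * x i * (2 * (a - 1) * (‖x‖ ^ 2) ^ (a - 1 - 1) * x i) +
          (‖x‖ ^ 2) ^ (a - 1) * (height x + heightL n (EuclideanSpace.single i 1) * x i))) := by
    intro i
    have e : (fun y : Rn (n + 1) => pkGrad y (EuclideanSpace.single i 1)) = fun y =>
        gammaConst n * ((heightL n (EuclideanSpace.single i 1)) * (‖y‖ ^ 2) ^ a +
          2 * a * ((heightL n y * EuclideanSpace.proj (𝕜 := ℝ) i y) * (‖y‖ ^ 2) ^ (a - 1))) := by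
      funext y
      simp [pkGrad, inner_single_one, heightL_apply, ← ha]
      simp only [ha]; ring
    have h1 := hasFDerivAt_sq_norm_rpow a hx
    have h2 := hasFDerivAt_sq_norm_rpow (a - 1) hx
    have h3 := ((heightL n).hasFDerivAt (x := x)).mul
      ((EuclideanSpace.proj (𝕜 := ℝ) i).hasFDerivAt (x := x))
    have h4 := (((h1.const_mul (heightL n (EuclideanSpace.single i 1))).add
      ((h3.mul h2).const_mul (2 * a))).const_mul (gammaConst n))
    rw [e]
    refine (congrArg (fun L => L (EuclideanSpace.single i 1)) h4.fderiv).trans ?_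
    simp [inner_single_one, heightL_apply]
    ring
  have hs : ∀ i : Fin (n + 1), heightL n (EuclideanSpace.single i 1) * x i =
      if i = Fin.last n then height x else 0 := by
    intro i
    by_cases h : i = Fin.last n
    · subst h; simp [heightL_apply, height]
    · have : heightL n (EuclideanSpace.single i (1 : ℝ)) = 0 := by
        simp [heightL_apply, height, Ne.symm h]
      simp [this, h]
  have hq : (‖x‖ ^ 2) ^ (a - 1 - 1) * ‖x‖ ^ 2 = (‖x‖ ^ 2) ^ (a - 1) := by
    rw [Real.rpow_sub_one (x := ‖x‖ ^ 2) (by positivity) (a - 1)]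
    field_simp
  have hn : ∑ i, x i * x i = ‖x‖ ^ 2 := by
    rw [EuclideanSpace.norm_sq_eq]; simp [sq]
  simp_rw [hγ]
  rw [← Finset.mul_sum, Finset.sum_add_distrib]
  have e1 : ∑ i, heightL n (EuclideanSpace.single i 1) * (2 * a * (‖x‖ ^ 2) ^ (a - 1) * x i) =
      2 * a * (‖x‖ ^ 2) ^ (a - 1) * height x := by
    have : ∀ i, heightL n (EuclideanSpace.single i 1) * (2 * a * (‖x‖ ^ 2) ^ (a - 1) * x i) =
      2 * a * (‖x‖ ^ 2) ^ (a - 1) * (if i = Fin.last n then height x else 0) := fun i => by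
        rw [← hs]; ring
    simp_rw [this]
    rw [← Finset.mul_sum]; simp
  have e2 : ∑ i, 2 * a * (height x * x i * (2 * (a - 1) * (‖x‖ ^ 2) ^ (a - 1 - 1) * x i) +
          (‖x‖ ^ 2) ^ (a - 1) * (height x + heightL n (EuclideanSpace.single i 1) * x i)) =
      2 * a * (height x * 2 * (a - 1) * (‖x‖ ^ 2) ^ (a - 1) +
        (‖x‖ ^ 2) ^ (a - 1) * ((n + 1) * height x + height x)) := by
    rw [← Finset.mul_sum, Finset.sum_add_distrib, ← Finset.mul_sum, Finset.sum_add_distrib]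
    simp_rw [hs]
    have : ∑ i, height x * x i * (2 * (a - 1) * (‖x‖ ^ 2) ^ (a - 1 - 1) * x i) =
      height x * 2 * (a - 1) * (‖x‖ ^ 2) ^ (a - 1) := by
      rw [← hq, ← hn, Finset.mul_sum, Finset.mul_sum]
      exact Finset.sum_congr rfl fun i _ => by ring
    rw [this]
    simp
  rw [e1, e2, ha]
  ring

lemma up_sub_emb (x z : Rn n) (s : ℝ) : up x s - emb z = up (x - z) s := by
  rw [emb_eq_up]; exact ((splitL n).symm.map_sub (x, s) (z, 0)).symm.trans
    (by rw [splitL_symm_apply]; simp)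

lemma pk_up (h : Rn n) (s : ℝ) :
    pk (up h s) = gammaConst n * (s * (‖h‖ ^ 2 + s ^ 2) ^ (-(((n : ℝ) + 1) / 2))) := by
  rw [pk, norm_sq_up, height_up]

/-- The Poisson kernel has total mass one: write the power as a Gamma integral of Gaussians. -/
lemma integral_pk {s : ℝ} (hs : 0 < s) :
    Integrable (fun h : Rn n => pk (up h s)) ∧ ∫ h : Rn n, pk (up h s) = 1 := by
  set b : ℝ := ((n : ℝ) + 1) / 2 with hb
  have hbp : 0 < b := by positivity
  have hq : ∀ h : Rn n, 0 < ‖h‖ ^ 2 + s ^ 2 := fun h => by positivity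
  -- `∫₀^∞ F h τ dτ` is a multiple of the kernel, and `h ↦ F h τ` is a Gaussian
  let F : Rn n → ℝ → ℝ := fun h τ => τ ^ (b - 1) * Real.exp (-((‖h‖ ^ 2 + s ^ 2) * τ))
  have hF1 : ∀ h : Rn n, ∫ τ in Ioi 0, F h τ = (1 / (‖h‖ ^ 2 + s ^ 2)) ^ b * Real.Gamma b := fun h =>
    Real.integral_rpow_mul_exp_neg_mul_Ioi hbp (hq h)
  have hF2 : ∀ τ : ℝ, 0 < τ → ∫ h : Rn n, F h τ =
      Real.pi ^ ((n : ℝ) / 2) * (τ ^ ((1 : ℝ) / 2 - 1) * Real.exp (-(s ^ 2 * τ))) := by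
    intro τ hτ
    have : ∀ h : Rn n, F h τ =
        (τ ^ (b - 1) * Real.exp (-(s ^ 2 * τ))) * Real.exp (-τ * ‖h‖ ^ 2) := fun h => by
      simp only [F]; rw [mul_assoc, ← Real.exp_add]; congr 2; ring
    simp_rw [this]
    rw [integral_const_mul, GaussianFourier.integral_rexp_neg_mul_sq_norm hτ, finrank_euclideanSpace,
      Fintype.card_fin, Real.div_rpow Real.pi_pos.le hτ.le]
    have : τ ^ (b - 1) = τ ^ ((1 : ℝ) / 2 - 1) * τ ^ ((n : ℝ) / 2) := by
      rw [← Real.rpow_add hτ]; congr 1; rw [hb]; ring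
    rw [this]
    have : τ ^ ((n : ℝ) / 2) ≠ 0 := (Real.rpow_pos_of_pos hτ _).ne'
    field_simp
  have hmeas : AEStronglyMeasurable (Function.uncurry F)
      ((volume : Measure (Rn n)).prod (volume.restrict (Ioi 0))) := by
    apply Measurable.aestronglyMeasurable
    simp only [F, Function.uncurry_def]
    fun_prop
  -- a Bochner integral with a nonzero value comes from an integrable function
  have hint : Integrable (Function.uncurry F)
      ((volume : Measure (Rn n)).prod (volume.restrict (Ioi 0))) := by
    rw [integrable_prod_iff' hmeas]
    constructor
    · filter_upwards [self_mem_ae_restrict measurableSet_Ioi] with τ hτ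
      have hτ : 0 < τ := hτ
      by_contra h
      have h0 := integral_undef h
      have h1 := hF2 τ hτ
      rw [show ∫ h : Rn n, F h τ = 0 from h0] at h1
      have : 0 < Real.pi ^ ((n : ℝ) / 2) * (τ ^ ((1 : ℝ) / 2 - 1) * Real.exp (-(s ^ 2 * τ))) := by
        positivity
      linarith
    · have : IntegrableOn (fun τ : ℝ => Real.pi ^ ((n : ℝ) / 2) *
          (τ ^ ((1 : ℝ) / 2 - 1) * Real.exp (-(s ^ 2 * τ)))) (Ioi 0) := by
        refine Integrable.const_mul ?_ _
        by_contra h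
        have h0 := integral_undef h
        rw [Real.integral_rpow_mul_exp_neg_mul_Ioi (by norm_num) (by positivity)] at h0
        have : 0 < (1 / s ^ 2) ^ ((1 : ℝ) / 2) * Real.Gamma (1 / 2) :=
          mul_pos (by positivity) (Real.Gamma_pos_of_pos (by norm_num))
        linarith
      refine this.congr ?_
      filter_upwards [self_mem_ae_restrict measurableSet_Ioi] with τ hτ
      rw [← hF2 τ hτ]
      refine integral_congr_ae (Filter.Eventually.of_forall fun h => ?_)
      have hτ : 0 < τ := hτ
      have : 0 ≤ F h τ := by simp only [F]; positivity
      simp only [Function.uncurry_apply_pair, Real.norm_of_nonneg this]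
  have hswap := integral_integral_swap (f := F) hint
  have hr : ∫ τ in Ioi (0 : ℝ), ∫ h : Rn n, F h τ = Real.pi ^ b / s := by
    rw [setIntegral_congr_fun measurableSet_Ioi (fun τ hτ => hF2 τ hτ), integral_const_mul,
      Real.integral_rpow_mul_exp_neg_mul_Ioi (by norm_num) (by positivity), Real.Gamma_one_half_eq,
      ← Real.sqrt_eq_rpow, one_div, Real.sqrt_inv, Real.sqrt_sq hs.le, hb, add_div,
      Real.rpow_add Real.pi_pos, Real.sqrt_eq_rpow]
    ring
  rw [hr] at hswap
  have hpk : ∀ h : Rn n, pk (up h s) = (s / Real.pi ^ b) * ∫ τ in Ioi 0, F h τ := by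
    intro h
    rw [hF1, pk_up, ← hb, gammaConst, ← hb, one_div, Real.inv_rpow (hq h).le,
      Real.rpow_neg (hq h).le]
    ring
  have hpi : Real.pi ^ b ≠ 0 := (Real.rpow_pos_of_pos Real.pi_pos _).ne'
  refine ⟨?_, ?_⟩
  · simp_rw [hpk]
    exact hint.integral_prod_left.const_mul _
  · simp_rw [hpk]
    rw [integral_const_mul, hswap]
    field_simp

/-! ### Differentiation of the Poisson integral -/

/-- Integrability of `v` against the weight `(1 + |z|)^{-(n+1)}`, which is what makes the Poisson
integral of `v` converge. -/
def PoissonIntegrable (v : Rn n → Rn m) : Prop :=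
  Integrable fun z => ((1 + ‖z‖) ^ (n + 1))⁻¹ • v z

lemma integrable_weight (n : ℕ) : Integrable fun z : Rn n => ((1 + ‖z‖) ^ (n + 1))⁻¹ := by
  have h := integrable_one_add_norm (E := Rn n) (μ := volume) (r := (n : ℝ) + 1)
    (by rw [finrank_euclideanSpace, Fintype.card_fin]; linarith)
  refine h.congr (Filter.Eventually.of_forall fun z => ?_)
  simp only
  rw [Real.rpow_neg (by positivity), ← Real.rpow_natCast]
  norm_cast

lemma poissonIntegrable_const (c : Rn m) : PoissonIntegrable (fun _ : Rn n => c) :=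
  (integrable_weight n).smul_const c

lemma PoissonIntegrable.sub {v w : Rn n → Rn m} (hv : PoissonIntegrable v)
    (hw : PoissonIntegrable w) : PoissonIntegrable (fun z => v z - w z) := by
  refine (Integrable.sub hv hw).congr (Filter.Eventually.of_forall fun z => ?_)
  simp [smul_sub]

lemma PoissonIntegrable.aestronglyMeasurable {v : Rn n → Rn m} (hv : PoissonIntegrable v) :
    AEStronglyMeasurable v volume := by
  have h : Continuous fun z : Rn n => (1 + ‖z‖) ^ (n + 1) := by fun_prop
  refine (h.aestronglyMeasurable.smul (Integrable.aestronglyMeasurable hv)).congr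
    (Filter.Eventually.of_forall fun z => ?_)
  have : (1 + ‖z‖) ^ (n + 1) ≠ 0 := by positivity
  simp [smul_smul, mul_inv_cancel₀ this]

lemma height_le_norm_sub_emb (x : Rn (n + 1)) (z : Rn n) : height x ≤ ‖x - emb z‖ := by
  have := abs_height_le (x - emb z)
  rw [height_sub, height_emb, sub_zero] at this
  exact (le_abs_self _).trans this

lemma sub_emb_ne_zero {x : Rn (n + 1)} (hx : 0 < height x) (z : Rn n) : x - emb z ≠ 0 := by
  rw [← norm_pos_iff]; exact hx.trans_le (height_le_norm_sub_emb x z)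

lemma one_add_norm_le {x : Rn (n + 1)} (hx : 0 < height x) (z : Rn n) :
    1 + ‖z‖ ≤ ((1 + ‖x‖) / height x + 1) * ‖x - emb z‖ := by
  have h1 := height_le_norm_sub_emb x z
  have h2 : ‖z‖ ≤ ‖x‖ + ‖x - emb z‖ := by
    rw [← norm_emb z]
    calc ‖emb z‖ = ‖x - (x - emb z)‖ := by congr 1; abel
      _ ≤ _ := norm_sub_le _ _
  have h3 : 1 + ‖x‖ ≤ (1 + ‖x‖) / height x * ‖x - emb z‖ := by
    rw [div_mul_eq_mul_div, le_div_iff₀ hx]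
    exact mul_le_mul_of_nonneg_left h1 (by positivity)
  linarith

/-- The kernel is dominated by the Poisson weight, with a constant that is locally bounded in `x`. -/
lemma inv_norm_sub_emb_pow_le {x : Rn (n + 1)} (hx : 0 < height x) (z : Rn n) :
    (‖x - emb z‖ ^ (n + 1))⁻¹ ≤
      ((1 + ‖x‖) / height x + 1) ^ (n + 1) * ((1 + ‖z‖) ^ (n + 1))⁻¹ := by
  have h1 := one_add_norm_le hx z
  have h2 : 0 < ‖x - emb z‖ := hx.trans_le (height_le_norm_sub_emb x z)
  rw [inv_le_iff_one_le_mul₀ (by positivity), mul_right_comm, ← mul_pow, ← div_eq_mul_inv,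
    one_le_div (by positivity)]
  gcongr

lemma abs_pk_le {x : Rn (n + 1)} (hx : x ≠ 0) :
    |pk x| ≤ gammaConst n * |height x| / ‖x‖ ^ (n + 1) := by
  rw [pk, sq_norm_rpow, abs_mul, abs_mul, abs_of_pos (gammaConst_pos n),
    abs_of_nonneg (by positivity : 0 ≤ (‖x‖ ^ (n + 1))⁻¹), ← mul_assoc]
  exact le_of_eq (by ring)

lemma measurable_pk : Measurable (pk (n := n)) := by
  unfold pk
  have := (continuous_height (n := n)).measurable
  fun_prop

lemma measurable_pkGrad : Measurable (pkGrad (n := n)) := by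
  unfold pkGrad
  have := (continuous_height (n := n)).measurable
  have h2 : Measurable (fun x : Rn (n + 1) => innerSL ℝ x) := (innerSL ℝ).continuous.measurable
  fun_prop

lemma integrable_pk_smul {v : Rn n → Rn m} (hv : PoissonIntegrable v) {x : Rn (n + 1)}
    (hx : 0 < height x) : Integrable fun z => pk (x - emb z) • v z := by
  have hm : Measurable fun z : Rn n => pk (x - emb z) :=
    measurable_pk.comp (continuous_const.sub continuous_emb).measurable
  refine ((Integrable.norm hv).const_mul (gammaConst n * height x *
    ((1 + ‖x‖) / height x + 1) ^ (n + 1))).mono'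
      (hm.aestronglyMeasurable.smul hv.aestronglyMeasurable)
      (Filter.Eventually.of_forall fun z => ?_)
  have h1 := abs_pk_le (sub_emb_ne_zero hx z)
  rw [height_sub, height_emb, sub_zero, abs_of_pos hx] at h1
  have h2 := inv_norm_sub_emb_pow_le hx z
  rw [norm_smul, norm_smul, Real.norm_eq_abs, Real.norm_of_nonneg (by positivity), ← mul_assoc]
  gcongr
  calc _ ≤ gammaConst n * height x * (‖x - emb z‖ ^ (n + 1))⁻¹ := h1
    _ ≤ gammaConst n * height x * (((1 + ‖x‖) / height x + 1) ^ (n + 1) *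
      ((1 + ‖z‖) ^ (n + 1))⁻¹) := mul_le_mul_of_nonneg_left h2
        (mul_nonneg (gammaConst_pos n).le hx.le)
    _ = _ := by ring

lemma norm_pkGrad_sub_le {x : Rn (n + 1)} (hx : 0 < height x) (z : Rn n) :
    ‖pkGrad (x - emb z)‖ ≤ gammaConst n * (n + 2) * ((1 + ‖x‖) / height x + 1) ^ (n + 1) *
      ((1 + ‖z‖) ^ (n + 1))⁻¹ := by
  refine (norm_pkGrad_le (sub_emb_ne_zero hx z)).trans ?_
  rw [div_eq_mul_inv, mul_assoc (gammaConst n * (n + 2))]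
  exact mul_le_mul_of_nonneg_left (inv_norm_sub_emb_pow_le hx z)
    (mul_nonneg (gammaConst_pos n).le (by positivity))

lemma integrable_pkGrad_smulRight {v : Rn n → Rn m} (hv : PoissonIntegrable v) {x : Rn (n + 1)}
    (hx : 0 < height x) : Integrable fun z => (pkGrad (x - emb z)).smulRight (v z) := by
  have hm : Measurable fun z : Rn n => pkGrad (x - emb z) :=
    measurable_pkGrad.comp (continuous_const.sub continuous_emb).measurable
  refine ((Integrable.norm hv).const_mul (gammaConst n * (n + 2) *
    ((1 + ‖x‖) / height x + 1) ^ (n + 1))).mono' ?_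
      (Filter.Eventually.of_forall fun z => ?_)
  · exact (ContinuousLinearMap.smulRightL ℝ (Rn (n + 1)) (Rn m)).aestronglyMeasurable_comp₂
      hm.aestronglyMeasurable hv.aestronglyMeasurable
  · rw [ContinuousLinearMap.norm_smulRight_apply, norm_smul, Real.norm_of_nonneg (by positivity),
      ← mul_assoc]
    gcongr
    exact norm_pkGrad_sub_le hx z

/-- The Poisson integral may be differentiated under the integral sign. -/
lemma hasFDerivAt_harmExt {v : Rn n → Rn m} (hv : PoissonIntegrable v) {x : Rn (n + 1)}
    (hx : 0 < height x) :
    HasFDerivAt (harmExt v) (∫ z, (pkGrad (x - emb z)).smulRight (v z)) x := by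
  have e : harmExt v = fun x => ∫ z, pk (x - emb z) • v z :=
    funext fun x => harmExt_eq_integral_pk v x
  have hpos : ∀ y ∈ Metric.ball x (height x / 2), height x / 2 < height y := by
    intro y hy
    have h1 := abs_height_le (y - x)
    rw [height_sub] at h1
    rw [Metric.mem_ball, dist_eq_norm] at hy
    have := neg_le_of_abs_le h1
    linarith
  rw [e]
  refine hasFDerivAt_integral_of_dominated_of_fderiv_le (F := fun y z => pk (y - emb z) • v z)
    (F' := fun y z => (pkGrad (y - emb z)).smulRight (v z))
    (bound := fun z => gammaConst n * (n + 2) *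
      ((1 + (‖x‖ + height x / 2)) / (height x / 2) + 1) ^ (n + 1) *
        ‖((1 + ‖z‖) ^ (n + 1))⁻¹ • v z‖)
    (Metric.ball_mem_nhds x (half_pos hx)) ?_ (integrable_pk_smul hv hx)
    (integrable_pkGrad_smulRight hv hx).aestronglyMeasurable ?_
    ((Integrable.norm hv).const_mul _) ?_
  · filter_upwards [isOpen_upperHalf.mem_nhds hx] with y hy
    exact (integrable_pk_smul hv hy).aestronglyMeasurable
  · refine Filter.Eventually.of_forall fun z y hy => ?_
    have hy' : 0 < height y := (half_pos hx).trans (hpos y hy)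
    rw [ContinuousLinearMap.norm_smulRight_apply, norm_smul, Real.norm_of_nonneg (by positivity),
      ← mul_assoc]
    gcongr
    refine (norm_pkGrad_sub_le hy' z).trans ?_
    have := (gammaConst_pos n)
    have h3 : ‖y‖ ≤ ‖x‖ + height x / 2 := by
      rw [Metric.mem_ball, dist_eq_norm] at hy
      have := norm_add_le x (y - x)
      rw [add_sub_cancel] at this
      linarith
    have h4 := (hpos y hy).le
    gcongr
  · refine Filter.Eventually.of_forall fun z y hy => ?_
    have hy' : 0 < height y := (half_pos hx).trans (hpos y hy)
    have := (hasFDerivAt_pk (sub_emb_ne_zero hy' z)).comp y ((hasFDerivAt_id y).sub_const (emb z))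
    exact HasFDerivAt.smul_const this (v z)

lemma integral_pk_sub_emb {x : Rn (n + 1)} (hx : 0 < height x) :
    ∫ z, pk (x - emb z) = 1 := by
  rw [← (integral_pk (n := n) hx).2, ← integral_sub_left_eq_self _ volume (horiz x)]
  refine integral_congr_ae (Filter.Eventually.of_forall fun z => ?_)
  simp only
  have h := up_sub_emb (horiz x) (horiz x - z) (height x)
  rw [up_horiz_height, sub_sub_cancel] at h
  rw [h]

lemma harmExt_sub {v w : Rn n → Rn m} (hv : PoissonIntegrable v) (hw : PoissonIntegrable w)
    {x : Rn (n + 1)} (hx : 0 < height x) :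
    harmExt (fun z => v z - w z) x = harmExt v x - harmExt w x := by
  simp_rw [harmExt_eq_integral_pk, smul_sub]
  exact integral_sub (integrable_pk_smul hv hx) (integrable_pk_smul hw hx)

lemma harmExt_const (c : Rn m) {x : Rn (n + 1)} (hx : 0 < height x) :
    harmExt (fun _ => c) x = c := by
  rw [harmExt_eq_integral_pk, integral_smul_const, integral_pk_sub_emb hx, one_smul]

/-- Since the Poisson kernel has constant mass, subtracting a constant does not change the gradient
of the extension. -/
lemma fderiv_harmExt_eq {v : Rn n → Rn m} (hv : PoissonIntegrable v) (c : Rn m) {x : Rn (n + 1)}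
    (hx : 0 < height x) :
    fderiv ℝ (harmExt v) x = ∫ z, (pkGrad (x - emb z)).smulRight (v z - c) := by
  have h1 := hasFDerivAt_harmExt (hv.sub (poissonIntegrable_const c)) hx
  have h2 : (fun y => harmExt v y) =ᶠ[nhds x] fun y => harmExt (fun z => v z - c) y + c := by
    filter_upwards [isOpen_upperHalf.mem_nhds hx] with y hy
    rw [harmExt_sub hv (poissonIntegrable_const c) hy, harmExt_const c hy, sub_add_cancel]
  exact ((h1.add_const c).congr_of_eventuallyEq h2).fderiv

lemma fderiv_harmExt_sub {v w : Rn n → Rn m} (hv : PoissonIntegrable v)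
    (hw : PoissonIntegrable w) {x : Rn (n + 1)} (hx : 0 < height x) :
    fderiv ℝ (harmExt fun z => v z - w z) x = fderiv ℝ (harmExt v) x - fderiv ℝ (harmExt w) x := by
  have h2 : (harmExt fun z => v z - w z) =ᶠ[nhds x] fun y => harmExt v y - harmExt w y := by
    filter_upwards [isOpen_upperHalf.mem_nhds hx] with y hy
    exact harmExt_sub hv hw hy
  rw [h2.fderiv_eq]
  exact fderiv_fun_sub (hasFDerivAt_harmExt hv hx).differentiableAt
    (hasFDerivAt_harmExt hw hx).differentiableAt

/-! ### Gradient bound for the harmonic extension -/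

/-- The Cauchy-Schwarz inequality. -/
lemma sq_lintegral_mul_le {α : Type*} [MeasurableSpace α] {μ : Measure α} {f g : α → ℝ≥0∞}
    (hf : AEMeasurable f μ) (hg : AEMeasurable g μ) :
    (∫⁻ a, f a * g a ∂μ) ^ 2 ≤ (∫⁻ a, f a ^ 2 ∂μ) * ∫⁻ a, g a ^ 2 ∂μ := by
  have h2 := ENNReal.lintegral_mul_le_Lp_mul_Lq μ Real.HolderConjugate.two_two hf hg
  calc _ ≤ ((∫⁻ z, f z ^ (2 : ℝ) ∂μ) ^ (1 / (2 : ℝ)) *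
        (∫⁻ z, g z ^ (2 : ℝ) ∂μ) ^ (1 / (2 : ℝ))) ^ 2 := by
        gcongr; exact h2
    _ = _ := by
        rw [mul_pow, ← ENNReal.rpow_natCast, ← ENNReal.rpow_natCast, ← ENNReal.rpow_mul,
          ← ENNReal.rpow_mul]
        norm_num

lemma integrable_one_add_sq_rpow (n : ℕ) :
    Integrable fun z : Rn n => (1 + ‖z‖ ^ 2) ^ (-((n : ℝ) + 1 / 2) / 2) :=
  integrable_rpow_neg_one_add_norm_sq (by rw [finrank_euclideanSpace, Fintype.card_fin]; linarith)

/-- Scaling out the height from the integral of a power of the distance to a boundary point. -/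
lemma lintegral_sq_add_rpow (x' : Rn n) {s : ℝ} (hs : 0 < s) :
    ∫⁻ z : Rn n, ENNReal.ofReal ((‖x' - z‖ ^ 2 + s ^ 2) ^ (-((n : ℝ) + 1 / 2) / 2)) =
      ENNReal.ofReal (s ^ (-(1 / 2) : ℝ) *
        ∫ z : Rn n, (1 + ‖z‖ ^ 2) ^ (-((n : ℝ) + 1 / 2) / 2)) := by
  set q : ℝ := -((n : ℝ) + 1 / 2) / 2 with hq
  have h0 := integrable_one_add_sq_rpow n
  rw [← hq] at h0
  have e : ∀ z : Rn n, (‖z‖ ^ 2 + s ^ 2) ^ q = (s ^ 2) ^ q * (1 + ‖s⁻¹ • z‖ ^ 2) ^ q := by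
    intro z
    rw [← Real.mul_rpow (by positivity) (by positivity), norm_smul, norm_inv, Real.norm_of_nonneg hs.le]
    congr 1
    field_simp
    ring
  have h1 : Integrable fun z : Rn n => (‖z‖ ^ 2 + s ^ 2) ^ q := by
    simp_rw [e]
    exact (h0.comp_smul (inv_ne_zero hs.ne')).const_mul _
  rw [← ofReal_integral_eq_lintegral_ofReal]
  · congr 1
    rw [integral_sub_left_eq_self (fun z : Rn n => (‖z‖ ^ 2 + s ^ 2) ^ q) volume x']
    simp_rw [e]
    rw [integral_const_mul,
      Measure.integral_comp_smul volume (fun z : Rn n => (1 + ‖z‖ ^ 2) ^ q), smul_eq_mul, ← mul_assoc,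
      finrank_euclideanSpace, Fintype.card_fin]
    congr 1
    rw [abs_of_pos (by positivity), inv_pow, inv_inv, ← Real.rpow_natCast s 2, ← Real.rpow_mul hs.le,
      ← Real.rpow_natCast s n, ← Real.rpow_add hs]
    congr 1
    rw [hq]; push_cast; ring
  · exact h1.comp_sub_left x'
  · exact Filter.Eventually.of_forall fun z => by positivity

/-- The constant in the pointwise gradient bound. -/
noncomputable def gradConst (n : ℕ) : ℝ :=
  (gammaConst n * (n + 2)) ^ 2 * ∫ z : Rn n, (1 + ‖z‖ ^ 2) ^ (-((n : ℝ) + 1 / 2) / 2)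

lemma gradConst_nonneg (n : ℕ) : 0 ≤ gradConst n :=
  mul_nonneg (sq_nonneg _) (integral_nonneg fun z => by positivity)

/-- Pointwise bound for the gradient of the extension. The Cauchy-Schwarz inequality is applied
with the weight `(s / ρ)^{1/2}`, `ρ` the distance to the boundary point: without it
the bound below would fail, logarithmically, to be integrable in `s`. -/
lemma sq_norm_fderiv_harmExt_le {v : Rn n → Rn m} (hv : PoissonIntegrable v) (c : Rn m)
    (x' : Rn n) {s : ℝ} (hs : 0 < s) :
    ENNReal.ofReal (‖fderiv ℝ (harmExt v) (up x' s)‖ ^ 2) ≤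
      ENNReal.ofReal (gradConst n) * ∫⁻ z, ENNReal.ofReal (s ^ (-(1 / 2) : ℝ) *
        (‖x' - z‖ ^ 2 + s ^ 2) ^ (-((n : ℝ) + 3 / 2) / 2)) * ENNReal.ofReal (‖v z - c‖ ^ 2) := by
  have hx : 0 < height (up x' s) := by simpa using hs
  set K : ℝ := gammaConst n * (n + 2) with hK
  have hK0 : 0 ≤ K := mul_nonneg (gammaConst_pos n).le (by positivity)
  set Q : Rn n → ℝ := fun z => ‖x' - z‖ ^ 2 + s ^ 2 with hQ
  have hQ0 : ∀ z, 0 < Q z := fun z => by simp only [hQ]; positivity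
  -- with `ρ² = Q`, the kernel `ρ^{-(n+1)}` is split as `ρ^{-(n+1/2)/2} * ρ^{-(n+3/2)/2}`
  let f : Rn n → ℝ≥0∞ := fun z => ENNReal.ofReal (Q z ^ (-((n : ℝ) + 1 / 2) / 4))
  let g : Rn n → ℝ≥0∞ := fun z =>
    ENNReal.ofReal (K * Q z ^ (-((n : ℝ) + 3 / 2) / 4) * ‖v z - c‖)
  have hQm : Measurable Q := by simp only [hQ]; fun_prop
  have hf : AEMeasurable f := by
    simp only [f]; exact (hQm.pow_const _).ennreal_ofReal.aemeasurable
  have hg : AEMeasurable g := by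
    simp only [g]
    exact ((((hQm.pow_const _).const_mul K).aemeasurable).mul
      (hv.aestronglyMeasurable.sub aestronglyMeasurable_const).norm.aemeasurable).ennreal_ofReal
  have h1 : ‖fderiv ℝ (harmExt v) (up x' s)‖ₑ ≤ ∫⁻ z, (f * g) z := by
    rw [fderiv_harmExt_eq hv c hx]
    refine (enorm_integral_le_lintegral_enorm _).trans (lintegral_mono fun z => ?_)
    rw [← ofReal_norm, ContinuousLinearMap.norm_smulRight_apply, Pi.mul_apply,
      ← ENNReal.ofReal_mul (by positivity)]
    refine ENNReal.ofReal_le_ofReal ?_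
    have h := norm_pkGrad_le (sub_emb_ne_zero hx z)
    rw [div_eq_mul_inv, ← sq_norm_rpow, up_sub_emb, norm_sq_up] at h
    have e : Q z ^ (-(((n : ℝ) + 1) / 2)) =
        Q z ^ (-((n : ℝ) + 1 / 2) / 4) * Q z ^ (-((n : ℝ) + 3 / 2) / 4) := by
      rw [← Real.rpow_add (hQ0 z)]; congr 1; ring
    rw [show ‖x' - z‖ ^ 2 + s ^ 2 = Q z from rfl, e] at h
    rw [up_sub_emb]
    calc _ ≤ K * (Q z ^ (-((n : ℝ) + 1 / 2) / 4) * Q z ^ (-((n : ℝ) + 3 / 2) / 4)) * ‖v z - c‖ :=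
          mul_le_mul_of_nonneg_right h (norm_nonneg _)
      _ = _ := by ring
  have h3 : ‖fderiv ℝ (harmExt v) (up x' s)‖ₑ ^ 2 ≤ (∫⁻ z, f z ^ 2) * ∫⁻ z, g z ^ 2 :=
    (pow_le_pow_left' h1 2).trans (sq_lintegral_mul_le hf hg)
  have hf2 : ∫⁻ z, f z ^ 2 = ENNReal.ofReal (s ^ (-(1 / 2) : ℝ) *
      ∫ z : Rn n, (1 + ‖z‖ ^ 2) ^ (-((n : ℝ) + 1 / 2) / 2)) := by
    rw [← lintegral_sq_add_rpow x' hs]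
    refine lintegral_congr fun z => ?_
    simp only [f]
    rw [← ENNReal.ofReal_pow (Real.rpow_nonneg (hQ0 z).le _), ← Real.rpow_mul_natCast (hQ0 z).le]
    congr 2
    push_cast; ring
  have hg2 : ∫⁻ z, g z ^ 2 = ENNReal.ofReal (K ^ 2) * ∫⁻ z, ENNReal.ofReal
      (Q z ^ (-((n : ℝ) + 3 / 2) / 2)) * ENNReal.ofReal (‖v z - c‖ ^ 2) := by
    rw [← lintegral_const_mul' _ _ ENNReal.ofReal_ne_top]
    refine lintegral_congr fun z => ?_
    have := Real.rpow_nonneg (hQ0 z).le (-((n : ℝ) + 3 / 2) / 4)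
    simp only [g]
    rw [← ENNReal.ofReal_pow (by positivity), ← ENNReal.ofReal_mul (Real.rpow_nonneg (hQ0 z).le _),
      ← ENNReal.ofReal_mul (by positivity), mul_pow, mul_pow, ← Real.rpow_mul_natCast (hQ0 z).le]
    congr 1
    rw [mul_assoc]
    congr 3
    push_cast; ring
  rw [ENNReal.ofReal_pow (norm_nonneg _), ofReal_norm]
  refine h3.trans (le_of_eq ?_)
  rw [hf2, hg2, gradConst]
  have e2 : ∀ z, ENNReal.ofReal (s ^ (-(1 / 2) : ℝ) * Q z ^ (-((n : ℝ) + 3 / 2) / 2)) *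
      ENNReal.ofReal (‖v z - c‖ ^ 2) = ENNReal.ofReal (s ^ (-(1 / 2) : ℝ)) * (ENNReal.ofReal
      (Q z ^ (-((n : ℝ) + 3 / 2) / 2)) * ENNReal.ofReal (‖v z - c‖ ^ 2)) := fun z => by
    rw [ENNReal.ofReal_mul (by positivity), mul_assoc]
  simp_rw [show ∀ z, ‖x' - z‖ ^ 2 + s ^ 2 = Q z from fun _ => rfl, e2]
  rw [lintegral_const_mul' _ _ ENNReal.ofReal_ne_top, ENNReal.ofReal_mul (by positivity),
    ENNReal.ofReal_mul (by positivity)]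
  ring

/-- Integrating the gradient bound in the height gives the kernel `r^{-(n+1)}` of the two-point energy;
the ranges `s ≤ r` and `s > r` are estimated separately. -/
lemma lintegral_height_le {r : ℝ} (hr : 0 < r) :
    ∫⁻ s in Ioi (0 : ℝ), ENNReal.ofReal (s ^ (-(1 / 2) : ℝ) *
      (r ^ 2 + s ^ 2) ^ (-((n : ℝ) + 3 / 2) / 2)) ≤ ENNReal.ofReal (3 / r ^ (n + 1)) := by
  have hneg : -((n : ℝ) + 3 / 2) / 2 ≤ 0 := by
    have : (0 : ℝ) ≤ n := Nat.cast_nonneg n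
    linarith
  have hsq : ∀ t : ℝ, 0 < t → (t ^ 2) ^ (-((n : ℝ) + 3 / 2) / 2) = t ^ (-((n : ℝ) + 3 / 2)) :=
    fun t ht => by
      rw [← Real.rpow_natCast t 2, ← Real.rpow_mul ht.le]; congr 1; push_cast; ring
  rw [← Ioc_union_Ioi_eq_Ioi hr.le]
  refine (lintegral_union_le _ _ _).trans ?_
  have h1 : ∫⁻ s in Ioc 0 r, ENNReal.ofReal (s ^ (-(1 / 2) : ℝ) *
      (r ^ 2 + s ^ 2) ^ (-((n : ℝ) + 3 / 2) / 2)) ≤ ENNReal.ofReal (2 / r ^ (n + 1)) := by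
    calc _ ≤ ∫⁻ s in Ioc 0 r, ENNReal.ofReal (s ^ (-(1 / 2) : ℝ) * r ^ (-((n : ℝ) + 3 / 2))) := by
          refine setLIntegral_mono' measurableSet_Ioc fun s hs => ENNReal.ofReal_le_ofReal ?_
          have : 0 < s := hs.1
          rw [← hsq r hr]
          gcongr ?_ * ?_
          exact Real.rpow_le_rpow_of_nonpos (by positivity) (by nlinarith) hneg
      _ = ENNReal.ofReal (∫ s in Ioc 0 r, s ^ (-(1 / 2) : ℝ) * r ^ (-((n : ℝ) + 3 / 2))) := by
          rw [ofReal_integral_eq_lintegral_ofReal]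
          · refine Integrable.mul_const ?_ _
            exact (intervalIntegrable_iff_integrableOn_Ioc_of_le hr.le).1
              (intervalIntegral.intervalIntegrable_rpow' (by norm_num))
          · filter_upwards [self_mem_ae_restrict measurableSet_Ioc] with s hs
            have : 0 < s := hs.1
            positivity
      _ ≤ _ := by
          refine ENNReal.ofReal_le_ofReal (le_of_eq ?_)
          rw [integral_mul_const, ← intervalIntegral.integral_of_le hr.le,
            integral_rpow (Or.inl (by norm_num)), Real.zero_rpow (by norm_num), sub_zero,
            div_mul_eq_mul_div, ← Real.rpow_add hr, ← Real.rpow_natCast r (n + 1)]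
          have : r ^ (-(1 / 2 : ℝ) + 1 + -((n : ℝ) + 3 / 2)) = (r ^ ((n + 1 : ℕ) : ℝ))⁻¹ := by
            rw [← Real.rpow_neg hr.le]; congr 1; push_cast; ring
          rw [this]
          norm_num
          ring
  have h2 : ∫⁻ s in Ioi r, ENNReal.ofReal (s ^ (-(1 / 2) : ℝ) *
      (r ^ 2 + s ^ 2) ^ (-((n : ℝ) + 3 / 2) / 2)) ≤ ENNReal.ofReal (1 / r ^ (n + 1)) := by
    have hlt : -((n : ℝ) + 2) < -1 := by
      have : (0 : ℝ) ≤ n := Nat.cast_nonneg n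
      linarith
    calc _ ≤ ∫⁻ s in Ioi r, ENNReal.ofReal (s ^ (-((n : ℝ) + 2))) := by
          refine setLIntegral_mono' measurableSet_Ioi fun s hs => ENNReal.ofReal_le_ofReal ?_
          have hs0 : 0 < s := hr.trans hs
          have : s ^ (-((n : ℝ) + 2)) = s ^ (-(1 / 2) : ℝ) * s ^ (-((n : ℝ) + 3 / 2)) := by
            rw [← Real.rpow_add hs0]; congr 1; ring
          rw [this, ← hsq s hs0]
          gcongr ?_ * ?_
          exact Real.rpow_le_rpow_of_nonpos (by positivity) (by nlinarith) hneg
      _ = ENNReal.ofReal (∫ s in Ioi r, s ^ (-((n : ℝ) + 2))) := by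
          rw [ofReal_integral_eq_lintegral_ofReal]
          · exact integrableOn_Ioi_rpow_of_lt hlt hr
          · filter_upwards [self_mem_ae_restrict measurableSet_Ioi] with s hs
            have : 0 < s := hr.trans hs
            positivity
      _ ≤ _ := by
          refine ENNReal.ofReal_le_ofReal ?_
          rw [integral_Ioi_rpow_of_lt hlt hr]
          have : r ^ (-((n : ℝ) + 2) + 1) = (r ^ (n + 1))⁻¹ := by
            rw [← Real.rpow_natCast r (n + 1), ← Real.rpow_neg hr.le]; congr 1; push_cast; ring
          rw [this, show -((n : ℝ) + 2) + 1 = -(n + 1) by ring, neg_div_neg_eq, ← one_div]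
          have : (1 : ℝ) ≤ n + 1 := by
            have : (0 : ℝ) ≤ n := Nat.cast_nonneg n
            linarith
          exact div_le_self (by positivity) this
  refine (add_le_add h1 h2).trans (le_of_eq ?_)
  rw [← ENNReal.ofReal_add (by positivity) (by positivity)]
  congr 1
  ring

/-- The Dirichlet integral of the extension over the half-cylinder above `s` is controlled by
the two-point energy. -/
lemma lintegral_cylinder_le {v : Rn n → Rn m} (hv : PoissonIntegrable v) (S : Set (Rn n)) :
    ∫⁻ x in S, ∫⁻ s in Ioi (0 : ℝ), ENNReal.ofReal (‖fderiv ℝ (harmExt v) (up x s)‖ ^ 2) ≤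
      ENNReal.ofReal (3 * gradConst n) * ∫⁻ x in S, ∫⁻ z, pairDensity v (x, z) := by
  rw [← lintegral_const_mul' _ _ ENNReal.ofReal_ne_top]
  refine lintegral_mono fun x => ?_
  -- above `x` the constant subtracted from `v` is `v x`
  calc _ ≤ ∫⁻ s in Ioi (0 : ℝ), ENNReal.ofReal (gradConst n) *
        ∫⁻ z, ENNReal.ofReal (s ^ (-(1 / 2) : ℝ) *
        (‖x - z‖ ^ 2 + s ^ 2) ^ (-((n : ℝ) + 3 / 2) / 2)) * ENNReal.ofReal (‖v z - v x‖ ^ 2) :=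
        setLIntegral_mono' measurableSet_Ioi fun s hs => sq_norm_fderiv_harmExt_le hv (v x) x hs
    _ = ENNReal.ofReal (gradConst n) * ∫⁻ z, ∫⁻ s in Ioi (0 : ℝ),
        ENNReal.ofReal (s ^ (-(1 / 2) : ℝ) *
        (‖x - z‖ ^ 2 + s ^ 2) ^ (-((n : ℝ) + 3 / 2) / 2)) * ENNReal.ofReal (‖v z - v x‖ ^ 2) := by
        rw [lintegral_const_mul' _ _ ENNReal.ofReal_ne_top, lintegral_lintegral_swap]
        have h1 : Measurable fun p : ℝ × Rn n => ENNReal.ofReal (p.1 ^ (-(1 / 2) : ℝ) *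
            (‖x - p.2‖ ^ 2 + p.1 ^ 2) ^ (-((n : ℝ) + 3 / 2) / 2)) := by fun_prop
        have h2 : AEMeasurable (fun p : ℝ × Rn n => ENNReal.ofReal (‖v p.2 - v x‖ ^ 2))
            ((volume.restrict (Ioi (0 : ℝ))).prod volume) :=
          ((hv.aestronglyMeasurable.sub aestronglyMeasurable_const).norm.aemeasurable.pow_const
            2).ennreal_ofReal.comp_snd
        exact h1.aemeasurable.mul h2
    _ ≤ ENNReal.ofReal (gradConst n) * ∫⁻ z, ENNReal.ofReal 3 * pairDensity v (x, z) := by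
        gcongr with z
        rw [lintegral_mul_const' _ _ ENNReal.ofReal_ne_top]
        rcases eq_or_ne x z with rfl | hxz
        · simp
        · have hr : 0 < ‖x - z‖ := norm_pos_iff.mpr (sub_ne_zero.mpr hxz)
          refine (mul_le_mul_left (lintegral_height_le hr) _).trans (le_of_eq ?_)
          rw [pairDensity, ← ENNReal.ofReal_mul (by positivity), ← ENNReal.ofReal_mul (by norm_num),
            norm_sub_rev (v z)]
          congr 1
          ring
    _ = _ := by
        rw [lintegral_const_mul' _ _ ENNReal.ofReal_ne_top, ← mul_assoc,
          ← ENNReal.ofReal_mul (gradConst_nonneg n), mul_comm (gradConst n)]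

/-! ### The two-point energy and quadratic functionals -/

/-- The pairs of points at least one of which lies in `ω`. -/
def touch (ω : Set (Rn n)) : Set (Rn n × Rn n) := {p | p.1 ∈ ω ∨ p.2 ∈ ω}

lemma measurableSet_touch {ω : Set (Rn n)} (hω : MeasurableSet ω) : MeasurableSet (touch ω) :=
  (measurable_fst hω).union (measurable_snd hω)

lemma touch_mono {ω ω' : Set (Rn n)} (h : ω' ⊆ ω) : touch ω' ⊆ touch ω :=
  fun _ hp => hp.imp (fun h' => h h') (fun h' => h h')

/-- The integral of the two-point energy density over all pairs meeting `ω`. -/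
noncomputable def pairEnergy (v : Rn n → Rn m) (ω : Set (Rn n)) : ℝ≥0∞ :=
  ∫⁻ p in touch ω, pairDensity v p

lemma pairDensity_swap (v : Rn n → Rn m) (p : Rn n × Rn n) :
    pairDensity v p.swap = pairDensity v p := by
  simp [pairDensity, norm_sub_rev (v p.2), norm_sub_rev p.2]

/-- By symmetry of the density, `𝓔(v, ω)` is `γ_n / 4` times the energy of the pairs meeting `ω`. -/
lemma halfEnergy_eq (v : Rn n → Rn m) {ω : Set (Rn n)} (hω : MeasurableSet ω) :
    halfEnergy v ω = ENNReal.ofReal (gammaConst n / 4) * pairEnergy v ω := by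
  have h1 : touch ω = (ω ×ˢ ω ∪ ω ×ˢ ωᶜ) ∪ ωᶜ ×ˢ ω := by
    ext p; simp only [touch, mem_ofPred_eq, mem_union, mem_prod, mem_compl_iff]; tauto
  have hsw : ∫⁻ p in ωᶜ ×ˢ ω, pairDensity v p = ∫⁻ p in ω ×ˢ ωᶜ, pairDensity v p := by
    have h2 : MeasurePreserving (Prod.swap : Rn n × Rn n → _) volume volume :=
      Measure.measurePreserving_swap
    rw [← h2.setLIntegral_comp_preimage_emb MeasurableEquiv.prodComm.measurableEmbedding]
    simp_rw [pairDensity_swap]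
    rw [preimage_swap_prod]
  have d1 : Disjoint (ω ×ˢ ω ∪ ω ×ˢ ωᶜ) (ωᶜ ×ˢ ω) := by
    rw [Set.disjoint_left]; rintro p (hp | hp) hp' <;> exact hp'.1 hp.1
  have d2 : Disjoint (ω ×ˢ ω) (ω ×ˢ ωᶜ) := by
    rw [Set.disjoint_left]; intro p hp hp'; exact hp'.2 hp.2
  have e : ENNReal.ofReal (gammaConst n / 2) = ENNReal.ofReal (gammaConst n / 4) * 2 := by
    rw [show gammaConst n / 2 = gammaConst n / 4 * 2 by ring,
      ENNReal.ofReal_mul (by have := gammaConst_pos n; positivity)]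
    simp
  rw [halfEnergy, pairEnergy, h1, lintegral_union (hω.compl.prod hω) d1,
    lintegral_union (hω.prod hω.compl) d2, hsw, e]
  ring

lemma aemeasurable_pairDensity {v : Rn n → Rn m} (hv : AEStronglyMeasurable v volume) :
    AEMeasurable (pairDensity v) ((volume : Measure (Rn n)).prod volume) := by
  have h1 : AEStronglyMeasurable (fun p : Rn n × Rn n => v p.1 - v p.2)
    ((volume : Measure (Rn n)).prod volume) := hv.comp_fst.sub hv.comp_snd
  exact ((h1.norm.aemeasurable.pow_const 2).div
    (Measurable.aemeasurable (by fun_prop))).ennreal_ofReal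

lemma lintegral_lintegral_pairDensity_le {v : Rn n → Rn m} (hv : AEStronglyMeasurable v volume)
    {ω : Set (Rn n)} : ∫⁻ x in ω, ∫⁻ z, pairDensity v (x, z) ≤ pairEnergy v ω := by
  have h : ((volume : Measure (Rn n)).restrict ω).prod volume =
      (volume : Measure (Rn n × Rn n)).restrict (ω ×ˢ univ) := by
    rw [Measure.volume_eq_prod, ← Measure.prod_restrict, Measure.restrict_univ]
  have h2 := (aemeasurable_pairDensity hv).restrict (s := ω ×ˢ univ)
  rw [← lintegral_prod _ (by rw [h]; exact h2), h]
  exact lintegral_mono_set fun p hp => Or.inl hp.1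

/-- Maps with a convergent Poisson integral and finite energy near `ω`. -/
structure FiniteEnergy (v : Rn n → Rn m) (ω : Set (Rn n)) : Prop where
  poissonIntegrable : PoissonIntegrable v
  lt_top : pairEnergy v ω < ∞

lemma FiniteEnergy.mono {v : Rn n → Rn m} {ω ω' : Set (Rn n)} (hv : FiniteEnergy v ω)
    (h : ω' ⊆ ω) : FiniteEnergy v ω' :=
  ⟨hv.1, (lintegral_mono_set (touch_mono h)).trans_lt hv.2⟩

/-- Local square integrability includes measurability on all of `ℝⁿ`. -/
lemma aestronglyMeasurable_of_isCompact {v : Rn n → Rn m}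
    (hv : ∀ K : Set (Rn n), IsCompact K → MemLp v 2 (volume.restrict K)) :
    AEStronglyMeasurable v volume := by
  rw [← Measure.restrict_univ (μ := volume), ← Metric.iUnion_closedBall_nat (0 : Rn n),
    aestronglyMeasurable_iUnion_iff]
  exact fun k => (hv _ (isCompact_closedBall _ _)).aestronglyMeasurable

/-- A point `x₀` of `ω` at which the energy density is integrable turns finite energy into
square integrability against the Poisson weight. -/
lemma integrable_weight_mul_sq {v : Rn n → Rn m} (hv : AEStronglyMeasurable v volume)
    {ω : Set (Rn n)} (hω : IsOpen ω) (hne : ω.Nonempty) (h : pairEnergy v ω < ∞) :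
    Integrable fun z => ((1 + ‖z‖) ^ (n + 1))⁻¹ * ‖v z‖ ^ 2 := by
  have h2 := (aemeasurable_pairDensity hv)
  have h3 : ∀ᵐ x ∂(volume.restrict ω), ∫⁻ z, pairDensity v (x, z) < ∞ := by
    refine ae_lt_top' ?_ ((lintegral_lintegral_pairDensity_le hv).trans_lt h).ne
    exact (AEMeasurable.lintegral_prod_right' h2).restrict
  have : (ae (volume.restrict ω)).NeBot := by
    rw [ae_neBot, Ne, Measure.restrict_eq_zero]
    exact (hω.measure_pos volume hne).ne'
  obtain ⟨x₀, hx₀⟩ := h3.exists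
  have hw := integrable_weight n
  -- the weighted square of `v - v x₀` is integrable
  have hsq : Integrable fun z => ((1 + ‖z‖) ^ (n + 1))⁻¹ * ‖v z - v x₀‖ ^ 2 := by
    have hm : AEStronglyMeasurable (fun z => ((1 + ‖z‖) ^ (n + 1))⁻¹ * ‖v z - v x₀‖ ^ 2) volume :=
      hw.aestronglyMeasurable.mul ((hv.sub aestronglyMeasurable_const).norm.pow 2)
    refine ⟨hm, ?_⟩
    rw [hasFiniteIntegral_iff_enorm]
    refine lt_of_le_of_lt (b := ∫⁻ z, ENNReal.ofReal ((1 + ‖x₀‖) ^ (n + 1)) * pairDensity v (x₀, z)) ?_ ?_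
    · refine lintegral_mono fun z => ?_
      rw [← ofReal_norm, Real.norm_of_nonneg (by positivity), pairDensity,
        ← ENNReal.ofReal_mul (by positivity)]
      refine ENNReal.ofReal_le_ofReal ?_
      simp only
      rcases eq_or_ne x₀ z with rfl | hne
      · simp
      · have hp : 0 < ‖x₀ - z‖ := norm_pos_iff.mpr (sub_ne_zero.mpr hne)
        have h5 : ‖x₀ - z‖ ≤ (1 + ‖x₀‖) * (1 + ‖z‖) := by
          have := norm_sub_le x₀ z
          nlinarith [norm_nonneg x₀, norm_nonneg z, mul_nonneg (norm_nonneg x₀) (norm_nonneg z)]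
        rw [norm_sub_rev (v z), inv_mul_eq_div, ← mul_div_assoc, div_le_div_iff₀ (by positivity)
          (by positivity)]
        have h6 : ‖x₀ - z‖ ^ (n + 1) ≤ (1 + ‖x₀‖) ^ (n + 1) * (1 + ‖z‖) ^ (n + 1) := by
          rw [← mul_pow]; gcongr
        calc _ ≤ ‖v x₀ - v z‖ ^ 2 * ((1 + ‖x₀‖) ^ (n + 1) * (1 + ‖z‖) ^ (n + 1)) := by gcongr
          _ = _ := by ring
    · rw [lintegral_const_mul' _ _ ENNReal.ofReal_ne_top]
      exact ENNReal.mul_lt_top ENNReal.ofReal_lt_top hx₀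
  refine ((hsq.const_mul 2).add (hw.mul_const (2 * ‖v x₀‖ ^ 2))).mono'
    (hw.aestronglyMeasurable.mul (hv.norm.pow 2)) (Filter.Eventually.of_forall fun z => ?_)
  rw [Real.norm_of_nonneg (by positivity), Pi.add_apply]
  have h1 := norm_add_le (v z - v x₀) (v x₀)
  rw [sub_add_cancel] at h1
  have h4 : ‖v z‖ ^ 2 ≤ 2 * ‖v z - v x₀‖ ^ 2 + 2 * ‖v x₀‖ ^ 2 := by
    nlinarith [norm_nonneg (v z), sq_nonneg (‖v z - v x₀‖ - ‖v x₀‖)]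
  calc _ ≤ ((1 + ‖z‖) ^ (n + 1))⁻¹ * (2 * ‖v z - v x₀‖ ^ 2 + 2 * ‖v x₀‖ ^ 2) := by gcongr
    _ = _ := by ring

/-- Finite energy makes the Poisson integral converge, since `|v| ≤ 1 + |v|²`. -/
lemma poissonIntegrable_of_pairEnergy {v : Rn n → Rn m} (hv : AEStronglyMeasurable v volume)
    {ω : Set (Rn n)} (hω : IsOpen ω) (hne : ω.Nonempty) (h : pairEnergy v ω < ∞) :
    PoissonIntegrable v := by
  have hw := integrable_weight n
  refine (hw.add (integrable_weight_mul_sq hv hω hne h)).mono' (hw.aestronglyMeasurable.smul hv)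
    (Filter.Eventually.of_forall fun z => ?_)
  rw [norm_smul, Real.norm_of_nonneg (by positivity), Pi.add_apply]
  have : ‖v z‖ ≤ 1 + ‖v z‖ ^ 2 := by nlinarith [sq_nonneg (‖v z‖ - 1)]
  calc _ ≤ ((1 + ‖z‖) ^ (n + 1))⁻¹ * (1 + ‖v z‖ ^ 2) := by gcongr
    _ = _ := by ring

lemma MemHhat.finiteEnergy {v : Rn n → Rn m} {ω : Set (Rn n)} (hv : MemHhat v ω) (hω : IsOpen ω)
    (hne : ω.Nonempty) : FiniteEnergy v ω := by
  have h : pairEnergy v ω < ∞ := by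
    have h1 := hv.energy_lt_top
    rw [halfEnergy_eq v hω.measurableSet] at h1
    have := gammaConst_pos n
    exact ENNReal.lt_top_of_mul_ne_top_right h1.ne (by simpa using this)
  exact ⟨poissonIntegrable_of_pairEnergy
    (aestronglyMeasurable_of_isCompact hv.memLp_two_of_isCompact) hω hne h, h⟩

lemma PoissonIntegrable.add {v w : Rn n → Rn m} (hv : PoissonIntegrable v)
    (hw : PoissonIntegrable w) : PoissonIntegrable (v + w) := by
  refine (Integrable.add hv hw).congr (Filter.Eventually.of_forall fun z => ?_)
  simp [smul_add]

lemma PoissonIntegrable.smul {v : Rn n → Rn m} (hv : PoissonIntegrable v) (c : ℝ) :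
    PoissonIntegrable (c • v) := by
  refine (Integrable.smul c hv).congr (Filter.Eventually.of_forall fun z => ?_)
  simp [smul_smul, mul_comm]

lemma pairDensity_add_le (v w : Rn n → Rn m) (p : Rn n × Rn n) :
    pairDensity (v + w) p ≤ 2 * pairDensity v p + 2 * pairDensity w p := by
  have e : ∀ t : ℝ, 2 * ENNReal.ofReal t = ENNReal.ofReal (2 * t) := fun t => by
    rw [ENNReal.ofReal_mul (by norm_num)]; simp
  rw [pairDensity, pairDensity, pairDensity, e, e,
    ← ENNReal.ofReal_add (by positivity) (by positivity)]
  refine ENNReal.ofReal_le_ofReal ?_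
  rw [← mul_div_assoc, ← mul_div_assoc, ← add_div]
  gcongr
  have h : (v + w) p.1 - (v + w) p.2 = (v p.1 - v p.2) + (w p.1 - w p.2) := by
    simp only [Pi.add_apply]; abel
  rw [h]
  have h1 := norm_add_le (v p.1 - v p.2) (w p.1 - w p.2)
  have h2 := norm_nonneg ((v p.1 - v p.2) + (w p.1 - w p.2))
  nlinarith [sq_nonneg (‖v p.1 - v p.2‖ - ‖w p.1 - w p.2‖)]

lemma pairDensity_smul (c : ℝ) (v : Rn n → Rn m) (p : Rn n × Rn n) :
    pairDensity (c • v) p = ENNReal.ofReal (c ^ 2) * pairDensity v p := by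
  rw [pairDensity, pairDensity, ← ENNReal.ofReal_mul (sq_nonneg c)]
  simp only [Pi.smul_apply, ← smul_sub, norm_smul, mul_pow, Real.norm_eq_abs, sq_abs]
  rw [mul_div_assoc]

lemma pairEnergy_smul (c : ℝ) (v : Rn n → Rn m) (ω : Set (Rn n)) :
    pairEnergy (c • v) ω = ENNReal.ofReal (c ^ 2) * pairEnergy v ω := by
  simp_rw [pairEnergy, pairDensity_smul]
  exact lintegral_const_mul' _ _ ENNReal.ofReal_ne_top

lemma pairEnergy_add_le {v w : Rn n → Rn m} (hv : AEStronglyMeasurable v volume)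
    (ω : Set (Rn n)) : pairEnergy (v + w) ω ≤ 2 * pairEnergy v ω + 2 * pairEnergy w ω := by
  refine (lintegral_mono fun p => pairDensity_add_le v w p).trans (le_of_eq ?_)
  have h : AEMeasurable (pairDensity v) (volume : Measure (Rn n × Rn n)) :=
    aemeasurable_pairDensity hv
  rw [lintegral_add_left' (h.restrict.const_mul 2),
    lintegral_const_mul' _ _ (by norm_num), lintegral_const_mul' _ _ (by norm_num)]
  rfl

lemma FiniteEnergy.add {v w : Rn n → Rn m} {ω : Set (Rn n)} (hv : FiniteEnergy v ω)
    (hw : FiniteEnergy w ω) : FiniteEnergy (v + w) ω :=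
  ⟨hv.1.add hw.1, (pairEnergy_add_le hv.1.aestronglyMeasurable ω).trans_lt
    (ENNReal.add_lt_top.2 ⟨ENNReal.mul_lt_top (by norm_num) hv.2,
      ENNReal.mul_lt_top (by norm_num) hw.2⟩)⟩

lemma FiniteEnergy.smul {v : Rn n → Rn m} {ω : Set (Rn n)} (hv : FiniteEnergy v ω) (c : ℝ) :
    FiniteEnergy (c • v) ω :=
  ⟨hv.1.smul c, by rw [pairEnergy_smul]; exact ENNReal.mul_lt_top ENNReal.ofReal_lt_top hv.2⟩

lemma FiniteEnergy.sub {v w : Rn n → Rn m} {ω : Set (Rn n)} (hv : FiniteEnergy v ω)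
    (hw : FiniteEnergy w ω) : FiniteEnergy (v - w) ω := by
  have := hv.add (hw.smul (-1))
  rwa [neg_smul, one_smul, ← sub_eq_add_neg] at this

/-- The real two-point density, whose integral is the energy. -/
noncomputable def realDensity (v : Rn n → Rn m) (p : Rn n × Rn n) : ℝ :=
  ‖v p.1 - v p.2‖ ^ 2 / ‖p.1 - p.2‖ ^ (n + 1)

lemma realDensity_nonneg (v : Rn n → Rn m) (p : Rn n × Rn n) : 0 ≤ realDensity v p := by
  unfold realDensity; positivity

lemma integrableOn_realDensity {v : Rn n → Rn m} (hv : AEStronglyMeasurable v volume)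
    {ω : Set (Rn n)} (h : pairEnergy v ω < ∞) : IntegrableOn (realDensity v) (touch ω) := by
  have h1 : AEStronglyMeasurable (fun p : Rn n × Rn n => v p.1 - v p.2)
    ((volume : Measure (Rn n)).prod volume) := hv.comp_fst.sub hv.comp_snd
  refine ⟨((h1.norm.aemeasurable.pow_const 2).div
    (Measurable.aemeasurable (by fun_prop))).aestronglyMeasurable.restrict, ?_⟩
  rw [hasFiniteIntegral_iff_ofReal (Filter.Eventually.of_forall (realDensity_nonneg v))]
  exact h

lemma toReal_pairEnergy {v : Rn n → Rn m} (hv : AEStronglyMeasurable v volume)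
    {ω : Set (Rn n)} (h : pairEnergy v ω < ∞) :
    (pairEnergy v ω).toReal = ∫ p in touch ω, realDensity v p := by
  rw [integral_eq_lintegral_of_nonneg_ae (Filter.Eventually.of_forall (realDensity_nonneg v))
    (integrableOn_realDensity hv h).aestronglyMeasurable]
  rfl

/-- A form of polarisation: `q` is quadratic on the maps of finite energy, with the cross term
written through the rescaled maps `l a ± l⁻¹ b`. The free parameter `l` lets a bound for `q` by the
energy control the cross term. -/
def IsQuadratic (ω : Set (Rn n)) (q : (Rn n → Rn m) → ℝ) : Prop :=
  ∀ a b : Rn n → Rn m, FiniteEnergy a ω → FiniteEnergy b ω → ∀ l : ℝ, l ≠ 0 →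
    q (a + b) = q a + q b + 1 / 2 * (q (l • a + l⁻¹ • b) - q (l • a - l⁻¹ • b))

lemma norm_sq_polarise {E : Type*} [NormedAddCommGroup E] [InnerProductSpace ℝ E] (a b : E) {l : ℝ}
    (hl : l ≠ 0) : ‖a + b‖ ^ 2 = ‖a‖ ^ 2 + ‖b‖ ^ 2 +
      1 / 2 * (‖l • a + l⁻¹ • b‖ ^ 2 - ‖l • a - l⁻¹ • b‖ ^ 2) := by
  rw [norm_add_sq_real, norm_add_sq_real, norm_sub_sq_real, real_inner_smul_left,
    real_inner_smul_right, ← mul_assoc l, mul_inv_cancel₀ hl]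
  ring

lemma realDensity_polarise (a b : Rn n → Rn m) {l : ℝ} (hl : l ≠ 0) (p : Rn n × Rn n) :
    realDensity (a + b) p = realDensity a p + realDensity b p +
      1 / 2 * (realDensity (l • a + l⁻¹ • b) p - realDensity (l • a - l⁻¹ • b) p) := by
  have h := norm_sq_polarise (a p.1 - a p.2) (b p.1 - b p.2) hl
  have e1 : (a + b) p.1 - (a + b) p.2 = (a p.1 - a p.2) + (b p.1 - b p.2) := by
    simp only [Pi.add_apply]; abel
  have e2 : (l • a + l⁻¹ • b) p.1 - (l • a + l⁻¹ • b) p.2 =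
      l • (a p.1 - a p.2) + l⁻¹ • (b p.1 - b p.2) := by
    simp only [Pi.add_apply, Pi.smul_apply, smul_sub]; abel
  have e3 : (l • a - l⁻¹ • b) p.1 - (l • a - l⁻¹ • b) p.2 =
      l • (a p.1 - a p.2) - l⁻¹ • (b p.1 - b p.2) := by
    simp only [Pi.sub_apply, Pi.smul_apply, smul_sub]; abel
  rw [realDensity, e1, h, realDensity, realDensity, realDensity, realDensity, e2, e3]
  ring

lemma isQuadratic_pairEnergy (ω : Set (Rn n)) :
    IsQuadratic ω fun v : Rn n → Rn m => (pairEnergy v ω).toReal := by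
  intro a b ha hb l hl
  have hab := ha.add hb
  have h1 := (ha.smul l).add (hb.smul l⁻¹)
  have h2 := (ha.smul l).sub (hb.smul l⁻¹)
  have I : ∀ {v : Rn n → Rn m}, FiniteEnergy v ω → IntegrableOn (realDensity v) (touch ω) :=
    fun h => integrableOn_realDensity h.1.aestronglyMeasurable h.2
  have T : ∀ {v : Rn n → Rn m}, FiniteEnergy v ω →
      (pairEnergy v ω).toReal = ∫ p in touch ω, realDensity v p :=
    fun h => toReal_pairEnergy h.1.aestronglyMeasurable h.2
  simp only
  rw [T ha, T hb, T hab, T h1, T h2]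
  simp_rw [realDensity_polarise a b hl]
  have A : IntegrableOn (fun p => realDensity a p + realDensity b p) (touch ω) := (I ha).add (I hb)
  have B : IntegrableOn (fun p => 1 / 2 * (realDensity (l • a + l⁻¹ • b) p -
    realDensity (l • a - l⁻¹ • b) p)) (touch ω) := ((I h1).sub (I h2)).const_mul _
  rw [integral_add A B, integral_add (I ha) (I hb), integral_const_mul,
    integral_sub (I h1) (I h2)]

/-- A quadratic functional bounded by the energy is continuous for it, with an explicit modulus. -/
lemma IsQuadratic.abs_sub_le {ω : Set (Rn n)} {q : (Rn n → Rn m) → ℝ} (hq : IsQuadratic ω q)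
    {C : ℝ} (hC : 0 ≤ C) (hb : ∀ v, FiniteEnergy v ω → |q v| ≤ C * (pairEnergy v ω).toReal)
    {a b : Rn n → Rn m} (ha : FiniteEnergy a ω) (hb' : FiniteEnergy b ω) {l : ℝ} (hl : l ≠ 0) :
    |q b - q a| ≤ C * ((1 + 2 * (l⁻¹) ^ 2) * (pairEnergy (b - a) ω).toReal +
      2 * l ^ 2 * (pairEnergy a ω).toReal) := by
  -- polarise `b = a + (b - a)`
  have hd := hb'.sub ha
  have h := hq a (b - a) ha hd l hl
  rw [add_sub_cancel] at h
  have E : ∀ {v w : Rn n → Rn m}, FiniteEnergy v ω → FiniteEnergy w ω → ∀ c d : ℝ,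
      (pairEnergy (c • v + d • w) ω).toReal ≤
        2 * c ^ 2 * (pairEnergy v ω).toReal + 2 * d ^ 2 * (pairEnergy w ω).toReal := by
    intro v w hv hw c d
    have h1 := pairEnergy_add_le (v := c • v) (w := d • w) (hv.smul c).1.aestronglyMeasurable ω
    rw [pairEnergy_smul, pairEnergy_smul] at h1
    have h2 := ENNReal.toReal_mono (ENNReal.add_lt_top.2 ⟨ENNReal.mul_lt_top (by norm_num)
      (ENNReal.mul_lt_top ENNReal.ofReal_lt_top hv.2), ENNReal.mul_lt_top (by norm_num)
      (ENNReal.mul_lt_top ENNReal.ofReal_lt_top hw.2)⟩).ne h1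
    rw [ENNReal.toReal_add (ENNReal.mul_lt_top (by norm_num)
      (ENNReal.mul_lt_top ENNReal.ofReal_lt_top hv.2)).ne (ENNReal.mul_lt_top (by norm_num)
      (ENNReal.mul_lt_top ENNReal.ofReal_lt_top hw.2)).ne] at h2
    simp only [ENNReal.toReal_mul, ENNReal.toReal_ofReal (sq_nonneg _), ENNReal.toReal_ofNat] at h2
    linarith
  have e1 := E ha hd l l⁻¹
  have e2 := E ha hd l (-l⁻¹)
  rw [neg_smul, ← sub_eq_add_neg, neg_sq] at e2
  have b1 := hb _ ((ha.smul l).add (hd.smul l⁻¹))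
  have b2 := hb _ ((ha.smul l).sub (hd.smul l⁻¹))
  have b3 := hb _ hd
  have b1' := b1.trans (mul_le_mul_of_nonneg_left e1 hC)
  have b2' := b2.trans (mul_le_mul_of_nonneg_left e2 hC)
  rw [abs_le] at b1' b2' b3 ⊢
  constructor <;> nlinarith

open Filter Topology in
/-- Uniformly bounded quadratic functionals that converge on an approximating sequence converge. -/
lemma tendsto_of_isQuadratic {ι : Type*} {f : Filter ι} {ω : Set (Rn n)}
    {q : ι → (Rn n → Rn m) → ℝ} {R : (Rn n → Rn m) → ℝ} {C : ℝ} (hC : 0 ≤ C)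
    (hq : ∀ᶠ t in f, IsQuadratic ω (q t) ∧
      ∀ v, FiniteEnergy v ω → |q t v| ≤ C * (pairEnergy v ω).toReal)
    (hR : IsQuadratic ω R) (hRb : ∀ v, FiniteEnergy v ω → |R v| ≤ C * (pairEnergy v ω).toReal)
    {v : Rn n → Rn m} (hv : FiniteEnergy v ω) {w : ℕ → Rn n → Rn m}
    (hw : ∀ k, FiniteEnergy (w k) ω)
    (hlim : Tendsto (fun k => (pairEnergy (w k - v) ω).toReal) atTop (𝓝 0))
    (hk : ∀ k, Tendsto (fun t => q t (w k)) f (𝓝 (R (w k)))) :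
    Tendsto (fun t => q t v) f (𝓝 (R v)) := by
  -- both `q t` and `R` change by less than `ε` between `v` and a good approximant
  have key : ∀ ε > 0, ∃ k, C * ((1 + 2 * (ε⁻¹) ^ 2) * (pairEnergy (w k - v) ω).toReal +
      2 * ε ^ 2 * (pairEnergy v ω).toReal) ≤ C * ((1 + 2 * (pairEnergy v ω).toReal) * ε ^ 2) := by
    intro ε hε
    have h1 : Tendsto (fun k => (1 + 2 * (ε⁻¹) ^ 2) * (pairEnergy (w k - v) ω).toReal) atTop
        (𝓝 ((1 + 2 * (ε⁻¹) ^ 2) * 0)) := hlim.const_mul _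
    rw [mul_zero] at h1
    obtain ⟨k, hk⟩ := (h1.eventually_lt_const (show (0 : ℝ) < ε ^ 2 by positivity)).exists
    exact ⟨k, mul_le_mul_of_nonneg_left (by linarith) hC⟩
  rw [Metric.tendsto_nhds]
  intro δ hδ
  set M := C * (1 + 2 * (pairEnergy v ω).toReal) with hM
  have hM0 : 0 ≤ M := mul_nonneg hC (by positivity)
  obtain ⟨ε, hε, hε2⟩ : ∃ ε > 0, M * ε ^ 2 < δ / 3 := by
    have h1 : Tendsto (fun ε : ℝ => M * ε ^ 2) (𝓝[>] 0) (𝓝 (M * 0 ^ 2)) :=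
      (Continuous.tendsto (by fun_prop) 0).mono_left nhdsWithin_le_nhds
    rw [zero_pow two_ne_zero, mul_zero] at h1
    obtain ⟨ε, h2, h3⟩ := ((h1.eventually_lt_const (show (0 : ℝ) < δ / 3 by positivity)).and
      self_mem_nhdsWithin).exists
    exact ⟨ε, h3, h2⟩
  obtain ⟨k, hkk⟩ := key ε hε
  have hR1 := (hR.abs_sub_le hC hRb hv (hw k) hε.ne').trans hkk
  filter_upwards [hq, Metric.tendsto_nhds.1 (hk k) (δ / 3) (by positivity)] with t ht ht2
  have hq1 := (ht.1.abs_sub_le hC ht.2 hv (hw k) hε.ne').trans hkk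
  rw [Real.dist_eq] at ht2 ⊢
  rw [← mul_assoc, ← hM] at hR1 hq1
  rw [abs_le] at hR1 hq1
  rw [abs_lt] at ht2 ⊢
  constructor <;> linarith [hR1.1, hR1.2, hq1.1, hq1.2, ht2.1, ht2.2]

/-! ### Bi-Lipschitz changes of variables and flows -/

lemma volume_image_le_of_lipschitzWith {K : NNReal} {f : Rn n → Rn n} (hf : LipschitzWith K f)
    (s : Set (Rn n)) : volume (f '' s) ≤ (K : ℝ≥0∞) ^ n * volume s := by
  have h1 := Measure.isAddLeftInvariant_eq_smul (volume : Measure (Rn n))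
    (Measure.hausdorffMeasure (n : ℝ) : Measure (Rn n))
  have h2 := hf.hausdorffMeasure_image_le (d := n) (Nat.cast_nonneg n) s
  rw [h1, Measure.smul_apply, Measure.smul_apply, ENNReal.smul_def, ENNReal.smul_def, smul_eq_mul,
    smul_eq_mul]
  calc _ ≤ _ * ((K : ℝ≥0∞) ^ (n : ℝ) * Measure.hausdorffMeasure (n : ℝ) s) := by gcongr
    _ = _ := by rw [ENNReal.rpow_natCast]; ring

/-- A bijection of `ℝⁿ` that is `K`-Lipschitz together with its inverse `ψ'`. -/
structure IsBiLipschitz (K : NNReal) (ψ ψ' : Rn n → Rn n) : Prop where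
  left : LipschitzWith K ψ
  right : LipschitzWith K ψ'
  left_inv : ∀ x, ψ' (ψ x) = x
  right_inv : ∀ x, ψ (ψ' x) = x

lemma IsBiLipschitz.map_restrict_le {K : NNReal} {ψ ψ' : Rn n → Rn n} (h : IsBiLipschitz K ψ ψ')
    (S : Set (Rn n)) :
    (volume.restrict (ψ ⁻¹' S)).map ψ ≤ (K : ℝ≥0∞) ^ n • volume.restrict S := by
  refine Measure.le_iff.2 fun A hA => ?_
  rw [Measure.map_apply h.left.continuous.measurable hA,
    Measure.restrict_apply (h.left.continuous.measurable hA), Measure.smul_apply,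
    Measure.restrict_apply hA, smul_eq_mul]
  refine (measure_mono ?_).trans (volume_image_le_of_lipschitzWith h.right (A ∩ S))
  exact fun x hx => ⟨ψ x, hx, h.left_inv x⟩

lemma IsBiLipschitz.map_le {K : NNReal} {ψ ψ' : Rn n → Rn n} (h : IsBiLipschitz K ψ ψ') :
    volume.map ψ ≤ (K : ℝ≥0∞) ^ n • volume := by
  simpa using h.map_restrict_le univ

lemma IsBiLipschitz.quasiMeasurePreserving {K : NNReal} {ψ ψ' : Rn n → Rn n}
    (h : IsBiLipschitz K ψ ψ') : Measure.QuasiMeasurePreserving ψ volume volume :=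
  ⟨h.left.continuous.measurable, (Measure.absolutelyContinuous_of_le_smul h.map_le)⟩

/-- The kernel `|x - y|^{-(n+1)}` is distorted by at most `K^{n+1}`. -/
lemma pairDensity_comp_le {K : NNReal} {ψ : Rn n → Rn n} (h : LipschitzWith K ψ)
    (v : Rn n → Rn m) (p : Rn n × Rn n) : pairDensity (fun x => v (ψ x)) p ≤
      (K : ℝ≥0∞) ^ (n + 1) * pairDensity v (Prod.map ψ ψ p) := by
  have e : (K : ℝ≥0∞) ^ (n + 1) = ENNReal.ofReal ((K : ℝ) ^ (n + 1)) := by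
    rw [ENNReal.ofReal_pow (NNReal.coe_nonneg K), ENNReal.ofReal_coe_nnreal]
  rw [e, pairDensity, pairDensity, ← ENNReal.ofReal_mul (by positivity)]
  refine ENNReal.ofReal_le_ofReal ?_
  simp only [Prod.map_fst, Prod.map_snd]
  have h1 := h.dist_le_mul p.1 p.2
  rw [dist_eq_norm, dist_eq_norm] at h1
  rcases eq_or_ne (ψ p.1) (ψ p.2) with h0 | h0
  · simp [h0]
  · have h2 : 0 < ‖ψ p.1 - ψ p.2‖ := norm_pos_iff.mpr (sub_ne_zero.mpr h0)
    have h3 : 0 < ‖p.1 - p.2‖ := by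
      rcases (norm_nonneg (p.1 - p.2)).eq_or_lt with h4 | h4
      · rw [← h4, mul_zero] at h1; linarith
      · exact h4
    rw [← mul_div_assoc, div_le_div_iff₀ (by positivity) (by positivity)]
    calc _ ≤ ‖v (ψ p.1) - v (ψ p.2)‖ ^ 2 * ((K : ℝ) * ‖p.1 - p.2‖) ^ (n + 1) := by gcongr
      _ = _ := by rw [mul_pow]; ring

/-- A bi-Lipschitz change of variables distorts the energy by a power of the Lipschitz constant. -/
lemma IsBiLipschitz.pairEnergy_comp_le {K : NNReal} {ψ ψ' : Rn n → Rn n}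
    (h : IsBiLipschitz K ψ ψ') {v : Rn n → Rn m} (hv : AEStronglyMeasurable v volume)
    {ω : Set (Rn n)} (hω : MeasurableSet ω) (hψ : ∀ x, ψ x ∈ ω ↔ x ∈ ω) :
    pairEnergy (fun x => v (ψ x)) ω ≤ (K : ℝ≥0∞) ^ (3 * n + 1) * pairEnergy v ω := by
  have hm : Measurable (Prod.map ψ ψ) :=
    h.left.continuous.measurable.prodMap h.left.continuous.measurable
  have hmap : (volume : Measure (Rn n × Rn n)).map (Prod.map ψ ψ) ≤
      ((K : ℝ≥0∞) ^ n * (K : ℝ≥0∞) ^ n) • volume := by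
    rw [Measure.volume_eq_prod, ← Measure.map_prod_map _ _ h.left.continuous.measurable
      h.left.continuous.measurable]
    refine (Measure.prod_mono h.map_le h.map_le).trans (le_of_eq ?_)
    rw [Measure.prod_smul_left, Measure.prod_smul_right, smul_smul]
  have hd : AEMeasurable ((touch ω).indicator (pairDensity v))
      (volume : Measure (Rn n × Rn n)) :=
    AEMeasurable.indicator (aemeasurable_pairDensity hv) (measurableSet_touch hω)
  calc pairEnergy (fun x => v (ψ x)) ω
      ≤ ∫⁻ p, (K : ℝ≥0∞) ^ (n + 1) * (touch ω).indicator (pairDensity v) (Prod.map ψ ψ p) := by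
        rw [pairEnergy, ← lintegral_indicator (measurableSet_touch hω)]
        refine lintegral_mono fun p => ?_
        by_cases hp : p ∈ touch ω
        · have hp' : Prod.map ψ ψ p ∈ touch ω := hp.imp (hψ _).2 (hψ _).2
          rw [indicator_of_mem hp, indicator_of_mem hp']
          exact pairDensity_comp_le h.left v p
        · rw [indicator_of_notMem hp]; exact zero_le
    _ = (K : ℝ≥0∞) ^ (n + 1) * ∫⁻ p, (touch ω).indicator (pairDensity v) p
          ∂((volume : Measure (Rn n × Rn n)).map (Prod.map ψ ψ)) := by
        rw [lintegral_const_mul' _ _ (ENNReal.pow_ne_top ENNReal.coe_ne_top), lintegral_map' _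
          hm.aemeasurable]
        exact hd.mono_ac (Measure.absolutelyContinuous_of_le_smul hmap)
    _ ≤ (K : ℝ≥0∞) ^ (n + 1) * ∫⁻ p, (touch ω).indicator (pairDensity v) p
          ∂(((K : ℝ≥0∞) ^ n * (K : ℝ≥0∞) ^ n) • (volume : Measure (Rn n × Rn n))) := by
        gcongr
    _ = _ := by
        rw [lintegral_smul_measure, lintegral_indicator (measurableSet_touch hω), smul_eq_mul,
          ← mul_assoc, ← pow_add, ← pow_add, pairEnergy]
        congr 2
        ring

lemma IsBiLipschitz.memLp_comp {K : NNReal} {ψ ψ' : Rn n → Rn n}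
    (h : IsBiLipschitz K ψ ψ') {v : Rn n → Rn m}
    (hv : ∀ C : Set (Rn n), IsCompact C → MemLp v 2 (volume.restrict C)) (C : Set (Rn n))
    (hC : IsCompact C) : MemLp (fun x => v (ψ x)) 2 (volume.restrict C) := by
  have h1 := hv (ψ '' C) (hC.image h.left.continuous)
  have e : ψ ⁻¹' (ψ '' C) = C :=
    (Function.LeftInverse.injective h.left_inv).preimage_image C
  have h2 := h.map_restrict_le (ψ '' C)
  rw [e] at h2
  have h3 := h1.of_measure_le_smul (ENNReal.pow_ne_top ENNReal.coe_ne_top) h2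
  exact (memLp_map_measure_iff h3.1 h.left.continuous.aemeasurable).1 h3

variable {X : Rn n → Rn n} {φ : ℝ → Rn n → Rn n} {L : NNReal}

/-- Uniqueness of integral curves. -/
lemma IsFlow.eq_of_hasDerivAt (hφ : IsFlow X φ) (hX : LipschitzWith L X) {γ : ℝ → Rn n}
    (hγ : ∀ t, HasDerivAt γ (X (γ t)) t) (t : ℝ) : γ t = φ t (γ 0) := by
  have := ODE_solution_unique_univ (v := fun _ => X) (s := fun _ => univ) (K := L) (t₀ := 0)
    (f := γ) (g := fun t => φ t (γ 0)) (fun t => hX.lipschitzOnWith)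
    (fun t => ⟨hγ t, mem_univ _⟩) (fun t => ⟨hφ.hasDerivAt t (γ 0), mem_univ _⟩)
    (hφ.map_zero _).symm
  exact congrFun this t

lemma IsFlow.map_add (hφ : IsFlow X φ) (hX : LipschitzWith L X) (s t : ℝ) (x : Rn n) :
    φ (s + t) x = φ s (φ t x) := by
  have := hφ.eq_of_hasDerivAt hX (γ := fun s => φ (s + t) x)
    (fun s => by simpa using (hφ.hasDerivAt (s + t) x).comp_add_const s t) s
  simpa using this

lemma IsFlow.map_neg_map (hφ : IsFlow X φ) (hX : LipschitzWith L X) (t : ℝ) (x : Rn n) :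
    φ (-t) (φ t x) = x := by
  rw [← hφ.map_add hX, neg_add_cancel, hφ.map_zero]

lemma IsFlow.map_map_neg (hφ : IsFlow X φ) (hX : LipschitzWith L X) (t : ℝ) (x : Rn n) :
    φ t (φ (-t) x) = x := by
  rw [← hφ.map_add hX, add_neg_cancel, hφ.map_zero]

lemma IsFlow.eq_self (hφ : IsFlow X φ) (hX : LipschitzWith L X) {x : Rn n} (hx : X x = 0) (t : ℝ) :
    φ t x = x :=
  (hφ.eq_of_hasDerivAt hX (γ := fun _ => x) (fun t => by rw [hx]; exact hasDerivAt_const t x) t).symm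

/-- A flow preserves every set containing the support of its field. -/
lemma IsFlow.mem_iff (hφ : IsFlow X φ) (hX : LipschitzWith L X) {S : Set (Rn n)}
    (hS : tsupport X ⊆ S) (t : ℝ) (x : Rn n) : φ t x ∈ S ↔ x ∈ S := by
  have key : ∀ (t : ℝ) (x : Rn n), x ∉ S → φ t x ∉ S := fun t x hx => by
    rwa [hφ.eq_self hX (image_eq_zero_of_notMem_tsupport fun h => hx (hS h)) t]
  refine ⟨fun h => by_contra fun h' => key t x h' h, fun h => by_contra fun h' => ?_⟩
  have := key (-t) _ h'
  rw [hφ.map_neg_map hX] at this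
  exact this h

/-- Gronwall's inequality. -/
lemma IsFlow.lipschitzWith (hφ : IsFlow X φ) (hX : LipschitzWith L X) (t : ℝ) :
    LipschitzWith (Real.toNNReal (Real.exp (L * |t|))) (φ t) := by
  refine LipschitzWith.of_dist_le_mul fun x y => ?_
  rw [Real.coe_toNNReal _ (Real.exp_pos _).le]
  rcases le_total 0 t with ht | ht
  · have := dist_le_of_trajectories_ODE (v := fun _ => X) (K := L) (a := 0) (b := t)
      (f := fun s => φ s x) (g := fun s => φ s y) (δ := dist x y) (fun _ => hX)
      (fun s _ => (hφ.hasDerivAt s x).continuousAt.continuousWithinAt)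
      (fun s _ => (hφ.hasDerivAt s x).hasDerivWithinAt)
      (fun s _ => (hφ.hasDerivAt s y).continuousAt.continuousWithinAt)
      (fun s _ => (hφ.hasDerivAt s y).hasDerivWithinAt)
      (by simp only [hφ.map_zero]; exact le_rfl) t ⟨ht, le_rfl⟩
    rw [abs_of_nonneg ht, mul_comm]
    simpa using this
  · have hd : ∀ z s, HasDerivAt (fun s => φ (-s) z) (-X (φ (-s) z)) s := fun z s =>
      ((hφ.hasDerivAt (-s) z).scomp s (hasDerivAt_neg s)).congr_deriv (by simp)
    have := dist_le_of_trajectories_ODE (v := fun _ => fun x => -X x) (K := L) (a := 0) (b := -t)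
      (f := fun s => φ (-s) x) (g := fun s => φ (-s) y) (δ := dist x y) (fun _ => hX.neg)
      (fun s _ => (hd x s).continuousAt.continuousWithinAt)
      (fun s _ => (hd x s).hasDerivWithinAt)
      (fun s _ => (hd y s).continuousAt.continuousWithinAt)
      (fun s _ => (hd y s).hasDerivWithinAt)
      (by simp only [neg_zero, hφ.map_zero]; exact le_rfl) (-t) ⟨neg_nonneg.2 ht, le_rfl⟩
    rw [abs_of_nonpos ht, mul_comm]
    simpa using this

lemma IsFlow.isBiLipschitz (hφ : IsFlow X φ) (hX : LipschitzWith L X) (t : ℝ) :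
    IsBiLipschitz (Real.toNNReal (Real.exp (L * |t|))) (φ t) (φ (-t)) :=
  ⟨hφ.lipschitzWith hX t, by simpa using hφ.lipschitzWith hX (-t), hφ.map_neg_map hX t,
    hφ.map_map_neg hX t⟩

variable {ω : Set (Rn n)} {v : Rn n → Rn m}

lemma FiniteEnergy.comp_flow (hv : FiniteEnergy v ω) (hφ : IsFlow X φ) (hX : LipschitzWith L X)
    (hω : IsOpen ω) (hne : ω.Nonempty) (hS : tsupport X ⊆ ω) (t : ℝ) :
    FiniteEnergy (fun x => v (φ t x)) ω := by
  have h := hφ.isBiLipschitz hX t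
  have h1 := h.pairEnergy_comp_le hv.1.aestronglyMeasurable hω.measurableSet (hφ.mem_iff hX hS t)
  have h2 := h1.trans_lt (ENNReal.mul_lt_top (ENNReal.pow_lt_top ENNReal.coe_lt_top) hv.2)
  exact ⟨poissonIntegrable_of_pairEnergy (hv.1.aestronglyMeasurable.comp_quasiMeasurePreserving
    h.quasiMeasurePreserving) hω hne h2, h2⟩

lemma toReal_pairEnergy_comp_flow_le (hv : FiniteEnergy v ω) (hφ : IsFlow X φ)
    (hX : LipschitzWith L X) (hω : IsOpen ω) (hS : tsupport X ⊆ ω) (t : ℝ) :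
    (pairEnergy (fun x => v (φ t x)) ω).toReal ≤
      Real.exp ((3 * n + 1) * L * |t|) * (pairEnergy v ω).toReal := by
  have h1 := (hφ.isBiLipschitz hX t).pairEnergy_comp_le hv.1.aestronglyMeasurable hω.measurableSet
    (hφ.mem_iff hX hS t)
  have h2 := ENNReal.toReal_mono (ENNReal.mul_lt_top (ENNReal.pow_lt_top ENNReal.coe_lt_top)
    hv.2).ne h1
  rw [ENNReal.toReal_mul, ENNReal.toReal_pow, ENNReal.coe_toReal,
    Real.coe_toNNReal _ (Real.exp_pos _).le, ← Real.exp_nat_mul] at h2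
  convert h2 using 3
  push_cast; ring

/-- The difference quotients of the energy along the flow are bounded by the energy. -/
lemma abs_energy_quotient_le (hv : FiniteEnergy v ω) (hφ : IsFlow X φ)
    (hX : LipschitzWith L X) (hω : IsOpen ω) (hne : ω.Nonempty) (hS : tsupport X ⊆ ω) {t : ℝ}
    (ht0 : t ≠ 0) (ht : |t| ≤ 1) :
    |((pairEnergy (fun x => v (φ t x)) ω).toReal - (pairEnergy v ω).toReal) / t| ≤
      ((3 * n + 1) * L * Real.exp (2 * ((3 * n + 1) * L))) * (pairEnergy v ω).toReal := by
  set C : ℝ := (3 * n + 1) * L with hC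
  have hC0 : 0 ≤ C := by positivity
  set e0 := (pairEnergy v ω).toReal
  set e1 := (pairEnergy (fun x => v (φ t x)) ω).toReal
  have h0 : 0 ≤ e0 := ENNReal.toReal_nonneg
  have h1 : e1 ≤ Real.exp (C * |t|) * e0 := toReal_pairEnergy_comp_flow_le hv hφ hX hω hS t
  have h2 := toReal_pairEnergy_comp_flow_le (hv.comp_flow hφ hX hω hne hS t) hφ hX hω hS (-t)
  simp only [hφ.map_map_neg hX, abs_neg, ← hC] at h2
  change e0 ≤ Real.exp (C * |t|) * e1 at h2
  have h3 : 0 ≤ C * |t| := by positivity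
  have h4 : Real.exp (C * |t|) ≤ Real.exp C := Real.exp_le_exp.2 (mul_le_of_le_one_right hC0 ht)
  have h5 : Real.exp (C * |t|) - 1 ≤ C * |t| * Real.exp C := by
    have h6 := Real.one_sub_le_exp_neg (C * |t|)
    have h7 : Real.exp (-(C * |t|)) * Real.exp (C * |t|) = 1 := by rw [← Real.exp_add]; simp
    have h8 := Real.exp_pos (C * |t|)
    have h9 : C * |t| * Real.exp (C * |t|) ≤ C * |t| * Real.exp C :=
      mul_le_mul_of_nonneg_left h4 h3
    nlinarith
  have hE : 1 ≤ Real.exp C := Real.one_le_exp hC0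
  have hE2 : Real.exp (2 * C) = Real.exp C * Real.exp C := by rw [← Real.exp_add]; ring_nf
  rw [abs_div, div_le_iff₀ (abs_pos.2 ht0), abs_le, hE2]
  have hCt : 0 ≤ C * |t| * Real.exp C := by positivity
  have k1 : (Real.exp (C * |t|) - 1) * e0 ≤ C * |t| * Real.exp C * e0 :=
    mul_le_mul_of_nonneg_right h5 h0
  have k2 : C * |t| * Real.exp C * e0 ≤ C * |t| * Real.exp C * e0 * Real.exp C :=
    le_mul_of_one_le_right (by positivity) hE
  have h1' : e1 ≤ Real.exp C * e0 := h1.trans (mul_le_mul_of_nonneg_right h4 h0)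
  have e1nn : 0 ≤ e1 := ENNReal.toReal_nonneg
  have k3 : (Real.exp (C * |t|) - 1) * e1 ≤ C * |t| * Real.exp C * (Real.exp C * e0) :=
    mul_le_mul h5 h1' e1nn hCt
  constructor <;> nlinarith

lemma isQuadratic_comp_flow (hφ : IsFlow X φ) (hX : LipschitzWith L X)
    (hω : IsOpen ω) (hne : ω.Nonempty) (hS : tsupport X ⊆ ω) (t : ℝ) :
    IsQuadratic ω fun v : Rn n → Rn m =>
      ((pairEnergy (fun x => v (φ t x)) ω).toReal - (pairEnergy v ω).toReal) / t := by
  intro a b ha hb l hl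
  have h1 := isQuadratic_pairEnergy ω a b ha hb l hl
  have h2 := isQuadratic_pairEnergy ω _ _ (ha.comp_flow hφ hX hω hne hS t)
    (hb.comp_flow hφ hX hω hne hS t) l hl
  simp only at h1 h2 ⊢
  rw [h1]
  change (pairEnergy (fun x => (a + b) (φ t x)) ω).toReal = _ + _ + 1 / 2 *
    ((pairEnergy (fun x => (l • a + l⁻¹ • b) (φ t x)) ω).toReal -
      (pairEnergy (fun x => (l • a - l⁻¹ • b) (φ t x)) ω).toReal) at h2
  rw [h2]
  ring

/-! ### Density of smooth maps -/

open Filter Topology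

lemma pairEnergy_le_two_mul (u : Rn n → Rn m) (ω : Set (Rn n)) :
    pairEnergy u ω ≤ 2 * ∫⁻ p in ω ×ˢ univ, pairDensity u p := by
  have h1 : touch ω = ω ×ˢ univ ∪ univ ×ˢ ω := by
    ext p; simp [touch]
  have hsw : ∫⁻ p in univ ×ˢ ω, pairDensity u p = ∫⁻ p in ω ×ˢ univ, pairDensity u p := by
    have h2 : MeasurePreserving (Prod.swap : Rn n × Rn n → _) volume volume :=
      Measure.measurePreserving_swap
    rw [← h2.setLIntegral_comp_preimage_emb MeasurableEquiv.prodComm.measurableEmbedding]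
    simp_rw [pairDensity_swap]
    rw [preimage_swap_prod]
  rw [pairEnergy, h1, two_mul]
  refine (lintegral_union_le _ _ _).trans ?_
  rw [hsw]

/-- Cutting off far away from `ω` costs little energy. -/
lemma tendsto_pairEnergy_indicator_compl {v : Rn n → Rn m} (hv : AEStronglyMeasurable v volume)
    {ω : Set (Rn n)} (hω : IsOpen ω) (hωb : Bornology.IsBounded ω) (hne : ω.Nonempty)
    (h : pairEnergy v ω < ∞) :
    Tendsto (fun R : ℕ => pairEnergy ((Metric.closedBall (0 : Rn n) R)ᶜ.indicator v) ω) atTop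
      (𝓝 0) := by
  obtain ⟨R₀, hR₀⟩ := hωb.subset_closedBall 0
  have hsq := integrable_weight_mul_sq hv hω hne h
  set g : Rn n → ℝ≥0∞ := fun z => ENNReal.ofReal (((1 + ‖z‖) ^ (n + 1))⁻¹ * ‖v z‖ ^ 2) with hg
  have hgi : ∫⁻ z, g z ≠ ∞ :=
    ((hasFiniteIntegral_iff_ofReal (Eventually.of_forall fun z => by positivity)).1 hsq.2).ne
  have hgm : AEMeasurable g := hsq.aestronglyMeasurable.aemeasurable.ennreal_ofReal
  have hcb : ∀ R : ℕ, MeasurableSet (Metric.closedBall (0 : Rn n) R)ᶜ := fun R =>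
    Metric.isClosed_closedBall.measurableSet.compl
  have h1 : Tendsto (fun R : ℕ => ∫⁻ z, (Metric.closedBall (0 : Rn n) R)ᶜ.indicator g z) atTop
      (𝓝 (∫⁻ _ : Rn n, 0)) := by
    refine tendsto_lintegral_of_dominated_convergence' g (fun R => hgm.indicator (hcb R))
      (fun R => Eventually.of_forall fun z => indicator_le_self _ _ _) hgi
      (Eventually.of_forall fun z => ?_)
    refine tendsto_const_nhds.congr' ?_
    filter_upwards [eventually_ge_atTop ⌈‖z‖⌉₊] with R hR
    rw [indicator_of_notMem]
    simpa using (Nat.le_ceil ‖z‖).trans (Nat.cast_le.2 hR)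
  rw [lintegral_zero] at h1
  have h2 : Tendsto (fun R : ℕ => 2 * (ENNReal.ofReal (2 ^ (n + 1)) * volume ω) *
      ∫⁻ z, (Metric.closedBall (0 : Rn n) R)ᶜ.indicator g z) atTop (𝓝 0) := by
    have hc : 2 * (ENNReal.ofReal (2 ^ (n + 1)) * volume ω) ≠ ∞ :=
      ENNReal.mul_ne_top (by norm_num)
        (ENNReal.mul_ne_top ENNReal.ofReal_ne_top hωb.measure_lt_top.ne)
    simpa using ENNReal.Tendsto.const_mul h1 (Or.inr hc)
  refine tendsto_of_tendsto_of_tendsto_of_le_of_le' tendsto_const_nhds h2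
    (Eventually.of_forall fun _ => zero_le) ?_
  -- once `ω` lies in the ball of radius `R / 2`, only pairs with one point far away remain
  filter_upwards [eventually_ge_atTop ⌈2 * |R₀| + 1⌉₊] with R hR
  have hR' : 2 * |R₀| + 1 ≤ R := (Nat.le_ceil _).trans (Nat.cast_le.2 hR)
  set B := Metric.closedBall (0 : Rn n) R with hB
  refine (pairEnergy_le_two_mul _ ω).trans ?_
  have h3 : ∫⁻ p in ω ×ˢ univ, pairDensity (Bᶜ.indicator v) p ≤
      ∫⁻ p in ω ×ˢ univ, ENNReal.ofReal (2 ^ (n + 1)) * Bᶜ.indicator g p.2 := by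
    refine setLIntegral_mono' (hω.measurableSet.prod MeasurableSet.univ) fun p hp => ?_
    have hp1 : ‖p.1‖ ≤ |R₀| := by
      have := hR₀ hp.1
      rw [mem_closedBall_zero_iff] at this
      exact this.trans (le_abs_self _)
    have hp1' : p.1 ∉ Bᶜ := by
      rw [notMem_compl_iff, hB, mem_closedBall_zero_iff]
      linarith [abs_nonneg R₀]
    rw [pairDensity, indicator_of_notMem hp1']
    by_cases hp2 : p.2 ∈ Bᶜ
    · rw [indicator_of_mem hp2, indicator_of_mem hp2, hg, ← ENNReal.ofReal_mul (by positivity)]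
      refine ENNReal.ofReal_le_ofReal ?_
      rw [mem_compl_iff, hB, mem_closedBall_zero_iff, not_le] at hp2
      have h4 : (1 + ‖p.2‖) / 2 ≤ ‖p.1 - p.2‖ := by
        have := norm_sub_norm_le p.2 p.1
        rw [norm_sub_rev] at this
        linarith
      have h5 : 0 < (1 + ‖p.2‖) / 2 := by positivity
      rw [zero_sub, norm_neg]
      calc _ ≤ ‖v p.2‖ ^ 2 / ((1 + ‖p.2‖) / 2) ^ (n + 1) := by gcongr
        _ = _ := by rw [div_pow]; field_simp
    · rw [indicator_of_notMem hp2]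
      simp
  have h4 : ∫⁻ p in ω ×ˢ (univ : Set (Rn n)), ENNReal.ofReal (2 ^ (n + 1)) * Bᶜ.indicator g p.2 =
      ENNReal.ofReal (2 ^ (n + 1)) * volume ω * ∫⁻ z, Bᶜ.indicator g z := by
    have e : (volume : Measure (Rn n × Rn n)).restrict (ω ×ˢ univ) =
        ((volume : Measure (Rn n)).restrict ω).prod volume := by
      rw [Measure.volume_eq_prod, ← Measure.prod_restrict, Measure.restrict_univ]
    rw [e, lintegral_prod _ ((((hgm.indicator (hcb R)).const_mul _)).comp_snd)]
    simp only
    rw [lintegral_const, lintegral_const_mul' _ _ ENNReal.ofReal_ne_top,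
      Measure.restrict_apply_univ]
    ring
  calc _ ≤ 2 * (ENNReal.ofReal (2 ^ (n + 1)) * volume ω * ∫⁻ z, Bᶜ.indicator g z) := by
        rw [← h4]; gcongr
    _ = _ := by ring

/-- Translations are continuous in `L²`. -/
lemma tendsto_lintegral_translate {E : Type*} [NormedAddCommGroup E] [NormedSpace ℝ E]
    [FiniteDimensional ℝ E] [MeasurableSpace E] [BorelSpace E] (μ : Measure E)
    [μ.IsAddHaarMeasure] {F : E → Rn m} (hF : MemLp F 2 μ) :
    Tendsto (fun c : E => ∫⁻ x, ‖F (c + x) - F x‖ₑ ^ 2 ∂μ) (𝓝 0) (𝓝 0) := by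
  have : Fact ((2 : ℝ≥0∞) ≠ ∞) := ⟨by norm_num⟩
  have hc : ∀ c : E, MemLp (fun x => F (c +ᵥ x)) 2 μ := fun c =>
    hF.comp_measurePreserving (measurePreserving_vadd c μ)
  have h1 : Tendsto (fun c : E => DomAddAct.mk c +ᵥ hF.toLp F) (𝓝 0)
      (𝓝 (DomAddAct.mk (0 : E) +ᵥ hF.toLp F)) := by
    have : Continuous fun c : E => DomAddAct.mk c +ᵥ hF.toLp F :=
      (continuous_vadd.comp
        ((DomAddAct.continuous_mk (M := E)).prodMk (continuous_const (y := hF.toLp F))))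
    exact this.tendsto 0
  rw [DomAddAct.mk_zero, zero_vadd] at h1
  have h2 := tendsto_iff_edist_tendsto_0.1 h1
  have h3 : ∀ c : E, edist (DomAddAct.mk c +ᵥ hF.toLp F) (hF.toLp F) ^ 2 =
      ∫⁻ x, ‖F (c + x) - F x‖ₑ ^ 2 ∂μ := by
    intro c
    rw [DomAddAct.mk_vadd_toLp, Lp.edist_toLp_toLp,
      eLpNorm_eq_lintegral_rpow_enorm_toReal (by norm_num) (by norm_num), ← ENNReal.rpow_natCast,
      ← ENNReal.rpow_mul]
    simp
  have h4 := ENNReal.Tendsto.pow (n := 2) h2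
  simp only [h3] at h4
  simpa using h4

/-- The difference quotient of `f` of which the energy density is the square, cut off to the pairs
meeting `ω`. -/
noncomputable def diffQuot (f : Rn n → Rn m) (ω : Set (Rn n)) : Rn n × Rn n → Rn m :=
  (touch ω).indicator fun p => (Real.sqrt (‖p.1 - p.2‖ ^ (n + 1)))⁻¹ • (f p.1 - f p.2)

lemma enorm_diffQuot_sq (f : Rn n → Rn m) {ω : Set (Rn n)} {p : Rn n × Rn n} (hp : p ∈ touch ω) :
    ‖diffQuot f ω p‖ₑ ^ 2 = pairDensity f p := by
  rw [diffQuot, indicator_of_mem hp, ← ofReal_norm, ← ENNReal.ofReal_pow (norm_nonneg _),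
    pairDensity, norm_smul, mul_pow, norm_inv, Real.norm_of_nonneg (Real.sqrt_nonneg _), inv_pow,
    Real.sq_sqrt (by positivity), inv_mul_eq_div]

lemma memLp_diffQuot {f : Rn n → Rn m} (hf : AEStronglyMeasurable f volume) {ω : Set (Rn n)}
    (hω : MeasurableSet ω) (h : pairEnergy f ω < ∞) : MemLp (diffQuot f ω) 2 volume := by
  have h1 : AEStronglyMeasurable (fun p : Rn n × Rn n => f p.1 - f p.2)
    ((volume : Measure (Rn n)).prod volume) := hf.comp_fst.sub hf.comp_snd
  have h2 : Measurable fun p : Rn n × Rn n => (Real.sqrt (‖p.1 - p.2‖ ^ (n + 1)))⁻¹ := by fun_prop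
  have hm : AEStronglyMeasurable (diffQuot f ω) volume :=
    (h2.aestronglyMeasurable.smul h1).indicator (measurableSet_touch hω)
  refine ⟨hm, ?_⟩
  rw [eLpNorm_lt_top_iff_lintegral_rpow_enorm_lt_top (by norm_num) (by norm_num)]
  refine lt_of_eq_of_lt ?_ h
  rw [pairEnergy, ← lintegral_indicator (measurableSet_touch hω)]
  refine lintegral_congr fun p => ?_
  by_cases hp : p ∈ touch ω
  · rw [indicator_of_mem hp, ← enorm_diffQuot_sq f hp]; simp
  · rw [indicator_of_notMem hp, diffQuot, indicator_of_notMem hp]; simp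

open scoped Convolution in
/-- Mollification converges in the energy of a slightly smaller set: it averages the translates
of the difference quotient. -/
lemma exists_mollification {f : Rn n → Rn m} (hf : Integrable f) {ω ω' : Set (Rn n)}
    (hω : MeasurableSet ω) (hω' : MeasurableSet ω')
    (h : pairEnergy f ω < ∞) {δ : ℝ} (hδ : 0 < δ)
    (hsub : ∀ x ∈ ω', ∀ s : Rn n, ‖s‖ < δ → s + x ∈ ω) (hcf : HasCompactSupport f)
    {ε : ℝ≥0∞} (hε : 0 < ε) :
    ∃ w : Rn n → Rn m, ContDiff ℝ ((⊤ : ℕ∞) : WithTop ℕ∞) w ∧ HasCompactSupport w ∧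
      pairEnergy (w - f) ω' ≤ ε := by
  have hF := memLp_diffQuot hf.aestronglyMeasurable hω h
  set F := diffQuot f ω with hFdef
  have : (volume : Measure (Rn n × Rn n)).IsAddHaarMeasure :=
    Measure.prod.instIsAddHaarMeasure _ _
  have h1 := tendsto_lintegral_translate volume hF
  have h2 : Tendsto (fun s : Rn n => ∫⁻ p, ‖F ((-s, -s) + p) - F p‖ₑ ^ 2) (𝓝 0) (𝓝 0) :=
    h1.comp ((continuous_neg.prodMk continuous_neg).tendsto' (0 : Rn n) 0 (by simp))
  obtain ⟨r, hr, hrb⟩ := Metric.eventually_nhds_iff.1 (h2.eventually (gt_mem_nhds hε))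
  let ρ₀ : ContDiffBump (0 : Rn n) :=
    ⟨min r δ / 2, min r δ, by have := lt_min hr hδ; positivity, by
      have := lt_min hr hδ; linarith⟩
  set ρ : Rn n → ℝ := ρ₀.normed volume with hρ
  have hρ0 : ∀ s, 0 ≤ ρ s := fun s => ρ₀.nonneg_normed s
  have hρc : Continuous ρ := ρ₀.continuous_normed
  have hρs : ∀ s, ρ s ≠ 0 → ‖s‖ < r ∧ ‖s‖ < δ := fun s hs => by
    have : s ∈ Metric.ball (0 : Rn n) (min r δ) := by
      rw [← ρ₀.support_normed_eq (μ := volume)]; exact hs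
    rw [mem_ball_zero_iff] at this
    exact ⟨this.trans_le (min_le_left _ _), this.trans_le (min_le_right _ _)⟩
  have hρ1 : ∫⁻ s, ENNReal.ofReal (ρ s) = 1 := by
    rw [← ofReal_integral_eq_lintegral_ofReal ρ₀.integrable_normed
      (Eventually.of_forall hρ0), ρ₀.integral_normed, ENNReal.ofReal_one]
  set w : Rn n → Rn m := ρ ⋆[ContinuousLinearMap.lsmul ℝ ℝ, volume] f with hw
  have hwx : ∀ x, w x = ∫ s, ρ s • f (x - s) := fun x => rfl
  have hρk : HasCompactSupport ρ := ρ₀.hasCompactSupport_normed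
  have hint : ∀ x, Integrable fun s => ρ s • f (x - s) := fun x =>
    (hρk.convolutionExists_left (ContinuousLinearMap.lsmul ℝ ℝ) hρc hf.locallyIntegrable x)
  refine ⟨w, hρk.contDiff_convolution_left _ ρ₀.contDiff_normed hf.locallyIntegrable,
    hρk.convolution _ hcf, ?_⟩
  have hw0 : ∀ x, w x - f x = ∫ s, ρ s • (f (x - s) - f x) := fun x => by
    simp_rw [smul_sub]
    rw [integral_sub (hint x) (ρ₀.integrable_normed.smul_const _), integral_smul_const, hwx,
      ρ₀.integral_normed, one_smul]
  have hint' : ∀ x, Integrable fun s => ρ s • (f (x - s) - f x) := fun x => by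
    simp_rw [smul_sub]
    exact (hint x).sub (ρ₀.integrable_normed.smul_const _)
  -- on pairs meeting `ω'` the quotient of `w - f` averages the increments of `F`
  have havg : ∀ p ∈ touch ω', diffQuot (w - f) ω' p = ∫ s, ρ s • (F ((-s, -s) + p) - F p) := by
    intro p hp
    have hp' : p ∈ touch ω := hp.imp (fun hx => by simpa using hsub _ hx 0 (by simpa using hδ))
      (fun hx => by simpa using hsub _ hx 0 (by simpa using hδ))
    rw [diffQuot, indicator_of_mem hp, Pi.sub_apply, Pi.sub_apply, hw0, hw0,
      ← integral_sub (hint' _) (hint' _), ← integral_smul]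
    refine integral_congr_ae (Eventually.of_forall fun s => ?_)
    by_cases hs : ρ s = 0
    · simp [hs]
    · have hps : (-s, -s) + p ∈ touch ω := by
        have hn : ‖-s‖ < δ := by rw [norm_neg]; exact (hρs s hs).2
        exact hp.imp (fun hx => hsub _ hx _ hn) (fun hx => hsub _ hx _ hn)
      simp only [hFdef, diffQuot]
      rw [indicator_of_mem hps, indicator_of_mem hp']
      simp only [Prod.fst_add, Prod.snd_add, neg_add_eq_sub, sub_sub_sub_cancel_right]
      module
  -- the shear `(s, p) ↦ (s, p - (s, s))` preserves the measure
  have hjoint' : AEStronglyMeasurable (fun q : Rn n × (Rn n × Rn n) =>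
      F ((-q.1, -q.1) + q.2) - F q.2) (volume.prod volume) := by
    have hmp := (MeasurePreserving.id (volume : Measure (Rn n))).skew_product
      (μc := (volume : Measure (Rn n × Rn n))) (μd := (volume : Measure (Rn n × Rn n)))
      (g := fun s p => (-s, -s) + p) (by fun_prop)
      (Eventually.of_forall fun s => (measurePreserving_add_left volume (-s, -s)).map_eq)
    exact ((hF.aestronglyMeasurable.comp_snd
      (μ := (volume : Measure (Rn n)))).comp_measurePreserving hmp).sub
      hF.aestronglyMeasurable.comp_snd
  have hjoint : AEMeasurable (Function.uncurry fun (s : Rn n) (p : Rn n × Rn n) =>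
      ENNReal.ofReal (ρ s) * ‖F ((-s, -s) + p) - F p‖ₑ ^ 2) (volume.prod volume) :=
    (hρc.measurable.comp measurable_fst).ennreal_ofReal.aemeasurable.mul
      (hjoint'.enorm.pow_const 2)
  -- Cauchy-Schwarz for the probability density `ρ`
  have key : ∀ p ∈ touch ω', ∀ (_ : AEMeasurable fun s => ‖F ((-s, -s) + p) - F p‖ₑ),
      pairDensity (w - f) p ≤
      ∫⁻ s, ENNReal.ofReal (ρ s) * ‖F ((-s, -s) + p) - F p‖ₑ ^ 2 := by
    intro p hp hm
    have hρm : AEMeasurable fun s => ENNReal.ofReal (Real.sqrt (ρ s)) :=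
      (by fun_prop : Measurable fun s => ENNReal.ofReal (Real.sqrt (ρ s))).aemeasurable
    have hsq : ∀ s, ENNReal.ofReal (Real.sqrt (ρ s)) ^ 2 = ENNReal.ofReal (ρ s) := fun s => by
      rw [← ENNReal.ofReal_pow (Real.sqrt_nonneg _), Real.sq_sqrt (hρ0 s)]
    rw [← enorm_diffQuot_sq _ hp, havg p hp]
    have h5 := sq_lintegral_mul_le hρm (hρm.mul hm)
    simp only [Pi.mul_apply, mul_pow, hsq, hρ1, one_mul, ← mul_assoc, ← sq] at h5
    refine le_trans ?_ h5
    gcongr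
    refine (enorm_integral_le_lintegral_enorm _).trans (lintegral_mono fun s => ?_)
    rw [enorm_smul, Real.enorm_of_nonneg (hρ0 s)]
  have hmeas : ∀ᵐ p : Rn n × Rn n, AEMeasurable fun s => ‖F ((-s, -s) + p) - F p‖ₑ := by
    filter_upwards [hjoint'.prod_swap.prodMk_left] with p hp
    exact hp.enorm
  calc pairEnergy (w - f) ω' ≤ ∫⁻ p in touch ω', ∫⁻ s,
        ENNReal.ofReal (ρ s) * ‖F ((-s, -s) + p) - F p‖ₑ ^ 2 := by
        refine lintegral_mono_ae ?_
        filter_upwards [ae_restrict_of_ae hmeas, self_mem_ae_restrict (measurableSet_touch hω')]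
          with p h6 hp
        exact key p hp h6
    _ ≤ ∫⁻ p : Rn n × Rn n, ∫⁻ s, ENNReal.ofReal (ρ s) * ‖F ((-s, -s) + p) - F p‖ₑ ^ 2 :=
        setLIntegral_le_lintegral _ _
    _ = ∫⁻ s, ∫⁻ p : Rn n × Rn n, ENNReal.ofReal (ρ s) * ‖F ((-s, -s) + p) - F p‖ₑ ^ 2 :=
        (lintegral_lintegral_swap hjoint).symm
    _ ≤ ∫⁻ s, ENNReal.ofReal (ρ s) * ε := by
        refine lintegral_mono fun s => ?_
        rw [lintegral_const_mul' _ _ ENNReal.ofReal_ne_top]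
        by_cases hs : ρ s = 0
        · simp [hs]
        · have := hrb (y := s) (by rw [dist_zero_right]; exact (hρs s hs).1)
          gcongr
    _ = ε := by rw [lintegral_mul_const _ (by fun_prop), hρ1, one_mul]

lemma poissonIntegrable_of_integrable {f : Rn n → Rn m} (hf : Integrable f) :
    PoissonIntegrable f := by
  refine hf.norm.mono' ((integrable_weight n).aestronglyMeasurable.smul hf.aestronglyMeasurable)
    (Eventually.of_forall fun z => ?_)
  rw [norm_smul, Real.norm_of_nonneg (by positivity)]
  refine mul_le_of_le_one_left (norm_nonneg _) (inv_le_one_of_one_le₀ (one_le_pow₀ ?_))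
  linarith [norm_nonneg z]

/-- Smooth compactly supported maps are dense for the energy of a slightly smaller set. -/
lemma exists_smooth_approx {v : Rn n → Rn m} {ω ω' : Set (Rn n)} (hv : FiniteEnergy v ω)
    (hω : IsOpen ω) (hωb : Bornology.IsBounded ω) (hne : ω.Nonempty) (hω' : MeasurableSet ω')
    {δ : ℝ} (hδ : 0 < δ) (hsub : ∀ x ∈ ω', ∀ s : Rn n, ‖s‖ < δ → s + x ∈ ω) :
    ∃ w : ℕ → Rn n → Rn m, (∀ k, ContDiff ℝ ((⊤ : ℕ∞) : WithTop ℕ∞) (w k)) ∧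
      (∀ k, HasCompactSupport (w k)) ∧ (∀ k, FiniteEnergy (w k) ω') ∧
      Tendsto (fun k => (pairEnergy (w k - v) ω').toReal) atTop (𝓝 0) := by
  have hss : ω' ⊆ ω := fun x hx => by simpa using hsub x hx 0 (by simpa using hδ)
  have hvm := hv.1.aestronglyMeasurable
  have key : ∀ k : ℕ, ∃ w : Rn n → Rn m, ContDiff ℝ ((⊤ : ℕ∞) : WithTop ℕ∞) w ∧
      HasCompactSupport w ∧ pairEnergy (w - v) ω' ≤ ENNReal.ofReal (1 / (k + 1)) := by
    intro k
    -- cut off outside a large ball, then mollify, each at the cost of a quarter of the error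
    set ε : ℝ≥0∞ := ENNReal.ofReal (1 / (k + 1)) / 4 with hε
    have hε0 : 0 < ε := ENNReal.div_pos (by simp; positivity) (by norm_num)
    obtain ⟨R, hR⟩ := ((tendsto_pairEnergy_indicator_compl hvm hω hωb hne hv.2).eventually
      (gt_mem_nhds hε0)).exists
    set B := Metric.closedBall (0 : Rn n) R with hB
    have hBm : MeasurableSet B := Metric.isClosed_closedBall.measurableSet
    have hdec : v - Bᶜ.indicator v = B.indicator v := by
      rw [indicator_compl, sub_sub_cancel]
    have hcut : FiniteEnergy (B.indicator v) ω := by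
      rw [← hdec]
      refine hv.sub ⟨?_, hR.trans (by simp [hε, ENNReal.div_lt_top])⟩
      refine (Integrable.indicator hv.1 hBm.compl).congr (Eventually.of_forall fun z => ?_)
      by_cases hz : z ∈ Bᶜ
      · simp only [indicator_of_mem hz]
      · simp only [indicator_of_notMem hz, smul_zero]
    have hint : Integrable (B.indicator v) := by
      have h1 := (Integrable.norm (Integrable.indicator hv.1 hBm)).const_mul ((1 + (R : ℝ)) ^ (n + 1))
      refine h1.mono' (hvm.indicator hBm) (Eventually.of_forall fun z => ?_)
      by_cases hz : z ∈ B
      · simp only [indicator_of_mem hz]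
        rw [norm_smul, Real.norm_of_nonneg (by positivity), ← mul_assoc, ← div_eq_mul_inv]
        refine le_mul_of_one_le_left (norm_nonneg _) ((one_le_div (by positivity)).2 ?_)
        have : ‖z‖ ≤ R := by simpa [hB] using hz
        gcongr
      · simp [indicator_of_notMem hz]
    obtain ⟨w, hw1, hw2, hw3⟩ := exists_mollification hint hω.measurableSet hω' hcut.2 hδ hsub
      (HasCompactSupport.intro (isCompact_closedBall (0 : Rn n) R) fun x hx =>
        indicator_of_notMem hx _) hε0
    refine ⟨w, hw1, hw2, ?_⟩
    have e : w - v = (w - B.indicator v) + (-1 : ℝ) • Bᶜ.indicator v := by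
      rw [← hdec]; module
    have hwm : AEStronglyMeasurable (w - B.indicator v) volume :=
      hw1.continuous.aestronglyMeasurable.sub hint.aestronglyMeasurable
    rw [e]
    refine (pairEnergy_add_le hwm ω').trans ?_
    rw [pairEnergy_smul]
    have h5 : pairEnergy (Bᶜ.indicator v) ω' ≤ ε :=
      (lintegral_mono_set (touch_mono hss)).trans hR.le
    calc _ ≤ 2 * ε + 2 * (ENNReal.ofReal ((-1) ^ 2) * ε) := by gcongr
      _ = 4 * ε := by
          rw [neg_one_sq, ENNReal.ofReal_one, one_mul, ← add_mul]; norm_num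
      _ = _ := by rw [hε]; exact ENNReal.mul_div_cancel (by norm_num) (by norm_num)
  choose w hw1 hw2 hw3 using key
  have hfin : ∀ k, pairEnergy (w k - v) ω' < ∞ := fun k => (hw3 k).trans_lt ENNReal.ofReal_lt_top
  have hpi : ∀ k, PoissonIntegrable (w k) := fun k =>
    poissonIntegrable_of_integrable ((hw1 k).continuous.integrable_of_hasCompactSupport (hw2 k))
  refine ⟨w, hw1, hw2, fun k => ?_, ?_⟩
  · have h1 : FiniteEnergy (w k - v) ω' := ⟨(hpi k).sub hv.1, hfin k⟩
    have := h1.add (hv.mono hss)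
    rwa [sub_add_cancel] at this
  · refine squeeze_zero (fun k => ENNReal.toReal_nonneg) (fun k => ?_)
      tendsto_one_div_add_atTop_nhds_zero_nat
    have := ENNReal.toReal_mono ENNReal.ofReal_ne_top (hw3 k)
    rwa [ENNReal.toReal_ofReal (by positivity)] at this

/-! ### Dirichlet bound and the stress functional -/

lemma fderiv_harmExt_add {v w : Rn n → Rn m} (hv : PoissonIntegrable v)
    (hw : PoissonIntegrable w) {x : Rn (n + 1)} (hx : 0 < height x) :
    fderiv ℝ (harmExt (v + w)) x = fderiv ℝ (harmExt v) x + fderiv ℝ (harmExt w) x := by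
  have h := fderiv_harmExt_sub (hv.add hw) hw hx
  simp only [Pi.add_apply, add_sub_cancel_right] at h
  rw [h, sub_add_cancel]

lemma harmExt_smul (c : ℝ) (v : Rn n → Rn m) : harmExt (c • v) = c • harmExt v := by
  funext x
  rw [Pi.smul_apply, harmExt_eq_integral_pk, harmExt_eq_integral_pk, ← integral_smul]
  simp_rw [Pi.smul_apply, smul_comm c]

lemma fderiv_harmExt_smul (c : ℝ) {v : Rn n → Rn m} (hv : PoissonIntegrable v)
    {x : Rn (n + 1)} (hx : 0 < height x) :
    fderiv ℝ (harmExt (c • v)) x = c • fderiv ℝ (harmExt v) x := by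
  rw [harmExt_smul]
  exact fderiv_const_smul (hasFDerivAt_harmExt hv hx).differentiableAt c

/-! The stress of a gradient `L` against the gradient `D` of a vector field. -/

/-- The coefficients `δ_{ij} div Y - 2 ∂_j Y_i`, for `D` the derivative of `Y`. -/
noncomputable def stressCoeff {k : ℕ} (D : Rn k →L[ℝ] Rn k) (i j : Fin k) : ℝ :=
  (if i = j then ∑ l, D (EuclideanSpace.single l 1) l else 0) -
    2 * D (EuclideanSpace.single j 1) i

lemma stressIntegrand_eq {k : ℕ} (u : Rn k → Rn m) (Y : Rn k → Rn k) (x : Rn k) :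
    stressIntegrand u Y x = ∑ i, ∑ j, stressCoeff (fderiv ℝ Y x) i j *
      inner ℝ (pderiv u i x) (pderiv u j x) := by
  simp only [stressIntegrand, stressCoeff, gradSq, divergence, sub_mul, ite_mul, zero_mul,
    Finset.sum_sub_distrib, Finset.sum_ite_eq, Finset.mem_univ, if_true, real_inner_self_eq_norm_sq,
    Finset.mul_sum, Finset.sum_mul]
  congr 1
  · rw [Finset.sum_comm]
    simp only [pderiv]
    exact Finset.sum_congr rfl fun i _ => Finset.sum_congr rfl fun j _ => mul_comm _ _
  · refine Finset.sum_congr rfl fun i _ => Finset.sum_congr rfl fun j _ => ?_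
    simp only [pderiv]; ring

lemma norm_apply_single_le {k : ℕ} {E : Type*} [NormedAddCommGroup E] [NormedSpace ℝ E]
    (D : Rn k →L[ℝ] E) (i : Fin k) : ‖D (EuclideanSpace.single i 1)‖ ≤ ‖D‖ := by
  simpa using D.le_opNorm (EuclideanSpace.single i 1)

lemma abs_stressCoeff_le {k : ℕ} (D : Rn k →L[ℝ] Rn k) (i j : Fin k) :
    |stressCoeff D i j| ≤ (k + 2) * ‖D‖ := by
  have h : ∀ a b : Fin k, |D (EuclideanSpace.single a 1) b| ≤ ‖D‖ := fun a b =>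
    ((Real.norm_eq_abs _).symm.le.trans (PiLp.norm_apply_le _ b)).trans (norm_apply_single_le D a)
  have h1 : |if i = j then ∑ l, D (EuclideanSpace.single l 1) l else 0| ≤ k * ‖D‖ := by
    split_ifs
    · refine (Finset.abs_sum_le_sum_abs _ _).trans ((Finset.sum_le_sum fun l _ => h l l).trans ?_)
      simp
    · simp; positivity
  refine (abs_sub _ _).trans ?_
  rw [abs_mul, abs_two]
  linarith [h j i]

/-- The stress integrand is bounded by `|DY| |∇u|²`, up to a constant depending on the dimension. -/
lemma abs_stressIntegrand_le {k : ℕ} (u : Rn k → Rn m) (Y : Rn k → Rn k) (x : Rn k) :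
    |stressIntegrand u Y x| ≤ (k ^ 2 * (k + 2)) * ‖fderiv ℝ Y x‖ * ‖fderiv ℝ u x‖ ^ 2 := by
  rw [stressIntegrand_eq]
  have h : ∀ i j, |stressCoeff (fderiv ℝ Y x) i j * inner ℝ (pderiv u i x) (pderiv u j x)| ≤
      (k + 2) * ‖fderiv ℝ Y x‖ * ‖fderiv ℝ u x‖ ^ 2 := fun i j => by
    rw [abs_mul, sq]
    refine mul_le_mul (abs_stressCoeff_le _ i j) ((abs_real_inner_le_norm _ _).trans ?_)
      (abs_nonneg _) (by positivity)
    exact mul_le_mul (norm_apply_single_le _ i) (norm_apply_single_le _ j) (norm_nonneg _)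
      (norm_nonneg _)
  refine (Finset.abs_sum_le_sum_abs _ _).trans ((Finset.sum_le_sum fun i _ =>
    (Finset.abs_sum_le_sum_abs _ _).trans (Finset.sum_le_sum fun j _ => h i j)).trans (le_of_eq ?_))
  simp
  ring

lemma measurable_pderiv {k l : ℕ} (u : Rn k → Rn l) (j : Fin k) : Measurable (pderiv u j) :=
  measurable_fderiv_apply_const ℝ u _

lemma measurable_stressIntegrand {k : ℕ} (u : Rn k → Rn m) (Y : Rn k → Rn k) :
    Measurable (stressIntegrand u Y) := by
  have h1 := fun j => measurable_pderiv u j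
  have h2 : ∀ i j, Measurable fun x => pderiv Y j x i := fun i j =>
    (EuclideanSpace.proj (𝕜 := ℝ) i).continuous.measurable.comp (measurable_pderiv Y j)
  unfold stressIntegrand gradSq divergence
  refine (Measurable.mul (Finset.measurable_fun_sum _ fun j _ => (h1 j).norm.pow_const 2)
    (Finset.measurable_fun_sum _ fun i _ => h2 i i)).sub (Measurable.const_mul
      (Finset.measurable_fun_sum _ fun i _ => Finset.measurable_fun_sum _ fun j _ =>
        ((h1 i).inner (h1 j)).mul (h2 i j)) 2)

lemma inner_polarise {E : Type*} [NormedAddCommGroup E] [InnerProductSpace ℝ E] (a b a' b' : E)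
    {l : ℝ} (hl : l ≠ 0) : inner ℝ (a + b) (a' + b') = inner ℝ a a' + inner ℝ b b' + 1 / 2 *
      (inner ℝ (l • a + l⁻¹ • b) (l • a' + l⁻¹ • b') -
        inner ℝ (l • a - l⁻¹ • b) (l • a' - l⁻¹ • b')) := by
  simp only [inner_add_left, inner_add_right, inner_sub_left, inner_sub_right,
    real_inner_smul_left, real_inner_smul_right]
  field_simp
  ring

/-- The Dirichlet integral over `Ω` is bounded by the energy, when the part of `Ω` that is
close to `ℝⁿ` lies above `ω`. -/
lemma exists_dirichlet_bound {ω : Set (Rn n)} (hω : IsOpen ω) (hωb : Bornology.IsBounded ω)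
    (hne : ω.Nonempty) {Ω : Set (Rn (n + 1))} (hΩb : Bornology.IsBounded Ω)
    (hΩm : MeasurableSet Ω) (hΩ : Ω ⊆ upperHalf n) {δ : ℝ} (hδ : 0 < δ)
    (hsplit : ∀ x ∈ Ω, horiz x ∈ ω ∨ δ ≤ height x) :
    ∃ C : ℝ, 0 ≤ C ∧ ∀ v : Rn n → Rn m, FiniteEnergy v ω →
      ∫⁻ x in Ω, ENNReal.ofReal (‖fderiv ℝ (harmExt v) x‖ ^ 2) ≤
        ENNReal.ofReal C * pairEnergy v ω := by
  obtain ⟨R₁, hR₁⟩ := hΩb.subset_closedBall 0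
  obtain ⟨R₂, hR₂⟩ := hωb.subset_closedBall 0
  set R := max |R₁| |R₂| with hR
  have hR0 : 0 ≤ R := (abs_nonneg _).trans (le_max_left _ _)
  have hΩR : ∀ x ∈ Ω, ‖x‖ ≤ R := fun x hx => by
    have := hR₁ hx
    rw [mem_closedBall_zero_iff] at this
    exact (this.trans (le_abs_self _)).trans (le_max_left _ _)
  have hωR : ∀ x ∈ ω, ‖x‖ ≤ R := fun x hx => by
    have := hR₂ hx
    rw [mem_closedBall_zero_iff] at this
    exact (this.trans (le_abs_self _)).trans (le_max_right _ _)
  set A : ℝ := δ ^ (-(1 / 2) : ℝ) * δ ^ (-(1 / 2) : ℝ) *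
    ((1 + R) * ((1 + R) / δ + 1)) ^ (n + 1) with hA
  have hA0 : 0 ≤ A := by positivity
  have hvol : volume ω ≠ 0 := (hω.measure_pos volume hne).ne'
  have hvol' : volume ω ≠ ∞ := hωb.measure_lt_top.ne
  have hΩv : volume Ω ≠ ∞ := hΩb.measure_lt_top.ne
  set V := (volume Ω).toReal / (volume ω).toReal with hV
  refine ⟨3 * gradConst n + V * (gradConst n * A), by
    have := gradConst_nonneg n; positivity, fun v hv => ?_⟩
  have hvm := hv.1.aestronglyMeasurable
  set f : Rn (n + 1) → ℝ≥0∞ := fun x => ENNReal.ofReal (‖fderiv ℝ (harmExt v) x‖ ^ 2) with hf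
  have hfm : Measurable f := ((measurable_fderiv ℝ (harmExt v)).norm.pow_const 2).ennreal_ofReal
  -- the part of `Ω` above `ω`
  have h1 : ∫⁻ x in Ω ∩ horiz ⁻¹' ω, f x ≤
      ENNReal.ofReal (3 * gradConst n) * pairEnergy v ω := by
    set S : Set (Rn (n + 1)) := (fun x => (horiz x, height x)) ⁻¹' (ω ×ˢ Ioi 0) with hS
    have hSm : MeasurableSet S :=
      (continuous_horiz.prodMk continuous_height).measurable (hω.measurableSet.prod measurableSet_Ioi)
    calc _ ≤ ∫⁻ x in S, f x := lintegral_mono_set fun x hx => ⟨hx.2, hΩ hx.1⟩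
      _ = ∫⁻ p in ω ×ˢ Ioi 0, f (up p.1 p.2) := by
          rw [← lintegral_indicator hSm, lintegral_eq_lintegral_up,
            ← lintegral_indicator (hω.measurableSet.prod measurableSet_Ioi)]
          refine lintegral_congr fun p => ?_
          have : up p.1 p.2 ∈ S ↔ p ∈ ω ×ˢ Ioi 0 := by simp [hS]
          by_cases hp : p ∈ ω ×ˢ Ioi 0
          · rw [indicator_of_mem hp, indicator_of_mem (this.2 hp)]
          · rw [indicator_of_notMem hp, indicator_of_notMem (fun h => hp (this.1 h))]
      _ = ∫⁻ x in ω, ∫⁻ s in Ioi (0 : ℝ), f (up x s) := by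
          rw [Measure.volume_eq_prod, ← Measure.prod_restrict, lintegral_prod]
          exact (hfm.comp continuous_up.measurable).aemeasurable
      _ ≤ _ := (lintegral_cylinder_le hv.1 ω).trans (by
          gcongr; exact lintegral_lintegral_pairDensity_le hvm)
  -- far from `ℝⁿ` the gradient is bounded pointwise, on average over base points `x₀` in `ω`
  have h2 : ∀ x ∈ Ω \ horiz ⁻¹' ω, f x ≤
      ENNReal.ofReal (gradConst n * A) * (pairEnergy v ω / volume ω) := by
    intro x hx
    have hxh : δ ≤ height x := (hsplit x hx.1).resolve_left hx.2
    have hx0 : 0 < height x := hδ.trans_le hxh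
    have h3 : ∀ x₀ ∈ ω, f x ≤ ENNReal.ofReal (gradConst n * A) * ∫⁻ z, pairDensity v (x₀, z) := by
      intro x₀ hx₀
      have h4 := sq_norm_fderiv_harmExt_le hv.1 (v x₀) (horiz x) hx0
      rw [up_horiz_height] at h4
      refine h4.trans ?_
      rw [ENNReal.ofReal_mul (gradConst_nonneg n), mul_assoc,
        ← lintegral_const_mul' (ENNReal.ofReal A) _ ENNReal.ofReal_ne_top]
      refine mul_le_mul' le_rfl (lintegral_mono fun z => ?_)
      rw [pairDensity, ← ENNReal.ofReal_mul (by positivity), ← ENNReal.ofReal_mul hA0]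
      refine ENNReal.ofReal_le_ofReal ?_
      simp only
      have hQ : ‖horiz x - z‖ ^ 2 + height x ^ 2 = ‖x - emb z‖ ^ 2 := by
        rw [norm_sq_eq_horiz_add_height, horiz_sub, height_sub, horiz_emb, height_emb, sub_zero]
      have hρ : δ ≤ ‖x - emb z‖ := hxh.trans (height_le_norm_sub_emb x z)
      have hρ0 : 0 < ‖x - emb z‖ := hδ.trans_le hρ
      have h5 : (‖x - emb z‖ ^ 2) ^ (-((n : ℝ) + 3 / 2) / 2) =
          ‖x - emb z‖ ^ (-(1 / 2) : ℝ) * (‖x - emb z‖ ^ (n + 1))⁻¹ := by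
        rw [← Real.rpow_natCast _ 2, ← Real.rpow_mul hρ0.le, ← Real.rpow_natCast _ (n + 1),
          ← Real.rpow_neg hρ0.le, ← Real.rpow_add hρ0]
        congr 1; push_cast; ring
      rcases eq_or_ne x₀ z with rfl | hxz
      · simp
      have hxz' : 0 < ‖x₀ - z‖ := norm_pos_iff.mpr (sub_ne_zero.mpr hxz)
      have h6 : ‖x₀ - z‖ ≤ ((1 + R) * ((1 + R) / δ + 1)) * ‖x - emb z‖ := by
        have h7 := one_add_norm_le hx0 z
        have h8 : ((1 + ‖x‖) / height x + 1) ≤ (1 + R) / δ + 1 := by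
          have := hΩR x hx.1
          gcongr
        have h9 : ‖x₀ - z‖ ≤ (1 + R) * (1 + ‖z‖) := by
          have h10 := norm_sub_le x₀ z
          have := hωR x₀ hx₀
          nlinarith [norm_nonneg z, mul_nonneg hR0 (norm_nonneg z)]
        calc _ ≤ (1 + R) * (1 + ‖z‖) := h9
          _ ≤ (1 + R) * (((1 + R) / δ + 1) * ‖x - emb z‖) := by
              gcongr; exact h7.trans (by gcongr)
          _ = _ := by ring
      have h11 : (‖x - emb z‖ ^ (n + 1))⁻¹ ≤
          ((1 + R) * ((1 + R) / δ + 1)) ^ (n + 1) / ‖x₀ - z‖ ^ (n + 1) := by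
        rw [inv_eq_one_div, div_le_div_iff₀ (by positivity) (by positivity), one_mul, ← mul_pow]
        gcongr
      rw [hQ, h5, norm_sub_rev (v z)]
      have h12 : height x ^ (-(1 / 2) : ℝ) ≤ δ ^ (-(1 / 2) : ℝ) :=
        Real.rpow_le_rpow_of_nonpos hδ hxh (by norm_num)
      have h13 : ‖x - emb z‖ ^ (-(1 / 2) : ℝ) ≤ δ ^ (-(1 / 2) : ℝ) :=
        Real.rpow_le_rpow_of_nonpos hδ hρ (by norm_num)
      calc _ ≤ δ ^ (-(1 / 2) : ℝ) * (δ ^ (-(1 / 2) : ℝ) * (((1 + R) * ((1 + R) / δ + 1)) ^ (n + 1) /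
            ‖x₀ - z‖ ^ (n + 1))) * ‖v x₀ - v z‖ ^ 2 := by gcongr
        _ = _ := by rw [hA]; ring
    have h14 : f x * volume ω ≤ ENNReal.ofReal (gradConst n * A) * pairEnergy v ω := by
      rw [← setLIntegral_const]
      refine (setLIntegral_mono' hω.measurableSet h3).trans ?_
      rw [lintegral_const_mul' _ _ ENNReal.ofReal_ne_top]
      gcongr
      exact lintegral_lintegral_pairDensity_le hvm
    rw [← mul_div_assoc]
    exact ENNReal.le_div_iff_mul_le (Or.inl hvol) (Or.inl hvol') |>.2 h14
  have hΩ1 : MeasurableSet (horiz ⁻¹' ω : Set (Rn (n + 1))) :=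
    continuous_horiz.measurable hω.measurableSet
  rw [← lintegral_inter_add_sdiff f Ω hΩ1]
  have h15 : ∫⁻ x in Ω \ horiz ⁻¹' ω, f x ≤
      ENNReal.ofReal (V * (gradConst n * A)) * pairEnergy v ω := by
    refine (setLIntegral_mono' (hΩm.diff hΩ1) h2).trans ?_
    rw [setLIntegral_const]
    have : volume Ω / volume ω = ENNReal.ofReal V := by
      rw [hV, ENNReal.ofReal_div_of_pos (ENNReal.toReal_pos hvol hvol'), ENNReal.ofReal_toReal hΩv,
        ENNReal.ofReal_toReal hvol']
    rw [ENNReal.ofReal_mul (p := V) (by positivity), ← this]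
    calc _ ≤ ENNReal.ofReal (gradConst n * A) * (pairEnergy v ω / volume ω) * volume Ω := by
          gcongr; exact sdiff_subset
      _ = _ := by simp only [div_eq_mul_inv]; ring
  calc _ ≤ _ := add_le_add h1 h15
    _ = _ := by
      have := gradConst_nonneg n
      rw [← add_mul, ← ENNReal.ofReal_add (by positivity) (by positivity)]

/-- The stress functional `v ↦ -½ ∫_Ω (|∇vᵉ|² div Y - 2 ∑ ⟨∂ᵢvᵉ, ∂ⱼvᵉ⟩ ∂ⱼYᵢ)` of `Y` over `Ω`. -/
noncomputable def stressFunctional (Ω : Set (Rn (n + 1))) (Y : Rn (n + 1) → Rn (n + 1))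
    (v : Rn n → Rn m) : ℝ :=
  -(1 / 2) * ∫ x in Ω, stressIntegrand (harmExt v) Y x

section

variable {ω : Set (Rn n)} {Ω : Set (Rn (n + 1))} {C M : ℝ} {Y : Rn (n + 1) → Rn (n + 1)}

lemma integrableOn_sq_norm_fderiv {v : Rn n → Rn m} (hv : FiniteEnergy v ω)
    (hb : ∫⁻ x in Ω, ENNReal.ofReal (‖fderiv ℝ (harmExt v) x‖ ^ 2) ≤
      ENNReal.ofReal C * pairEnergy v ω) :
    IntegrableOn (fun x => ‖fderiv ℝ (harmExt v) x‖ ^ 2) Ω := by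
  refine ⟨((measurable_fderiv ℝ (harmExt v)).norm.pow_const 2).aestronglyMeasurable, ?_⟩
  rw [hasFiniteIntegral_iff_ofReal (Filter.Eventually.of_forall fun x => by positivity)]
  exact hb.trans_lt (ENNReal.mul_lt_top ENNReal.ofReal_lt_top hv.2)

lemma integrableOn_stressIntegrand {u : Rn (n + 1) → Rn m} (hΩm : MeasurableSet Ω)
    (hu : IntegrableOn (fun x => ‖fderiv ℝ u x‖ ^ 2) Ω) (hY : ∀ x ∈ Ω, ‖fderiv ℝ Y x‖ ≤ M) :
    IntegrableOn (stressIntegrand u Y) Ω := by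
  refine (hu.const_mul ((((n + 1 : ℕ) : ℝ) ^ 2 * ((n + 1 : ℕ) + 2)) * M)).mono'
    (measurable_stressIntegrand _ _).aestronglyMeasurable ?_
  filter_upwards [self_mem_ae_restrict hΩm] with x hx
  refine (abs_stressIntegrand_le _ _ _).trans ?_
  have := hY x hx
  gcongr

lemma abs_stressFunctional_le (hΩm : MeasurableSet Ω) (hC : 0 ≤ C) (hM : 0 ≤ M)
    (hY : ∀ x ∈ Ω, ‖fderiv ℝ Y x‖ ≤ M) {v : Rn n → Rn m} (hv : FiniteEnergy v ω)
    (hb : ∫⁻ x in Ω, ENNReal.ofReal (‖fderiv ℝ (harmExt v) x‖ ^ 2) ≤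
      ENNReal.ofReal C * pairEnergy v ω) :
    |stressFunctional Ω Y v| ≤
      ((((n + 1 : ℕ) : ℝ) ^ 2 * ((n + 1 : ℕ) + 2)) * M * C) * (pairEnergy v ω).toReal := by
  have hu := integrableOn_sq_norm_fderiv hv hb
  have h1 : |∫ x in Ω, stressIntegrand (harmExt v) Y x| ≤
      ∫ x in Ω, (((n + 1 : ℕ) : ℝ) ^ 2 * ((n + 1 : ℕ) + 2)) * M * ‖fderiv ℝ (harmExt v) x‖ ^ 2 := by
    rw [← Real.norm_eq_abs]
    refine norm_integral_le_of_norm_le (hu.const_mul _) ?_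
    filter_upwards [self_mem_ae_restrict hΩm] with x hx
    refine (abs_stressIntegrand_le _ _ _).trans ?_
    have := hY x hx
    gcongr
  have h2 : ∫ x in Ω, ‖fderiv ℝ (harmExt v) x‖ ^ 2 ≤ C * (pairEnergy v ω).toReal := by
    rw [integral_eq_lintegral_of_nonneg_ae (Filter.Eventually.of_forall fun x => by positivity)
      hu.aestronglyMeasurable]
    have := ENNReal.toReal_mono (ENNReal.mul_lt_top ENNReal.ofReal_lt_top hv.2).ne hb
    rwa [ENNReal.toReal_mul, ENNReal.toReal_ofReal hC] at this
  rw [integral_const_mul] at h1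
  rw [stressFunctional, abs_mul]
  have h3 : |(-(1 / 2) : ℝ)| ≤ 1 := by rw [abs_neg, abs_of_pos] <;> norm_num
  calc _ ≤ 1 * |∫ x in Ω, stressIntegrand (harmExt v) Y x| := by gcongr
    _ ≤ (((n + 1 : ℕ) : ℝ) ^ 2 * ((n + 1 : ℕ) + 2)) * M * (C * (pairEnergy v ω).toReal) := by
        rw [one_mul]; exact h1.trans (by gcongr)
    _ = _ := by ring

lemma isQuadratic_stressFunctional (hΩm : MeasurableSet Ω) (hΩ : Ω ⊆ upperHalf n)
    (hY : ∀ x ∈ Ω, ‖fderiv ℝ Y x‖ ≤ M)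
    (hb : ∀ v : Rn n → Rn m, FiniteEnergy v ω →
      ∫⁻ x in Ω, ENNReal.ofReal (‖fderiv ℝ (harmExt v) x‖ ^ 2) ≤
        ENNReal.ofReal C * pairEnergy v ω) :
    IsQuadratic ω (stressFunctional (m := m) Ω Y) := by
  intro a b ha hb' l hl
  have I : ∀ {v : Rn n → Rn m}, FiniteEnergy v ω →
      IntegrableOn (stressIntegrand (harmExt v) Y) Ω := fun hv =>
    integrableOn_stressIntegrand hΩm (integrableOn_sq_norm_fderiv hv (hb _ hv)) hY
  have h1 := (ha.smul l).add (hb'.smul l⁻¹)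
  have h2 := (ha.smul l).sub (hb'.smul l⁻¹)
  have A : IntegrableOn (fun x => stressIntegrand (harmExt a) Y x + stressIntegrand (harmExt b) Y x)
    Ω := (I ha).add (I hb')
  have B : IntegrableOn (fun x => 1 / 2 * (stressIntegrand (harmExt (l • a + l⁻¹ • b)) Y x -
    stressIntegrand (harmExt (l • a - l⁻¹ • b)) Y x)) Ω := ((I h1).sub (I h2)).const_mul _
  have key : ∫ x in Ω, stressIntegrand (harmExt (a + b)) Y x =
      ∫ x in Ω, ((stressIntegrand (harmExt a) Y x + stressIntegrand (harmExt b) Y x) +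
        1 / 2 * (stressIntegrand (harmExt (l • a + l⁻¹ • b)) Y x -
    stressIntegrand (harmExt (l • a - l⁻¹ • b)) Y x)) := by
    refine setIntegral_congr_fun hΩm fun x hx => ?_
    have hx0 : 0 < height x := hΩ hx
    have e1 : ∀ i, pderiv (harmExt (a + b)) i x = pderiv (harmExt a) i x + pderiv (harmExt b) i x :=
      fun i => by rw [pderiv, fderiv_harmExt_add ha.1 hb'.1 hx0]; rfl
    have e2 : ∀ i, pderiv (harmExt (l • a + l⁻¹ • b)) i x =
        l • pderiv (harmExt a) i x + l⁻¹ • pderiv (harmExt b) i x := fun i => by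
      rw [pderiv, fderiv_harmExt_add (ha.1.smul l) (hb'.1.smul l⁻¹) hx0,
        fderiv_harmExt_smul l ha.1 hx0, fderiv_harmExt_smul l⁻¹ hb'.1 hx0]; rfl
    have e3 : ∀ i, pderiv (harmExt (l • a - l⁻¹ • b)) i x =
        l • pderiv (harmExt a) i x - l⁻¹ • pderiv (harmExt b) i x := fun i => by
      have := fderiv_harmExt_sub (ha.1.smul l) (hb'.1.smul l⁻¹) hx0
      rw [pderiv]
      refine (congrArg (fun D => D (EuclideanSpace.single i (1 : ℝ))) this).trans ?_
      rw [fderiv_harmExt_smul l ha.1 hx0, fderiv_harmExt_smul l⁻¹ hb'.1 hx0]; rfl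
    have e4 := fun i j => inner_polarise (pderiv (harmExt a) i x) (pderiv (harmExt b) i x)
      (pderiv (harmExt a) j x) (pderiv (harmExt b) j x) hl
    simp only [stressIntegrand_eq, e1, e2, e3]
    simp only [e4]
    simp only [Finset.mul_sum, ← Finset.sum_add_distrib, ← Finset.sum_sub_distrib]
    exact Finset.sum_congr rfl fun i _ => Finset.sum_congr rfl fun j _ => by ring
  rw [stressFunctional, key, integral_add A B, integral_add (I ha) (I hb'), integral_const_mul,
    integral_sub (I h1) (I h2)]
  simp only [stressFunctional]
  ring

end

/-! ### Boundary behaviour of the extension of a smooth map -/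

/-- The majorant of the second-difference integrand: `h²` compensates the singularity of the kernel at
the origin, boundedness suffices at infinity. -/
lemma integrable_min_sq_div (hn : 1 ≤ n) :
    Integrable fun h : Rn n => min (‖h‖ ^ 2) 1 / ‖h‖ ^ (n + 1) := by
  have : Nontrivial (Rn n) := by
    have : Nonempty (Fin n) := ⟨⟨0, hn⟩⟩
    infer_instance
  rw [integrable_fun_norm_addHaar volume (f := fun r : ℝ => min (r ^ 2) 1 / r ^ (n + 1)),
    finrank_euclideanSpace, Fintype.card_fin, ← Ioc_union_Ioi_eq_Ioi zero_le_one,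
    integrableOn_union]
  have hp : ∀ y : ℝ, 0 < y → y ^ (n + 1) = y ^ (n - 1) * y ^ 2 := fun y _ => by
    rw [← pow_add]; congr 1; omega
  constructor
  · refine IntegrableOn.congr_fun (f := fun _ => (1 : ℝ)) (by simp) (fun y hy => ?_) measurableSet_Ioc
    have hy0 : 0 < y := hy.1
    simp only
    rw [min_eq_left (pow_le_one₀ hy0.le hy.2), hp y hy0, smul_eq_mul]
    field_simp
  · refine IntegrableOn.congr_fun (f := fun y : ℝ => y ^ (-2 : ℝ))
      (integrableOn_Ioi_rpow_of_lt (by norm_num) one_pos) (fun y hy => ?_) measurableSet_Ioi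
    have hy1 : 1 < y := hy
    have hy0 : 0 < y := one_pos.trans hy1
    simp only
    rw [min_eq_right (one_le_pow₀ hy1.le), hp y hy0, smul_eq_mul, Real.rpow_neg hy0.le,
      Real.rpow_two]
    field_simp

/-- The symmetric second difference of `v` at `x`. -/
def secDiff (v : Rn n → Rn m) (x h : Rn n) : Rn m := v (x + h) + v (x - h) - (2 : ℝ) • v x

/-- The normal derivative `∂_{n+1} vᵉ(·, 0) = -(-Δ)^{1/2} v` of the extension of a smooth `v`, as
an absolutely convergent integral of second differences. -/
noncomputable def normalDeriv (v : Rn n → Rn m) (x : Rn n) : Rn m :=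
  (gammaConst n / 2) • ∫ h, (‖h‖ ^ (n + 1))⁻¹ • secDiff v x h

section smooth

variable {v : Rn n → Rn m}

lemma exists_lipschitzWith_fderiv (hv : ContDiff ℝ ((⊤ : ℕ∞) : WithTop ℕ∞) v)
    (hc : HasCompactSupport v) : ∃ A : NNReal, LipschitzWith A (fderiv ℝ v) := by
  have h1 : ContDiff ℝ 1 (fderiv ℝ v) := (contDiff_infty.1 hv 2).fderiv_right
    (m := 1) (n := 2) (by norm_num)
  exact h1.lipschitzWith_of_hasCompactSupport (hc.fderiv (𝕜 := ℝ)) (by norm_num)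

/-- Second differences of a smooth compactly supported map are bounded by `|h|²` and by a constant. -/
lemma exists_norm_secDiff_le (hv : ContDiff ℝ ((⊤ : ℕ∞) : WithTop ℕ∞) v)
    (hc : HasCompactSupport v) :
    ∃ A : ℝ, 0 ≤ A ∧ ∀ x h, ‖secDiff v x h‖ ≤ A * min (‖h‖ ^ 2) 1 := by
  obtain ⟨L, hL⟩ := exists_lipschitzWith_fderiv hv hc
  obtain ⟨B, hB⟩ := hc.exists_bound_of_continuous hv.continuous
  have hd : Differentiable ℝ v := hv.differentiable (by simp)
  have hB0 : 0 ≤ B := (norm_nonneg _).trans (hB 0)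
  refine ⟨max (2 * L) (4 * B), by positivity, fun x h => ?_⟩
  have h1 : ‖secDiff v x h‖ ≤ 2 * L * ‖h‖ ^ 2 := by
    have hder : ∀ y, HasFDerivAt (fun y => secDiff v x y) (fderiv ℝ v (x + y) - fderiv ℝ v (x - y)) y := by
      intro y
      have d1 := (hd (x + y)).hasFDerivAt.comp y ((hasFDerivAt_id y).const_add x)
      have d2 := (hd (x - y)).hasFDerivAt.comp y ((hasFDerivAt_id y).const_sub x)
      refine ((d1.add d2).sub_const ((2 : ℝ) • v x)).congr_fderiv ?_
      ext z; simp [sub_eq_add_neg]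
    have := (convex_closedBall (0 : Rn n) ‖h‖).norm_image_sub_le_of_norm_hasFDerivWithin_le
      (f := fun y => secDiff v x y) (C := 2 * L * ‖h‖)
      (fun y _ => (hder y).hasFDerivWithinAt) (fun y hy => ?_)
      (x := 0) (y := h) (by simp) (by simp)
    · have h0 : secDiff v x 0 = 0 := by simp [secDiff, two_smul]
      rw [h0, sub_zero, sub_zero] at this
      calc _ ≤ _ := this
        _ = _ := by ring
    · rw [mem_closedBall_zero_iff] at hy
      have h2 := hL.dist_le_mul (x + y) (x - y)
      rw [dist_eq_norm, dist_eq_norm, add_sub_sub_cancel, ← two_smul ℝ y, norm_smul,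
        Real.norm_ofNat] at h2
      calc _ ≤ L * (2 * ‖y‖) := h2
        _ ≤ L * (2 * ‖h‖) := by gcongr
        _ = _ := by ring
  have h2 : ‖secDiff v x h‖ ≤ 4 * B := by
    refine (norm_sub_le _ _).trans ?_
    have := norm_add_le (v (x + h)) (v (x - h))
    rw [norm_smul, Real.norm_ofNat]
    linarith [hB (x + h), hB (x - h), hB x]
  rcases le_total (‖h‖ ^ 2) 1 with h3 | h3
  · rw [min_eq_left h3]
    exact h1.trans (by gcongr; exact le_max_left _ _)
  · rw [min_eq_right h3, mul_one]
    exact h2.trans (le_max_right _ _)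

lemma poissonIntegrable_smooth (hv : ContDiff ℝ ((⊤ : ℕ∞) : WithTop ℕ∞) v)
    (hc : HasCompactSupport v) : PoissonIntegrable v :=
  poissonIntegrable_of_integrable (hv.continuous.integrable_of_hasCompactSupport hc)

lemma abs_pkGrad_up_le {h : Rn n} (hh : h ≠ 0) (s : ℝ) :
    |pkGrad (up h s) (EuclideanSpace.single (Fin.last n) 1)| ≤
      gammaConst n * (n + 2) * (‖h‖ ^ (n + 1))⁻¹ := by
  have h0 : 0 < ‖h‖ := norm_pos_iff.mpr hh
  have h1 : ‖h‖ ≤ ‖up h s‖ := by simpa using norm_horiz_le (up h s)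
  have h2 : up h s ≠ 0 := norm_pos_iff.mp (h0.trans_le h1)
  rw [← Real.norm_eq_abs]
  refine ((norm_apply_single_le _ _).trans (norm_pkGrad_le h2)).trans ?_
  rw [div_eq_mul_inv]
  have := gammaConst_pos n
  gcongr

lemma pkGrad_up_last (h : Rn n) (s : ℝ) :
    pkGrad (up h s) (EuclideanSpace.single (Fin.last n) 1) =
      gammaConst n * ((‖h‖ ^ 2 + s ^ 2) ^ (-(((n : ℝ) + 1) / 2)) +
        s * (-((n : ℝ) + 1) * (‖h‖ ^ 2 + s ^ 2) ^ (-(((n : ℝ) + 1) / 2) - 1)) * s) := by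
  simp [pkGrad, norm_sq_up, heightL_apply, inner_single_one, height]
  ring

lemma tendsto_pkGrad_up {h : Rn n} (hh : h ≠ 0) :
    Tendsto (fun s => pkGrad (up h s) (EuclideanSpace.single (Fin.last n) 1)) (𝓝[>] 0)
      (𝓝 (gammaConst n * (‖h‖ ^ (n + 1))⁻¹)) := by
  have h0 : 0 < ‖h‖ := norm_pos_iff.mpr hh
  simp_rw [pkGrad_up_last]
  have hq : ContinuousAt (fun s : ℝ => ‖h‖ ^ 2 + s ^ 2) 0 := by fun_prop
  have hne : ‖h‖ ^ 2 + (0 : ℝ) ^ 2 ≠ 0 := by positivity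
  have hcont : ContinuousAt (fun s : ℝ =>
      gammaConst n * ((‖h‖ ^ 2 + s ^ 2) ^ (-(((n : ℝ) + 1) / 2)) +
        s * (-((n : ℝ) + 1) * (‖h‖ ^ 2 + s ^ 2) ^ (-(((n : ℝ) + 1) / 2) - 1)) * s)) 0 :=
    continuousAt_const.mul ((hq.rpow_const (Or.inl hne)).add ((continuousAt_id.mul
      (continuousAt_const.mul (hq.rpow_const (Or.inl hne)))).mul continuousAt_id))
  have := hcont.tendsto.mono_left (nhdsWithin_le_nhds (s := Ioi 0))
  convert this using 2
  have h1 := sq_norm_rpow (emb h)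
  rw [norm_emb] at h1
  simp [h1]

lemma pkGrad_up_neg_last (h : Rn n) (s : ℝ) :
    pkGrad (up (-h) s) (EuclideanSpace.single (Fin.last n) 1) =
      pkGrad (up h s) (EuclideanSpace.single (Fin.last n) 1) := by
  simp [pkGrad_up_last]

lemma integrable_pkGrad_up_smul (hv : PoissonIntegrable v) (x : Rn n) {s : ℝ} (hs : 0 < s) :
    Integrable fun h : Rn n => pkGrad (up h s) (EuclideanSpace.single (Fin.last n) 1) •
      (v (x - h) - v x) := by
  have h1 := integrable_pkGrad_smulRight (hv.sub (poissonIntegrable_const (v x)))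
    (x := up x s) (by simpa using hs)
  have h2 := (h1.apply_continuousLinearMap (EuclideanSpace.single (Fin.last n) 1)).comp_sub_left x
  refine h2.congr (ae_of_all _ fun h => ?_)
  simp [up_sub_emb]

/-- The vertical derivative of the extension, written with second differences by the evenness of
the kernel. -/
lemma pderiv_last_harmExt (hv : PoissonIntegrable v) (x : Rn n) {s : ℝ} (hs : 0 < s) :
    pderiv (harmExt v) (Fin.last n) (up x s) =
      (1 / 2 : ℝ) • ∫ h, pkGrad (up h s) (EuclideanSpace.single (Fin.last n) 1) •
        secDiff v x h := by
  have hs' : 0 < height (up x s) := by simpa using hs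
  have h1 := integrable_pkGrad_smulRight (hv.sub (poissonIntegrable_const (v x))) hs'
  have e1 : pderiv (harmExt v) (Fin.last n) (up x s) =
      ∫ h, pkGrad (up h s) (EuclideanSpace.single (Fin.last n) 1) • (v (x - h) - v x) := by
    rw [pderiv, fderiv_harmExt_eq hv (v x) hs', ContinuousLinearMap.integral_apply h1,
      ← integral_sub_left_eq_self _ _ x]
    simp [up_sub_emb]
  have i1 := integrable_pkGrad_up_smul hv x hs
  have i2 := i1.comp_neg
  have e2 : pderiv (harmExt v) (Fin.last n) (up x s) =
      ∫ h, pkGrad (up h s) (EuclideanSpace.single (Fin.last n) 1) • (v (x + h) - v x) := by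
    rw [e1, ← integral_neg_eq_self]
    simp [pkGrad_up_neg_last]
  simp only [pkGrad_up_neg_last, sub_neg_eq_add] at i2
  have e3 : ∫ h, pkGrad (up h s) (EuclideanSpace.single (Fin.last n) 1) • secDiff v x h =
      (2 : ℝ) • pderiv (harmExt v) (Fin.last n) (up x s) := by
    conv_rhs => rw [two_smul, e2]
    nth_rw 2 [← e2]
    rw [e1, ← integral_add i2 i1]
    congr 1; ext1 h
    rw [← smul_add, secDiff, two_smul]
    congr 1; abel
  rw [e3, smul_smul]; norm_num

lemma continuous_secDiff (hv : Continuous v) : Continuous fun p : Rn n × Rn n => secDiff v p.1 p.2 := by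
  unfold secDiff; fun_prop

lemma measurable_pkGrad_up_last (s : ℝ) : Measurable fun h : Rn n =>
    pkGrad (up h s) (EuclideanSpace.single (Fin.last n) 1) := by
  have h1 : Continuous fun h : Rn n => up h s :=
    continuous_up.comp (continuous_id.prodMk continuous_const)
  exact (measurable_pkGrad.comp h1.measurable).apply_continuousLinearMap _

lemma ae_ne_zero (hn : 1 ≤ n) : ∀ᵐ h : Rn n, h ≠ 0 := by
  have : Nonempty (Fin n) := ⟨⟨0, hn⟩⟩
  have : Nontrivial (Rn n) := inferInstance
  simp [ae_iff]

/-- A majorant of the second-difference integrand, uniform in the height. -/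
lemma norm_pkGrad_smul_secDiff_le {A : ℝ} (hA : ∀ x h, ‖secDiff v x h‖ ≤ A * min (‖h‖ ^ 2) 1)
    (x : Rn n) (s : ℝ) {h : Rn n} (hh : h ≠ 0) :
    ‖pkGrad (up h s) (EuclideanSpace.single (Fin.last n) 1) • secDiff v x h‖ ≤
      gammaConst n * (n + 2) * A * (min (‖h‖ ^ 2) 1 / ‖h‖ ^ (n + 1)) := by
  rw [norm_smul, Real.norm_eq_abs]
  have := gammaConst_pos n
  calc _ ≤ (gammaConst n * (n + 2) * (‖h‖ ^ (n + 1))⁻¹) * (A * min (‖h‖ ^ 2) 1) := by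
        gcongr
        exacts [abs_pkGrad_up_le hh s, hA x h]
    _ = _ := by ring

/-- The normal derivative of the extension exists at the boundary, by dominated convergence. -/
lemma tendsto_pderiv_last_harmExt (hn : 1 ≤ n) (hv : ContDiff ℝ ((⊤ : ℕ∞) : WithTop ℕ∞) v)
    (hc : HasCompactSupport v) (x : Rn n) :
    Tendsto (fun s => pderiv (harmExt v) (Fin.last n) (up x s)) (𝓝[>] 0)
      (𝓝 (normalDeriv v x)) := by
  obtain ⟨A, hA0, hA⟩ := exists_norm_secDiff_le hv hc
  have hpi := poissonIntegrable_smooth hv hc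
  have hsec : Continuous (secDiff v x) :=
    (continuous_secDiff hv.continuous).comp (continuous_const.prodMk continuous_id)
  have key : Tendsto (fun s => ∫ h, pkGrad (up h s) (EuclideanSpace.single (Fin.last n) 1) •
      secDiff v x h) (𝓝[>] 0) (𝓝 (∫ h, (gammaConst n * (‖h‖ ^ (n + 1))⁻¹) • secDiff v x h)) := by
    refine tendsto_integral_filter_of_dominated_convergence
      (fun h => gammaConst n * (n + 2) * A * (min (‖h‖ ^ 2) 1 / ‖h‖ ^ (n + 1))) ?_ ?_ ?_ ?_
    · exact Eventually.of_forall fun s => (measurable_pkGrad_up_last s).aestronglyMeasurable.smul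
        hsec.aestronglyMeasurable
    · exact Eventually.of_forall fun s => by
        filter_upwards [ae_ne_zero hn] with h hh
        exact norm_pkGrad_smul_secDiff_le hA x s hh
    · exact (integrable_min_sq_div hn).const_mul _
    · filter_upwards [ae_ne_zero hn] with h hh
      exact (tendsto_pkGrad_up hh).smul_const _
  have h2 := key.const_smul (1 / 2 : ℝ)
  have e : (1 / 2 : ℝ) • ∫ h, (gammaConst n * (‖h‖ ^ (n + 1))⁻¹) • secDiff v x h =
      normalDeriv v x := by
    simp_rw [mul_smul]
    rw [integral_smul, smul_smul, normalDeriv]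
    congr 1; ring
  rw [e] at h2
  refine h2.congr' ?_
  filter_upwards [self_mem_nhdsWithin] with s hs
  exact (pderiv_last_harmExt hpi x hs).symm

lemma exists_norm_pderiv_last_le (hn : 1 ≤ n) (hv : ContDiff ℝ ((⊤ : ℕ∞) : WithTop ℕ∞) v)
    (hc : HasCompactSupport v) : ∃ M : ℝ, ∀ x : Rn n, ∀ s : ℝ, 0 < s →
      ‖pderiv (harmExt v) (Fin.last n) (up x s)‖ ≤ M := by
  obtain ⟨A, hA0, hA⟩ := exists_norm_secDiff_le hv hc
  refine ⟨1 / 2 * ∫ h : Rn n, gammaConst n * (n + 2) * A * (min (‖h‖ ^ 2) 1 / ‖h‖ ^ (n + 1)),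
    fun x s hs => ?_⟩
  rw [pderiv_last_harmExt (poissonIntegrable_smooth hv hc) x hs, norm_smul]
  norm_num
  refine norm_integral_le_of_norm_le ((integrable_min_sq_div hn).const_mul _) ?_
  filter_upwards [ae_ne_zero hn] with h hh
  exact norm_pkGrad_smul_secDiff_le hA x s hh

lemma harmExt_up_eq (v : Rn n → Rn m) (x : Rn n) (s : ℝ) :
    harmExt v (up x s) = ∫ h, pk (up h s) • v (x - h) := by
  rw [harmExt_eq_integral_pk, ← integral_sub_left_eq_self _ _ x]
  simp [up_sub_emb]

lemma pk_up_nonneg (h : Rn n) {s : ℝ} (hs : 0 ≤ s) : 0 ≤ pk (up h s) := by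
  rw [pk_up]
  have := gammaConst_pos n
  positivity

lemma integral_pk_up_smul_le {E : Type*} [NormedAddCommGroup E] [NormedSpace ℝ E] {f : Rn n → E}
    {B : ℝ} (hB : ∀ z, ‖f z‖ ≤ B) {s : ℝ} (hs : 0 < s) :
    ‖∫ h : Rn n, pk (up h s) • f h‖ ≤ B := by
  have h1 := integral_pk (n := n) hs
  calc _ ≤ ∫ h : Rn n, pk (up h s) * B := norm_integral_le_of_norm_le (h1.1.mul_const B)
        (ae_of_all _ fun h => by
          rw [norm_smul, Real.norm_of_nonneg (pk_up_nonneg h hs.le)]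
          exact mul_le_mul_of_nonneg_left (hB h) (pk_up_nonneg h hs.le))
    _ = B := by rw [integral_mul_const, h1.2, one_mul]

/-- Horizontal derivatives commute with the harmonic extension. -/
lemma fderiv_harmExt_emb (hv : ContDiff ℝ ((⊤ : ℕ∞) : WithTop ℕ∞) v) (hc : HasCompactSupport v)
    (x y : Rn n) {s : ℝ} (hs : 0 < s) :
    fderiv ℝ (harmExt v) (up x s) (emb y) = ∫ h, pk (up h s) • fderiv ℝ v (x - h) y := by
  have hs' : 0 < height (up x s) := by simpa using hs
  have hv1 : ContDiff ℝ 1 v := contDiff_infty.1 hv 1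
  have hdc : Continuous (fderiv ℝ v) := hv1.continuous_fderiv (by simp)
  obtain ⟨B, hB⟩ := (hc.fderiv (𝕜 := ℝ)).exists_bound_of_continuous hdc
  have hpk := integral_pk (n := n) hs
  have h1 : HasFDerivAt (fun x => harmExt v (up x s))
      ((fderiv ℝ (harmExt v) (up x s)).comp (embL n)) x := by
    have hup : HasFDerivAt (fun x : Rn n => up x s) (embL n) x := by
      have e : (fun x : Rn n => up x s) = fun x => embL n x + up 0 s := by
        ext1 x
        have := (splitL n).symm.map_add (x, 0) (0, s)
        simpa [splitL_symm_apply, embL_apply, emb_eq_up] using this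
      rw [e]
      exact (embL n).hasFDerivAt.add_const _
    have hd := (hasFDerivAt_harmExt (poissonIntegrable_smooth hv hc) hs').differentiableAt
    exact hd.hasFDerivAt.comp x hup
  have hF : ∀ x, Integrable fun h => pk (up h s) • v (x - h) := fun x => by
    have := (integrable_pk_smul (poissonIntegrable_smooth hv hc)
      (x := up x s) (by simpa using hs)).comp_sub_left x
    simpa [up_sub_emb] using this
  have hm : ∀ x, AEStronglyMeasurable (fun h => pk (up h s) • fderiv ℝ v (x - h)) volume :=
    fun x => hpk.1.aestronglyMeasurable.smul
      (hdc.comp (continuous_const.sub continuous_id)).aestronglyMeasurable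
  have h2 : HasFDerivAt (fun x => ∫ h, pk (up h s) • v (x - h))
      (∫ h, pk (up h s) • fderiv ℝ v (x - h)) x := by
    refine hasFDerivAt_integral_of_dominated_of_fderiv_le (s := univ)
      (F' := fun x h => pk (up h s) • fderiv ℝ v (x - h))
      (bound := fun h => pk (up h s) * B) univ_mem
      (Eventually.of_forall fun x => (hF x).aestronglyMeasurable) (hF x) (hm x)
      (ae_of_all _ fun h y _ => ?_) (hpk.1.mul_const B) (ae_of_all _ fun h y _ => ?_)
    · rw [norm_smul, Real.norm_of_nonneg (pk_up_nonneg h hs.le)]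
      exact mul_le_mul_of_nonneg_left (hB _) (pk_up_nonneg h hs.le)
    · have d := (hv1.differentiable (by simp) (y - h)).hasFDerivAt.comp y
        ((hasFDerivAt_id y).sub_const h)
      have d' : HasFDerivAt (fun y => v (y - h)) (fderiv ℝ v (y - h)) y :=
        d.congr_fderiv (by ext z; simp)
      exact d'.const_smul (pk (up h s))
  have h3 : (fun x => harmExt v (up x s)) = fun x => ∫ h, pk (up h s) • v (x - h) := by
    ext1 x; exact harmExt_up_eq v x s
  rw [h3] at h1
  have h4 := congrArg (fun D => D y) (h1.unique h2)
  have hi : Integrable fun h => pk (up h s) • fderiv ℝ v (x - h) :=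
    (hpk.1.mul_const B).mono' (hm x) (ae_of_all _ fun h => by
      rw [norm_smul, Real.norm_of_nonneg (pk_up_nonneg h hs.le)]
      exact mul_le_mul_of_nonneg_left (hB _) (pk_up_nonneg h hs.le))
  simp only [ContinuousLinearMap.comp_apply, embL_apply] at h4
  rw [h4, ContinuousLinearMap.integral_apply hi]
  rfl

lemma pk_up_smul (k : Rn n) {s : ℝ} (hs : 0 < s) : s ^ n * pk (up (s • k) s) = pk (up k 1) := by
  have h0 : 0 < ‖k‖ ^ 2 + 1 := by positivity
  rw [pk_up, pk_up, norm_smul, Real.norm_of_nonneg hs.le,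
    show (s * ‖k‖) ^ 2 + s ^ 2 = s ^ 2 * (‖k‖ ^ 2 + 1) by ring, one_pow,
    Real.mul_rpow (by positivity) h0.le, one_mul]
  have e : (s ^ 2) ^ (-(((n : ℝ) + 1) / 2)) = (s ^ (n + 1))⁻¹ := by
    rw [← Real.rpow_natCast s 2, ← Real.rpow_mul hs.le, ← Real.rpow_natCast s (n + 1),
      ← Real.rpow_neg hs.le]
    congr 1; push_cast; ring
  rw [e, pow_succ]
  field_simp

/-- The Poisson kernels are an approximate identity. -/
lemma tendsto_integral_pk_up_smul {E : Type*} [NormedAddCommGroup E] [NormedSpace ℝ E]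
    [CompleteSpace E]
    {f : Rn n → E} (hf : Continuous f) {B : ℝ} (hB : ∀ z, ‖f z‖ ≤ B) (x : Rn n) :
    Tendsto (fun s : ℝ => ∫ h : Rn n, pk (up h s) • f (x - h)) (𝓝[>] 0) (𝓝 (f x)) := by
  have h1 := integral_pk (n := n) one_pos
  have key : Tendsto (fun s : ℝ => ∫ k : Rn n, pk (up k 1) • f (x - s • k)) (𝓝[>] 0)
      (𝓝 (∫ k : Rn n, pk (up k 1) • f x)) := by
    refine tendsto_integral_filter_of_dominated_convergence (fun k => pk (up k 1) * B) ?_ ?_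
      (h1.1.mul_const B) ?_
    · exact Eventually.of_forall fun s => h1.1.aestronglyMeasurable.smul
        (hf.comp (by fun_prop : Continuous fun k : Rn n => x - s • k)).aestronglyMeasurable
    · refine Eventually.of_forall fun s => ae_of_all _ fun k => ?_
      rw [norm_smul, Real.norm_of_nonneg (pk_up_nonneg k zero_le_one)]
      exact mul_le_mul_of_nonneg_left (hB _) (pk_up_nonneg k zero_le_one)
    · refine ae_of_all _ fun k => Tendsto.const_smul ?_ _
      have : Continuous fun s : ℝ => f (x - s • k) := hf.comp (by fun_prop)
      have := this.tendsto 0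
      simp only [zero_smul, sub_zero] at this
      exact this.mono_left nhdsWithin_le_nhds
  rw [integral_smul_const, h1.2, one_smul] at key
  refine key.congr' ?_
  filter_upwards [self_mem_nhdsWithin] with s hs
  have hs : 0 < s := hs
  have h2 := Measure.integral_comp_smul (volume : Measure (Rn n))
    (fun h => pk (up h s) • f (x - h)) s
  rw [finrank_euclideanSpace, Fintype.card_fin, abs_of_pos (by positivity)] at h2
  have h3 := congrArg (fun z => s ^ n • z) h2
  simp only [smul_smul, mul_inv_cancel₀ (pow_ne_zero n hs.ne'), one_smul] at h3
  rw [← h3, ← integral_smul]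
  congr 1; ext1 k
  rw [smul_smul, pk_up_smul k hs]

/-- The tangential derivatives of the extension converge to those of `v`. -/
lemma tendsto_fderiv_harmExt_emb (hv : ContDiff ℝ ((⊤ : ℕ∞) : WithTop ℕ∞) v)
    (hc : HasCompactSupport v) (x y : Rn n) :
    Tendsto (fun s => fderiv ℝ (harmExt v) (up x s) (emb y)) (𝓝[>] 0) (𝓝 (fderiv ℝ v x y)) := by
  have hv1 : ContDiff ℝ 1 v := contDiff_infty.1 hv 1
  have hdc : Continuous (fderiv ℝ v) := hv1.continuous_fderiv (by simp)
  obtain ⟨B, hB⟩ := (hc.fderiv (𝕜 := ℝ)).exists_bound_of_continuous hdc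
  refine (tendsto_integral_pk_up_smul (f := fun z => fderiv ℝ v z y) (by fun_prop)
    (B := B * ‖y‖) (fun z => (ContinuousLinearMap.le_opNorm _ _).trans (by gcongr; exact hB z))
    x).congr' ?_
  filter_upwards [self_mem_nhdsWithin] with s hs
  exact (fderiv_harmExt_emb hv hc x y hs).symm

/-- The gradient of the extension of a smooth map is bounded up to the boundary. -/
lemma exists_norm_fderiv_harmExt_le (hn : 1 ≤ n) (hv : ContDiff ℝ ((⊤ : ℕ∞) : WithTop ℕ∞) v)
    (hc : HasCompactSupport v) : ∃ M : ℝ, 0 ≤ M ∧ ∀ x : Rn (n + 1), 0 < height x →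
      ‖fderiv ℝ (harmExt v) x‖ ≤ M := by
  have hv1 : ContDiff ℝ 1 v := contDiff_infty.1 hv 1
  have hdc : Continuous (fderiv ℝ v) := hv1.continuous_fderiv (by simp)
  obtain ⟨B, hB⟩ := (hc.fderiv (𝕜 := ℝ)).exists_bound_of_continuous hdc
  obtain ⟨M, hM⟩ := exists_norm_pderiv_last_le hn hv hc
  have hB0 : 0 ≤ B := (norm_nonneg _).trans (hB 0)
  have hM0 : 0 ≤ M := (norm_nonneg _).trans (hM 0 1 one_pos)
  refine ⟨B + M, by positivity, fun x hx => ContinuousLinearMap.opNorm_le_bound _ (by positivity)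
    fun y => ?_⟩
  have e1 : y = emb (horiz y) + height y • EuclideanSpace.single (Fin.last n) 1 := by
    ext i
    refine Fin.lastCases ?_ (fun i => ?_) i
    · simp [emb, height]
    · simp [emb, horiz, Fin.castSucc_ne_last]
  have e2 : up (horiz x) (height x) = x := up_horiz_height x
  conv_lhs => rw [e1, map_add, map_smul]
  have a1 : ‖fderiv ℝ (harmExt v) x (emb (horiz y))‖ ≤ B * ‖y‖ := by
    conv_lhs => rw [← e2, fderiv_harmExt_emb hv hc _ _ hx]
    refine integral_pk_up_smul_le (f := fun h => fderiv ℝ v (horiz x - h) (horiz y))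
      (fun z => (ContinuousLinearMap.le_opNorm _ _).trans ?_) hx
    gcongr
    exacts [hB _, norm_horiz_le y]
  have a2 : ‖height y • fderiv ℝ (harmExt v) x (EuclideanSpace.single (Fin.last n) 1)‖ ≤
      M * ‖y‖ := by
    rw [norm_smul, Real.norm_eq_abs, mul_comm]
    have := hM (horiz x) (height x) hx
    rw [e2] at this
    gcongr
    exacts [this, abs_height_le y]
  calc _ ≤ _ := norm_add_le _ _
    _ ≤ _ := by rw [add_mul]; exact add_le_add a1 a2

end smooth

/-! ### First variation of the energy of a smooth map -/

section smooth

variable {v w : Rn n → Rn m} {ω S : Set (Rn n)}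

lemma pairDensity_eq_zero (hw : ∀ x ∉ S, w x = 0) {p : Rn n × Rn n} (hp : p ∉ touch S) :
    pairDensity w p = 0 := by
  simp only [touch, mem_ofPred_eq, not_or] at hp
  simp [pairDensity, hw _ hp.1, hw _ hp.2]

lemma pairEnergy_le_of_eq_zero (hw : ∀ x ∉ S, w x = 0) (hS : MeasurableSet S)
    (ω : Set (Rn n)) : pairEnergy w ω ≤ pairEnergy w S := by
  calc pairEnergy w ω ≤ ∫⁻ p, pairDensity w p := setLIntegral_le_lintegral _ _
    _ = ∫⁻ p in touch S, pairDensity w p := by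
        rw [← lintegral_indicator (measurableSet_touch hS)]
        congr 1; ext1 p
        by_cases hp : p ∈ touch S
        · rw [indicator_of_mem hp]
        · rw [indicator_of_notMem hp, pairDensity_eq_zero hw hp]

/-- A bounded Lipschitz map vanishing off a set of finite measure has finite energy. -/
lemma pairEnergy_le_of_sq_le (hw : ∀ x ∉ S, w x = 0) (hS : MeasurableSet S) {D : ℝ}
    (hD : ∀ x y, ‖w x - w y‖ ^ 2 ≤ D * min (‖x - y‖ ^ 2) 1) (ω : Set (Rn n)) :
    pairEnergy w ω ≤ 2 * (volume S * (ENNReal.ofReal D *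
      ∫⁻ h : Rn n, ENNReal.ofReal (min (‖h‖ ^ 2) 1 / ‖h‖ ^ (n + 1)))) := by
  refine (pairEnergy_le_of_eq_zero hw hS ω).trans ((pairEnergy_le_two_mul w S).trans ?_)
  gcongr
  have hκ : Measurable fun h : Rn n => ENNReal.ofReal (min (‖h‖ ^ 2) 1 / ‖h‖ ^ (n + 1)) := by
    fun_prop
  calc ∫⁻ p in S ×ˢ univ, pairDensity w p
      ≤ ∫⁻ p in S ×ˢ (univ : Set (Rn n)), ENNReal.ofReal D *
          ENNReal.ofReal (min (‖p.1 - p.2‖ ^ 2) 1 / ‖p.1 - p.2‖ ^ (n + 1)) := by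
        refine lintegral_mono fun p => ?_
        rw [← ENNReal.ofReal_mul' (by positivity), ← mul_div_assoc]
        refine ENNReal.ofReal_le_ofReal ?_
        gcongr
        exact hD _ _
    _ = ∫⁻ x in S, ∫⁻ y, ENNReal.ofReal D *
          ENNReal.ofReal (min (‖x - y‖ ^ 2) 1 / ‖x - y‖ ^ (n + 1)) := by
        rw [Measure.volume_eq_prod, ← Measure.prod_restrict, Measure.restrict_univ, lintegral_prod]
        exact Measurable.aemeasurable
          ((hκ.comp (measurable_fst.sub measurable_snd)).const_mul _)
    _ = ∫⁻ x in S, ENNReal.ofReal D * ∫⁻ h : Rn n,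
          ENNReal.ofReal (min (‖h‖ ^ 2) 1 / ‖h‖ ^ (n + 1)) := by
        congr 1; ext1 x
        have hx : Measurable fun y : Rn n =>
            ENNReal.ofReal (min (‖x - y‖ ^ 2) 1 / ‖x - y‖ ^ (n + 1)) :=
          hκ.comp (measurable_const.sub measurable_id)
        rw [lintegral_const_mul _ hx, lintegral_sub_left_eq_self
            (fun h : Rn n => ENNReal.ofReal (min (‖h‖ ^ 2) 1 / ‖h‖ ^ (n + 1))) x]
    _ = _ := by rw [setLIntegral_const, mul_comm]

lemma measurable_inv_norm_pow : Measurable fun h : Rn n => (‖h‖ ^ (n + 1))⁻¹ := by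
  fun_prop

lemma norm_normalDeriv_le (hn : 1 ≤ n) {A : ℝ}
    (hA : ∀ x h, ‖secDiff v x h‖ ≤ A * min (‖h‖ ^ 2) 1) (x : Rn n) :
    ‖normalDeriv v x‖ ≤
      gammaConst n / 2 * ∫ h : Rn n, A * (min (‖h‖ ^ 2) 1 / ‖h‖ ^ (n + 1)) := by
  have := gammaConst_pos n
  rw [normalDeriv, norm_smul, Real.norm_of_nonneg (by positivity)]
  gcongr
  refine norm_integral_le_of_norm_le ((integrable_min_sq_div hn).const_mul _)
    (ae_of_all _ fun h => ?_)
  rw [norm_smul, norm_inv, norm_pow, norm_norm]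
  calc _ ≤ (‖h‖ ^ (n + 1))⁻¹ * (A * min (‖h‖ ^ 2) 1) := by gcongr; exact hA x h
    _ = _ := by ring

lemma aestronglyMeasurable_normalDeriv (hv : Continuous v) :
    AEStronglyMeasurable (normalDeriv v) volume := by
  have h1 : AEStronglyMeasurable (fun p : Rn n × Rn n => (‖p.2‖ ^ (n + 1))⁻¹ • secDiff v p.1 p.2)
      ((volume : Measure (Rn n)).prod volume) :=
    (measurable_inv_norm_pow.comp measurable_snd).aestronglyMeasurable.smul
      (continuous_secDiff hv).aestronglyMeasurable
  exact (h1.integral_prod_right').const_smul (gammaConst n / 2)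

/-- The bilinear form of the energy, tested with a compactly supported `w`. -/
lemma integral_cross (hn : 1 ≤ n) (hv : Continuous v) {A : ℝ}
    (hA : ∀ x h, ‖secDiff v x h‖ ≤ A * min (‖h‖ ^ 2) 1) (hw : Continuous w)
    (hwc : HasCompactSupport w)
    (hi : Integrable fun p : Rn n × Rn n =>
      inner ℝ (v p.1 - v p.2) (w p.1 - w p.2) / ‖p.1 - p.2‖ ^ (n + 1)) :
    ∫ p : Rn n × Rn n, inner ℝ (v p.1 - v p.2) (w p.1 - w p.2) / ‖p.1 - p.2‖ ^ (n + 1) =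
      -(2 / gammaConst n) * ∫ x, inner ℝ (w x) (normalDeriv v x) := by
  have hγ := gammaConst_pos n
  -- substitute `p = (x, x + h)`
  have hmp : MeasurePreserving (MeasurableEquiv.shearAddRight (Rn n))
      ((volume : Measure (Rn n)).prod volume) ((volume : Measure (Rn n)).prod volume) :=
    measurePreserving_prod_add volume volume
  set c : Rn n × Rn n → ℝ := fun p =>
    inner ℝ (v p.1 - v p.2) (w p.1 - w p.2) / ‖p.1 - p.2‖ ^ (n + 1) with hc
  have hi' : Integrable (fun q : Rn n × Rn n => c (q.1, q.1 + q.2))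
      ((volume : Measure (Rn n)).prod volume) :=
    (hmp.integrable_comp_emb (MeasurableEquiv.measurableEmbedding _)).2 hi
  have e1 : ∫ p, c p = ∫ h, ∫ x, c (x, x + h) := by
    rw [← integral_prod_symm _ hi', Measure.volume_eq_prod, ← hmp.integral_comp']
    rfl
  have hG : Integrable (fun q : Rn n × Rn n =>
      inner ℝ (w q.1) ((‖q.2‖ ^ (n + 1))⁻¹ • secDiff v q.1 q.2))
      ((volume : Measure (Rn n)).prod volume) := by
    refine ((hw.norm.integrable_of_hasCompactSupport hwc.norm).mul_prod
      ((integrable_min_sq_div hn).const_mul A)).mono' ?_ (ae_of_all _ fun q => ?_)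
    · exact (hw.comp continuous_fst).aestronglyMeasurable.inner
        ((measurable_inv_norm_pow.comp measurable_snd).aestronglyMeasurable.smul
          (continuous_secDiff hv).aestronglyMeasurable)
    · refine (norm_inner_le_norm _ _).trans ?_
      gcongr
      rw [norm_smul, norm_inv, norm_pow, norm_norm]
      calc _ ≤ (‖q.2‖ ^ (n + 1))⁻¹ * (A * min (‖q.2‖ ^ 2) 1) := by gcongr; exact hA _ _
        _ = _ := by ring
  -- for fixed `h`, a translation by `h` turns the increment of `w` into a second difference of `v`
  have e2 : ∀ h : Rn n, ∫ x, c (x, x + h) =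
      -∫ x, inner ℝ (w x) ((‖h‖ ^ (n + 1))⁻¹ • secDiff v x h) := by
    intro h
    have i1 : ∀ a b : Rn n → Rn n, Continuous a → Continuous b →
        Integrable fun x => inner ℝ (v (a x) - v (b x)) (w x) := fun a b ha hb =>
      (((hv.comp ha).sub (hv.comp hb)).inner hw).integrable_of_hasCompactSupport
        (hwc.mono fun x hx => by
          contrapose! hx
          rw [Function.notMem_support] at hx ⊢
          simp [hx])
    have i2 : Integrable fun x => inner ℝ (v x - v (x + h)) (w x) :=
      i1 id (fun x => x + h) continuous_id (by fun_prop)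
    have i3 : Integrable fun x => inner ℝ (v (x - h) - v x) (w x) :=
      i1 (fun x => x - h) id (by fun_prop) continuous_id
    have i4 : Integrable fun x => inner ℝ (v x - v (x + h)) (w (x + h)) := by
      simpa using i3.comp_add_right h
    have e3 : ∫ x, inner ℝ (v x - v (x + h)) (w (x + h)) = ∫ x, inner ℝ (v (x - h) - v x) (w x) := by
      simpa using integral_add_right_eq_self (μ := volume)
        (fun x => inner ℝ (v (x - h) - v x) (w x)) h
    have e4 : ∫ x, c (x, x + h) = (‖h‖ ^ (n + 1))⁻¹ *
        ((∫ x, inner ℝ (v x - v (x + h)) (w x)) - ∫ x, inner ℝ (v (x - h) - v x) (w x)) := by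
      rw [← e3, ← integral_sub i2 i4, ← integral_const_mul]
      congr 1; ext1 x
      simp only [hc, inner_sub_right, sub_add_cancel_left, norm_neg]
      ring
    rw [e4, ← integral_sub i2 i3, ← integral_const_mul, ← integral_neg]
    congr 1; ext1 x
    simp only [secDiff, inner_sub_left, inner_sub_right, inner_add_right, inner_smul_right]
    rw [real_inner_comm (w x) (v x), real_inner_comm (w x) (v (x + h)),
      real_inner_comm (w x) (v (x - h))]
    ring
  have hx : ∀ᵐ x : Rn n, Integrable fun h => inner ℝ (w x) ((‖h‖ ^ (n + 1))⁻¹ • secDiff v x h) :=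
    hG.prod_right_ae
  rw [e1]
  simp_rw [e2]
  rw [integral_neg, ← integral_integral_swap hG, ← neg_mul_eq_neg_mul, ← integral_const_mul]
  congr 2; ext1 x
  have i5 : Integrable fun h : Rn n => (‖h‖ ^ (n + 1))⁻¹ • secDiff v x h := by
    refine ((integrable_min_sq_div hn).const_mul A).mono' ?_ (ae_of_all _ fun h => ?_)
    · exact measurable_inv_norm_pow.aestronglyMeasurable.smul
        ((continuous_secDiff hv).comp (continuous_const.prodMk continuous_id)).aestronglyMeasurable
    · rw [norm_smul, norm_inv, norm_pow, norm_norm]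
      calc _ ≤ (‖h‖ ^ (n + 1))⁻¹ * (A * min (‖h‖ ^ 2) 1) := by gcongr; exact hA x h
        _ = _ := by ring
  rw [normalDeriv, inner_smul_right, integral_inner i5]
  field_simp

lemma realDensity_add (a b : Rn n → Rn m) (p : Rn n × Rn n) :
    realDensity (a + b) p = realDensity a p + realDensity b p +
      2 * (inner ℝ (a p.1 - a p.2) (b p.1 - b p.2) / ‖p.1 - p.2‖ ^ (n + 1)) := by
  simp only [realDensity, Pi.add_apply, add_sub_add_comm, norm_add_sq_real]
  ring

/-- Energy of a perturbation: the first order term is the pairing with the normal derivative of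
the extension. -/
lemma toReal_pairEnergy_add (hn : 1 ≤ n) (hv : Continuous v) {A : ℝ}
    (hA : ∀ x h, ‖secDiff v x h‖ ≤ A * min (‖h‖ ^ 2) 1) (hvE : FiniteEnergy v ω)
    (hw : Continuous w) (hwc : HasCompactSupport w)
    (hwE : FiniteEnergy w ω) (hwω : ∀ x ∉ ω, w x = 0) :
    (pairEnergy (v + w) ω).toReal = (pairEnergy v ω).toReal + (pairEnergy w ω).toReal -
      4 / gammaConst n * ∫ x, inner ℝ (w x) (normalDeriv v x) := by
  have hm1 := hvE.1.aestronglyMeasurable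
  have hm2 := hwE.1.aestronglyMeasurable
  have hm3 := (hvE.add hwE).1.aestronglyMeasurable
  have j1 := integrableOn_realDensity hm1 hvE.2
  have j2 := integrableOn_realDensity hm2 hwE.2
  have j3 := integrableOn_realDensity hm3 (hvE.add hwE).2
  set c : Rn n × Rn n → ℝ := fun p =>
    inner ℝ (v p.1 - v p.2) (w p.1 - w p.2) / ‖p.1 - p.2‖ ^ (n + 1) with hc
  -- the cross term vanishes off the pairs meeting `ω`, so it may be integrated over all pairs
  have hc0 : ∀ p ∉ touch ω, c p = 0 := fun p hp => by
    simp only [touch, mem_ofPred_eq, not_or] at hp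
    simp [hc, hwω _ hp.1, hwω _ hp.2]
  have j4 : IntegrableOn c (touch ω) := by
    refine (((j3.sub j1).sub j2).const_mul (1 / 2)).congr (ae_of_all _ fun p => ?_)
    simp only [Pi.sub_apply, realDensity_add v w p, hc]
    ring
  have j5 : Integrable c := (integrableOn_iff_integrable_of_support_subset fun p hp => by
    by_contra h; exact hp (hc0 p h)).1 j4
  rw [toReal_pairEnergy hm3 (hvE.add hwE).2, toReal_pairEnergy hm1 hvE.2,
    toReal_pairEnergy hm2 hwE.2]
  simp_rw [realDensity_add]
  rw [integral_add (f := fun p => realDensity v p + realDensity w p) (g := fun p => 2 * c p)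
    (j1.add j2) (j4.const_mul 2), integral_add j1 j2, integral_const_mul,
    setIntegral_eq_integral_of_forall_compl_eq_zero hc0, integral_cross hn hv hA hw hwc j5]
  ring

variable {X : Rn n → Rn n} {φ : ℝ → Rn n → Rn n} {L : NNReal}

/-- Along a flow, the increments of a `C²` map are of first order in time, in the Lipschitz norm. -/
lemma exists_comp_flow_sub_bounds (hv : ContDiff ℝ ((⊤ : ℕ∞) : WithTop ℕ∞) v)
    (hX1 : ContDiff ℝ 1 X) (hXc : HasCompactSupport X) (hφ : IsFlow X φ)
    (hX : LipschitzWith L X) : ∃ B : ℝ, 0 ≤ B ∧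
      (∀ t : ℝ, |t| ≤ 1 → ∀ x, ‖v (φ t x) - v x‖ ≤ B * |t|) ∧
      (∀ t : ℝ, |t| ≤ 1 → ∀ x y, ‖(v (φ t x) - v x) - (v (φ t y) - v y)‖ ≤ B * |t| * ‖x - y‖) := by
  set G : Rn n → Rn m := fun x => fderiv ℝ v x (X x) with hG
  have hv2 : ContDiff ℝ 2 v := contDiff_infty.1 hv 2
  have hd : Differentiable ℝ v := hv.differentiable (by simp)
  have hGd : ContDiff ℝ 1 G := (hv2.fderiv_right (m := 1) (by norm_num)).clm_apply hX1
  have hGc : HasCompactSupport G := hXc.mono fun x hx => by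
    contrapose! hx
    rw [Function.notMem_support] at hx ⊢
    simp [hG, hx]
  obtain ⟨K, hK⟩ := hGd.lipschitzWith_of_hasCompactSupport hGc (by norm_num)
  obtain ⟨B, hB⟩ := hGc.exists_bound_of_continuous hGd.continuous
  have hB0 : 0 ≤ B := (norm_nonneg _).trans (hB 0)
  have hder : ∀ x t, HasDerivAt (fun s => v (φ s x)) (G (φ t x)) t := fun x t =>
    (hd (φ t x)).hasFDerivAt.comp_hasDerivAt t (hφ.hasDerivAt t x)
  have h0 : (0 : ℝ) ∈ Icc (-1 : ℝ) 1 := by simp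
  refine ⟨max B (K * Real.exp L), by positivity, fun t ht x => ?_, fun t ht x y => ?_⟩
  · have := (convex_Icc (-1 : ℝ) 1).norm_image_sub_le_of_norm_hasDerivWithin_le
      (fun s _ => (hder x s).hasDerivWithinAt) (fun s _ => hB (φ s x)) h0 (abs_le.1 ht)
    rw [hφ.map_zero, sub_zero, Real.norm_eq_abs] at this
    exact this.trans (by gcongr; exact le_max_left _ _)
  · have hb : ∀ s ∈ Icc (-1 : ℝ) 1, ‖G (φ s x) - G (φ s y)‖ ≤ K * Real.exp L * ‖x - y‖ := by
      intro s hs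
      have h1 := hK.dist_le_mul (φ s x) (φ s y)
      have h2 := (hφ.lipschitzWith hX s).dist_le_mul x y
      rw [Real.coe_toNNReal _ (Real.exp_pos _).le] at h2
      rw [dist_eq_norm] at h1
      rw [dist_eq_norm x y] at h2
      calc _ ≤ K * (Real.exp (L * |s|) * ‖x - y‖) := h1.trans (by gcongr)
        _ ≤ K * (Real.exp (L * 1) * ‖x - y‖) := by gcongr; exact abs_le.2 hs
        _ = _ := by rw [mul_one]; ring
    have := (convex_Icc (-1 : ℝ) 1).norm_image_sub_le_of_norm_hasDerivWithin_le
      (f := fun s => v (φ s x) - v (φ s y))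
      (fun s _ => ((hder x s).sub (hder y s)).hasDerivWithinAt) hb h0 (abs_le.1 ht)
    simp only [hφ.map_zero, sub_zero, Real.norm_eq_abs] at this
    rw [sub_sub_sub_comm]
    calc _ ≤ _ := this
      _ = (K * Real.exp L) * |t| * ‖x - y‖ := by ring
      _ ≤ _ := by gcongr; exact le_max_right _ _

/-- The first variation of the energy of a smooth map. With `w t = v ∘ φ t - v`, the energy of `w t` is
of order `t²`, so only the pairing of `w t / t` with the normal derivative survives in the limit. -/
lemma tendsto_energy_quotient (hn : 1 ≤ n) (hv : ContDiff ℝ ((⊤ : ℕ∞) : WithTop ℕ∞) v)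
    (hc : HasCompactSupport v) (hvE : FiniteEnergy v ω)
    (hX1 : ContDiff ℝ 1 X) (hXc : HasCompactSupport X) (hφ : IsFlow X φ)
    (hX : LipschitzWith L X) (hS : tsupport X ⊆ ω) :
    Tendsto (fun t => ((pairEnergy (fun x => v (φ t x)) ω).toReal - (pairEnergy v ω).toReal) / t)
      (𝓝[≠] 0) (𝓝 (-(4 / gammaConst n) *
        ∫ x, inner ℝ (fderiv ℝ v x (X x)) (normalDeriv v x))) := by
  obtain ⟨A, hA0, hA⟩ := exists_norm_secDiff_le hv hc
  obtain ⟨B, hB0, hB1, hB2⟩ := exists_comp_flow_sub_bounds hv hX1 hXc hφ hX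
  have hd : Differentiable ℝ v := hv.differentiable (by simp)
  set w : ℝ → Rn n → Rn m := fun t x => v (φ t x) - v x with hw
  have hSc : IsCompact (tsupport X) := hXc
  have hw0 : ∀ t, ∀ x ∉ tsupport X, w t x = 0 := fun t x hx => by
    simp [hw, hφ.eq_self hX (image_eq_zero_of_notMem_tsupport hx) t]
  have hwc : ∀ t, HasCompactSupport (w t) := fun t => HasCompactSupport.intro hSc (hw0 t)
  have hwcont : ∀ t, Continuous (w t) := fun t =>
    (hv.continuous.comp (hφ.lipschitzWith hX t).continuous).sub hv.continuous
  have hsq : ∀ t : ℝ, |t| ≤ 1 → ∀ x y,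
      ‖w t x - w t y‖ ^ 2 ≤ (4 * B ^ 2 * t ^ 2) * min (‖x - y‖ ^ 2) 1 := by
    intro t ht x y
    rcases le_total (‖x - y‖ ^ 2) 1 with h | h
    · rw [min_eq_left h]
      calc ‖w t x - w t y‖ ^ 2 ≤ (B * |t| * ‖x - y‖) ^ 2 := by gcongr; exact hB2 t ht x y
        _ = B ^ 2 * t ^ 2 * ‖x - y‖ ^ 2 := by rw [mul_pow, mul_pow, sq_abs]
        _ ≤ _ := by nlinarith [mul_nonneg (mul_nonneg (sq_nonneg B) (sq_nonneg t)) (sq_nonneg ‖x - y‖)]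
    · rw [min_eq_right h]
      calc ‖w t x - w t y‖ ^ 2 ≤ (B * |t| + B * |t|) ^ 2 := by
            gcongr
            exact (norm_sub_le _ _).trans (add_le_add (hB1 t ht x) (hB1 t ht y))
        _ = _ := by rw [← two_mul, mul_pow, mul_pow, sq_abs]; ring
  set κ : ℝ≥0∞ := ∫⁻ h : Rn n, ENNReal.ofReal (min (‖h‖ ^ 2) 1 / ‖h‖ ^ (n + 1)) with hκ
  have hκt : κ < ∞ := by
    have := (integrable_min_sq_div hn).lintegral_lt_top
    exact this
  set V : ℝ≥0∞ := 2 * (volume (tsupport X) * κ) with hV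
  have hVt : V < ∞ := ENNReal.mul_lt_top (by simp) (ENNReal.mul_lt_top hSc.measure_lt_top hκt)
  have hwe : ∀ t : ℝ, |t| ≤ 1 → pairEnergy (w t) ω ≤ ENNReal.ofReal (4 * B ^ 2 * t ^ 2) * V := by
    intro t ht
    refine (pairEnergy_le_of_sq_le (hw0 t) hSc.measurableSet (hsq t ht) ω).trans (le_of_eq ?_)
    rw [hV]; ring
  have hwE : ∀ t : ℝ, |t| ≤ 1 → FiniteEnergy (w t) ω := fun t ht =>
    ⟨poissonIntegrable_of_integrable ((hwcont t).integrable_of_hasCompactSupport (hwc t)),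
      (hwe t ht).trans_lt (ENNReal.mul_lt_top ENNReal.ofReal_lt_top hVt)⟩
  have hwe' : ∀ t : ℝ, |t| ≤ 1 → (pairEnergy (w t) ω).toReal ≤ 4 * B ^ 2 * t ^ 2 * V.toReal := by
    intro t ht
    have := ENNReal.toReal_mono (ENNReal.mul_lt_top ENNReal.ofReal_lt_top hVt).ne (hwe t ht)
    rwa [ENNReal.toReal_mul, ENNReal.toReal_ofReal (by positivity)] at this
  have hsmall : ∀ᶠ t : ℝ in 𝓝[≠] 0, |t| ≤ 1 := by
    refine nhdsWithin_le_nhds ?_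
    filter_upwards [Metric.closedBall_mem_nhds (0 : ℝ) one_pos] with t ht
    simpa using ht
  have t1 : Tendsto (fun t : ℝ => (pairEnergy (w t) ω).toReal / t) (𝓝[≠] 0) (𝓝 0) := by
    have hb : Tendsto (fun t : ℝ => 4 * B ^ 2 * V.toReal * |t|) (𝓝[≠] 0) (𝓝 0) := by
      have : Continuous fun t : ℝ => 4 * B ^ 2 * V.toReal * |t| := by fun_prop
      simpa using (this.tendsto 0).mono_left nhdsWithin_le_nhds
    refine squeeze_zero_norm' ?_ hb
    filter_upwards [hsmall, self_mem_nhdsWithin] with t ht ht0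
    have ht0 : t ≠ 0 := ht0
    have h3 : 0 < |t| := abs_pos.2 ht0
    rw [norm_div, Real.norm_eq_abs t, Real.norm_of_nonneg ENNReal.toReal_nonneg, div_le_iff₀ h3]
    refine (hwe' t ht).trans (le_of_eq ?_)
    rw [← sq_abs t]; ring
  have t2 : Tendsto (fun t : ℝ => ∫ x, inner ℝ (t⁻¹ • w t x) (normalDeriv v x)) (𝓝[≠] 0)
      (𝓝 (∫ x, inner ℝ (fderiv ℝ v x (X x)) (normalDeriv v x))) := by
    set N := gammaConst n / 2 * ∫ h : Rn n, A * (min (‖h‖ ^ 2) 1 / ‖h‖ ^ (n + 1)) with hN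
    have hNb : ∀ x, ‖normalDeriv v x‖ ≤ N := norm_normalDeriv_le hn hA
    have hmN := aestronglyMeasurable_normalDeriv hv.continuous
    refine tendsto_integral_filter_of_dominated_convergence
      ((tsupport X).indicator fun _ => B * N) ?_ ?_ ?_ ?_
    · refine Eventually.of_forall fun t => ?_
      have h1 : Continuous fun x => t⁻¹ • w t x := (hwcont t).const_smul t⁻¹
      exact h1.aestronglyMeasurable.inner hmN
    · filter_upwards [hsmall, self_mem_nhdsWithin] with t ht ht0
      refine ae_of_all _ fun x => ?_
      by_cases hx : x ∈ tsupport X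
      · rw [indicator_of_mem hx]
        refine (norm_inner_le_norm _ _).trans ?_
        gcongr
        · rw [norm_smul, norm_inv, Real.norm_eq_abs, inv_mul_le_iff₀ (abs_pos.2 ht0), mul_comm]
          exact hB1 t ht x
        · exact hNb x
      · rw [indicator_of_notMem hx, hw0 t x hx]
        simp
    · rw [integrable_indicator_iff hSc.measurableSet]
      exact integrableOn_const hSc.measure_lt_top.ne
    · refine ae_of_all _ fun x => Tendsto.inner ?_ tendsto_const_nhds
      have h1 : HasDerivAt (fun s => v (φ s x)) (fderiv ℝ v (φ 0 x) (X (φ 0 x))) 0 :=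
        (hd (φ 0 x)).hasFDerivAt.comp_hasDerivAt 0 (hφ.hasDerivAt 0 x)
      rw [hφ.map_zero] at h1
      have h2 := hasDerivAt_iff_tendsto_slope.1 h1
      refine h2.congr fun t => ?_
      simp [slope_def_module, hφ.map_zero, hw]
  have t3 := t1.add (t2.const_mul (-(4 / gammaConst n)))
  rw [zero_add] at t3
  refine t3.congr' ?_
  filter_upwards [hsmall, self_mem_nhdsWithin] with t ht ht0
  have e1 : (fun x => v (φ t x)) = v + w t := by ext1 x; simp [hw]
  rw [e1, toReal_pairEnergy_add hn hv.continuous hA hvE (hwcont t) (hwc t) (hwE t ht)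
    (fun x hx => hw0 t x fun h => hx (hS h))]
  simp_rw [real_inner_smul_left]
  rw [integral_const_mul]
  have ht0 : t ≠ 0 := ht0
  field_simp
  ring

end smooth

/-! ### Regularity of the extension and the stress-energy tensor -/

section regularity

variable {v : Rn n → Rn m}

/-- The Poisson integral is a convolution with the constant `1` of a family of compactly supported maps
that depends smoothly on the point of the half-space. -/
lemma contDiffOn_harmExt (hv : ContDiff ℝ ((⊤ : ℕ∞) : WithTop ℕ∞) v) (hc : HasCompactSupport v) :
    ContDiffOn ℝ ((⊤ : ℕ∞) : WithTop ℕ∞) (harmExt v) (upperHalf n) := by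
  set g : Rn (n + 1) → Rn n → Rn m := fun p t => pk (p + emb t) • v (-t) with hg
  have hk : IsCompact ((fun z : Rn n => -z) '' tsupport v) :=
    IsCompact.image hc continuous_neg
  have h1 := contDiffOn_convolution_right_with_param (μ := volume) (n := ⊤)
    (ContinuousLinearMap.lsmul ℝ ℝ : ℝ →L[ℝ] Rn m →L[ℝ] Rn m) (f := fun _ : Rn n => (1 : ℝ))
    (g := g) isOpen_upperHalf hk (fun p x _ hx => by
      have : v (-x) = 0 := image_eq_zero_of_notMem_tsupport fun h => hx ⟨-x, h, neg_neg x⟩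
      simp [hg, this]) (locallyIntegrable_const 1) (by
      have h2 : ContDiff ℝ ((⊤ : ℕ∞) : WithTop ℕ∞) fun q : Rn (n + 1) × Rn n => q.1 + emb q.2 :=
        contDiff_fst.add ((embL n).contDiff.comp contDiff_snd)
      refine (contDiffOn_pk.comp h2.contDiffOn fun q hq => ?_).smul
        (hv.comp contDiff_snd.neg).contDiffOn
      have h3 : 0 < height q.1 := hq.1
      intro h0
      have h4 : height (q.1 + emb q.2) = 0 := by
        rw [show q.1 + emb q.2 = 0 from h0]; rfl
      rw [height_add, height_emb, add_zero] at h4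
      exact h3.ne' h4)
  refine (h1.comp (s := upperHalf n) (f := fun p => (p, (0 : Rn n)))
    (contDiff_id.prodMk contDiff_const).contDiffOn fun p hp => ⟨hp, mem_univ _⟩).congr
    fun p _ => ?_
  simp only [Function.comp, convolution, ContinuousLinearMap.lsmul_apply, one_smul, hg,
    harmExt_eq_integral_pk]
  congr 1; ext1 z
  rw [zero_sub, neg_neg, sub_eq_add_neg]
  congr 3
  exact ((embL n).map_neg z).symm

/-- Differentiation of an integral against a kernel that is smooth off the origin. -/
lemma hasFDerivAt_integral_kernel (hv : Continuous v) (hc : HasCompactSupport v)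
    {g : Rn (n + 1) → ℝ} (hg : ContDiffOn ℝ 1 g {0}ᶜ) {x : Rn (n + 1)} (hx : 0 < height x) :
    HasFDerivAt (fun y => ∫ z, g (y - emb z) • v z)
        (∫ z, (fderiv ℝ g (x - emb z)).smulRight (v z)) x ∧
      Integrable fun z => (fderiv ℝ g (x - emb z)).smulRight (v z) := by
  have hd : ContinuousOn (fderiv ℝ g) {0}ᶜ :=
    hg.continuousOn_fderiv_of_isOpen isOpen_compl_singleton le_rfl
  set r := height x / 2 with hr
  have hr0 : 0 < r := by positivity
  have hpos : ∀ y ∈ Metric.closedBall x r, 0 < height y := by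
    intro y hy
    have h1 := abs_height_le (y - x)
    rw [height_sub] at h1
    have h2 : ‖y - x‖ ≤ r := by simpa [dist_eq_norm] using hy
    have := (abs_le.1 (h1.trans h2)).1
    linarith
  have hcs : ∀ y, 0 < height y → Continuous fun z : Rn n => g (y - emb z) := fun y hy =>
    hg.continuousOn.comp_continuous (continuous_const.sub continuous_emb)
      fun z => sub_emb_ne_zero hy z
  have hcd : ∀ y, 0 < height y → Continuous fun z : Rn n => fderiv ℝ g (y - emb z) := fun y hy =>
    hd.comp_continuous (continuous_const.sub continuous_emb) fun z => sub_emb_ne_zero hy z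
  have hF : ∀ y, 0 < height y → Continuous fun z : Rn n => g (y - emb z) • v z :=
    fun y hy => (hcs y hy).smul hv
  have hF' : Continuous fun z : Rn n => (fderiv ℝ g (x - emb z)).smulRight (v z) := by
    have := hcd x hx
    fun_prop
  have hcomp : IsCompact ((fun q : Rn (n + 1) × Rn n => q.1 - emb q.2) ''
      (Metric.closedBall x r ×ˢ tsupport v)) :=
    ((isCompact_closedBall x r).prod hc).image
      (continuous_fst.sub (continuous_emb.comp continuous_snd))
  obtain ⟨B, hB⟩ := hcomp.exists_bound_of_continuousOn (hd.mono (by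
    rintro _ ⟨q, hq, rfl⟩
    exact sub_emb_ne_zero (hpos _ hq.1) _))
  have hsupp : ∀ {E : Type} [NormedAddCommGroup E] (F : Rn n → E), (∀ z, v z = 0 → F z = 0) →
      HasCompactSupport F := fun F hF0 => hc.mono fun z hz => by
    contrapose! hz
    rw [Function.notMem_support] at hz ⊢
    exact hF0 z hz
  have hzero : ∀ z, v z = 0 → (fderiv ℝ g (x - emb z)).smulRight (v z) = 0 := fun z hz => by
    ext; simp [hz]
  refine ⟨hasFDerivAt_integral_of_dominated_of_fderiv_le (s := Metric.ball x r)
    (F' := fun y z => (fderiv ℝ g (y - emb z)).smulRight (v z))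
    (bound := fun z => B * ‖v z‖)
    (Metric.ball_mem_nhds x hr0) ?_ ?_ hF'.aestronglyMeasurable ?_ ?_ ?_,
    hF'.integrable_of_hasCompactSupport (hsupp _ hzero)⟩
  · filter_upwards [isOpen_upperHalf.mem_nhds hx] with y hy
    exact (hF y hy).aestronglyMeasurable
  · exact (hF x hx).integrable_of_hasCompactSupport (hsupp _ fun z hz => by simp [hz])
  · refine ae_of_all _ fun z y hy => ?_
    rw [ContinuousLinearMap.norm_smulRight_apply]
    by_cases hz : z ∈ tsupport v
    · gcongr
      exact hB _ ⟨(y, z), ⟨Metric.ball_subset_closedBall hy, hz⟩, rfl⟩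
    · simp [image_eq_zero_of_notMem_tsupport hz]
  · exact (hv.norm.integrable_of_hasCompactSupport hc.norm).const_mul B
  · refine ae_of_all _ fun z y hy => ?_
    have h1 := sub_emb_ne_zero (hpos y (Metric.ball_subset_closedBall hy)) z
    have h2 : HasFDerivAt g (fderiv ℝ g (y - emb z)) (y - emb z) :=
      (((hg.contDiffAt (isOpen_compl_singleton.mem_nhds h1)).differentiableAt
        (by norm_num))).hasFDerivAt
    have h3 : HasFDerivAt (fun y => g (y - emb z)) (fderiv ℝ g (y - emb z)) y :=
      (h2.comp y ((hasFDerivAt_id y).sub_const (emb z))).congr_fderiv (by ext; simp)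
    exact h3.smul_const (v z)

/-- The extension is harmonic. -/
lemma sum_fderiv_fderiv_harmExt (hv : ContDiff ℝ ((⊤ : ℕ∞) : WithTop ℕ∞) v)
    (hc : HasCompactSupport v) {x : Rn (n + 1)} (hx : 0 < height x) :
    ∑ j, fderiv ℝ (fderiv ℝ (harmExt v)) x (EuclideanSpace.single j 1)
      (EuclideanSpace.single j 1) = 0 := by
  have hu := (contDiffOn_harmExt hv hc).contDiffAt (isOpen_upperHalf.mem_nhds hx)
  have hu1 : DifferentiableAt ℝ (fderiv ℝ (harmExt v)) x :=
    (hu.fderiv_right (m := 1) (by norm_cast)).differentiableAt (by norm_num)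
  have hpi := poissonIntegrable_smooth hv hc
  have hpk1 : ContDiffOn ℝ 1 (fderiv ℝ (pk (n := n))) {0}ᶜ :=
    contDiffOn_pk.fderiv_of_isOpen isOpen_compl_singleton (by norm_cast)
  have hg : ∀ j : Fin (n + 1), ContDiffOn ℝ 1
      (fun y : Rn (n + 1) => pkGrad y (EuclideanSpace.single j 1)) {0}ᶜ := fun j =>
    (hpk1.clm_apply contDiffOn_const).congr fun y hy => by rw [(hasFDerivAt_pk hy).fderiv]
  -- second derivatives fall on the kernel
  have e1 : ∀ j : Fin (n + 1), fderiv ℝ (fderiv ℝ (harmExt v)) x (EuclideanSpace.single j 1)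
      (EuclideanSpace.single j 1) =
      ∫ z, fderiv ℝ (fun y => pkGrad y (EuclideanSpace.single j 1)) (x - emb z)
        (EuclideanSpace.single j 1) • v z := by
    intro j
    obtain ⟨h1, h2⟩ := hasFDerivAt_integral_kernel hv.continuous hc (hg j) hx
    have h3 : HasFDerivAt (fun y => fderiv ℝ (harmExt v) y (EuclideanSpace.single j 1))
        ((ContinuousLinearMap.apply ℝ (Rn m) (EuclideanSpace.single j 1)).comp
          (fderiv ℝ (fderiv ℝ (harmExt v)) x)) x :=
      (ContinuousLinearMap.apply ℝ (Rn m)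
        (EuclideanSpace.single j 1 : Rn (n + 1))).hasFDerivAt.comp x hu1.hasFDerivAt
    have h4 : (fun y => fderiv ℝ (harmExt v) y (EuclideanSpace.single j 1)) =ᶠ[𝓝 x]
        fun y => ∫ z, pkGrad (y - emb z) (EuclideanSpace.single j 1) • v z := by
      filter_upwards [isOpen_upperHalf.mem_nhds hx] with y hy
      have hy : 0 < height y := hy
      rw [(hasFDerivAt_harmExt hpi hy).fderiv,
        ContinuousLinearMap.integral_apply (integrable_pkGrad_smulRight hpi hy)]
      rfl
    have h5 := congrArg (fun D => D (EuclideanSpace.single j 1))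
      ((h3.congr_of_eventuallyEq h4.symm).unique h1)
    simp only [ContinuousLinearMap.comp_apply, ContinuousLinearMap.apply_apply] at h5
    rw [h5, ContinuousLinearMap.integral_apply h2]
    rfl
  simp_rw [e1]
  rw [← integral_finsetSum]
  · simp_rw [← Finset.sum_smul]
    refine integral_eq_zero_of_ae (ae_of_all _ fun z => ?_)
    simp [sum_pderiv_pkGrad (sub_emb_ne_zero hx z)]
  · intro j _
    exact ((hasFDerivAt_integral_kernel hv.continuous hc (hg j) hx).2).apply_continuousLinearMap
      (EuclideanSpace.single j 1)

end regularity

section stress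

variable {k : ℕ}

/-- The `j`-th component of the contraction of the stress-energy tensor of `u` with `Y`. -/
noncomputable def stressField (u : Rn k → Rn m) (Y : Rn k → Rn k) (j : Fin k) (x : Rn k) : ℝ :=
  inner ℝ (pderiv u j x) (fderiv ℝ u x (Y x)) - 1 / 2 * gradSq u x * Y x j

lemma sum_apply_smul_single (x : Rn k) :
    ∑ i, x i • (EuclideanSpace.single i (1 : ℝ) : Rn k) = x := by
  ext i
  simp [Pi.single_apply]

/-- The stress-energy tensor of a harmonic map into a Euclidean space is divergence free. -/
lemma sum_fderiv_stressField {u : Rn k → Rn m} {Y : Rn k → Rn k} {x : Rn k}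
    (hu : ContDiffAt ℝ 2 u x) (hY : DifferentiableAt ℝ Y x)
    (hh : ∑ j, fderiv ℝ (fderiv ℝ u) x (EuclideanSpace.single j 1)
      (EuclideanSpace.single j 1) = 0) :
    ∑ j, fderiv ℝ (stressField u Y j) x (EuclideanSpace.single j 1) =
      -(1 / 2) * stressIntegrand u Y x := by
  set B := fderiv ℝ (fderiv ℝ u) x with hB
  set e : Fin k → Rn k := fun j => EuclideanSpace.single j 1 with he
  set A := fderiv ℝ u x with hA
  set D := fderiv ℝ Y x with hD
  have hsymm : ∀ a b, B a b = B b a := by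
    intro a b
    exact (hu.isSymmSndFDerivAt (by simp)).eq a b
  have hA' : HasFDerivAt (fderiv ℝ u) B x :=
    ((hu.fderiv_right (m := 1) (by norm_num)).differentiableAt (by norm_num)).hasFDerivAt
  have hp : ∀ j, HasFDerivAt (pderiv u j)
      ((ContinuousLinearMap.apply ℝ (Rn m) (e j)).comp B) x := fun j =>
    (ContinuousLinearMap.apply ℝ (Rn m) (e j)).hasFDerivAt.comp x hA'
  have hY' : ∀ j, HasFDerivAt (fun y => Y y j) ((EuclideanSpace.proj j).comp D) x := fun j =>
    (EuclideanSpace.proj j : Rn k →L[ℝ] ℝ).hasFDerivAt.comp x hY.hasFDerivAt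
  have hgs : HasFDerivAt (gradSq u)
      (∑ i, (2 : ℕ) • (innerSL ℝ (A (e i))).comp
        ((ContinuousLinearMap.apply ℝ (Rn m) (e i)).comp B)) x := by
    unfold gradSq
    exact HasFDerivAt.fun_sum fun i _ => (hp i).norm_sq
  have hAY := hA'.clm_apply hY.hasFDerivAt
  have hder : ∀ j, fderiv ℝ (stressField u Y j) x (e j) =
      inner ℝ (A (e j)) (A (D (e j)) + B (e j) (Y x)) + inner ℝ (B (e j) (e j)) (A (Y x)) -
        (1 / 2 * gradSq u x * D (e j) j +
          Y x j * ∑ i, inner ℝ (A (e i)) (B (e j) (e i))) := by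
    intro j
    have h1 := ((hp j).inner ℝ hAY).sub ((hgs.const_mul (1 / 2)).mul (hY' j))
    have h2 : fderiv ℝ (stressField u Y j) x = _ := h1.fderiv
    rw [h2]
    simp [pderiv, fderivInnerCLM_apply, Finset.mul_sum, ← hA]
    rfl
  have e1 : ∑ j, inner ℝ (B (e j) (e j)) (A (Y x)) = 0 := by
    rw [← sum_inner, hh, inner_zero_left]
  have e2 : ∑ j, inner ℝ (A (e j)) (B (e j) (Y x)) =
      ∑ j, Y x j * ∑ i, inner ℝ (A (e i)) (B (e j) (e i)) := by
    simp_rw [Finset.mul_sum]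
    rw [Finset.sum_comm]
    refine Finset.sum_congr rfl fun j _ => ?_
    conv_lhs => rw [← sum_apply_smul_single (Y x), map_sum, inner_sum]
    refine Finset.sum_congr rfl fun i _ => ?_
    rw [map_smul, inner_smul_right, hsymm]
  have e3 : ∀ j, inner ℝ (A (e j)) (A (D (e j))) =
      ∑ i, inner ℝ (A (e i)) (A (e j)) * D (e j) i := by
    intro j
    conv_lhs => rw [← sum_apply_smul_single (D (e j)), map_sum, inner_sum]
    refine Finset.sum_congr rfl fun i _ => ?_
    rw [map_smul, inner_smul_right, real_inner_comm, mul_comm]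
  have e4 : ∑ j, inner ℝ (A (e j)) (A (D (e j))) =
      ∑ i, ∑ j, inner ℝ (A (e i)) (A (e j)) * D (e j) i := by
    simp_rw [e3]; exact Finset.sum_comm
  have e5 : stressIntegrand u Y x = gradSq u x * ∑ j, D (e j) j -
      2 * ∑ i, ∑ j, inner ℝ (A (e i)) (A (e j)) * D (e j) i := rfl
  change ∑ j, fderiv ℝ (stressField u Y j) x (e j) = _
  simp_rw [hder, inner_add_right, Finset.sum_sub_distrib, Finset.sum_add_distrib]
  rw [e1, e2, e4, e5, ← Finset.mul_sum]
  ring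

end stress

/-! ### Extension fields -/

/-- The divergence theorem on the whole space. -/
lemma integral_fderiv_apply_eq_zero {k : ℕ} {f : Rn k → ℝ} (hf : ContDiff ℝ 1 f)
    (hc : HasCompactSupport f) (e : Rn k) :
    Integrable (fun x => fderiv ℝ f x e) ∧ ∫ x, fderiv ℝ f x e = 0 := by
  have hi : Integrable fun x => fderiv ℝ f x e :=
    ((hf.continuous_fderiv (by norm_num)).clm_apply
      continuous_const).integrable_of_hasCompactSupport (hc.fderiv_apply (𝕜 := ℝ) e)
  refine ⟨hi, ?_⟩
  have := integral_bilinear_hasLineDerivAt_right_eq_neg_left_of_integrable (μ := volume)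
    (f := fun _ : Rn k => (1 : ℝ)) (f' := fun _ => 0) (g := f) (g' := fun x => fderiv ℝ f x e)
    (v := e) (B := ContinuousLinearMap.mul ℝ ℝ) (by simp) (by simpa using hi)
    (by simpa using hf.continuous.integrable_of_hasCompactSupport hc)
    (fun x _ => (hasFDerivAt_const (1 : ℝ) x).hasLineDerivAt e)
    (fun x _ => ((hf.differentiable (by norm_num)) x).hasFDerivAt.hasLineDerivAt e)
  simpa using this

/-- A map that is `C¹` up to the boundary of a bounded open set has bounded derivative there. -/
lemma exists_norm_fderiv_le {k : ℕ} {Ω : Set (Rn k)} {Y : Rn k → Rn k} (hΩ : IsOpen Ω)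
    (hb : Bornology.IsBounded Ω) (hY : ContDiffOn ℝ 1 Y (closure Ω)) :
    ∃ M : ℝ, 0 ≤ M ∧ ∀ x ∈ Ω, ‖fderiv ℝ Y x‖ ≤ M := by
  have hK : IsCompact (closure Ω) := hb.isCompact_closure
  have : ∃ M : ℝ, ∀ x ∈ closure Ω ∩ Ω, ‖fderiv ℝ Y x‖ ≤ M := by
    refine hK.induction_on (p := fun s => ∃ M : ℝ, ∀ x ∈ s ∩ Ω, ‖fderiv ℝ Y x‖ ≤ M)
      ⟨0, by simp⟩ (fun s t hst ⟨M, hM⟩ => ⟨M, fun x hx => hM x ⟨hst hx.1, hx.2⟩⟩)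
      (fun s t ⟨M, hM⟩ ⟨M', hM'⟩ => ⟨max M M', fun x hx => ?_⟩) fun x hx => ?_
    · rcases hx with ⟨hx | hx, hxΩ⟩
      · exact (hM x ⟨hx, hxΩ⟩).trans (le_max_left _ _)
      · exact (hM' x ⟨hx, hxΩ⟩).trans (le_max_right _ _)
    · obtain ⟨u, hu, -, f', hf', hf'c⟩ :=
        (contDiffWithinAt_succ_iff_hasFDerivWithinAt (n := 0) (by simp)).1
          (by simpa using hY x hx)
      rw [insert_eq_of_mem hx] at hu
      have hxu : x ∈ u := mem_of_mem_nhdsWithin hx hu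
      have hcont : ContinuousWithinAt f' u x := hf'c.continuousWithinAt
      have h1 : ∀ᶠ y in 𝓝[u] x, ‖f' y‖ < ‖f' x‖ + 1 :=
        hcont.norm.eventually (gt_mem_nhds (by linarith))
      have h2 : {y | ‖f' y‖ < ‖f' x‖ + 1} ∩ u ∈ 𝓝[closure Ω] x := by
        have h3 : {y | ‖f' y‖ < ‖f' x‖ + 1} ∩ u ∈ 𝓝[u] x :=
          inter_mem h1 self_mem_nhdsWithin
        rw [mem_nhdsWithin] at h3 ⊢
        obtain ⟨V, hV, hxV, hVs⟩ := h3
        obtain ⟨V', hV', hxV', hVs'⟩ := mem_nhdsWithin.1 hu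
        exact ⟨V ∩ V', hV.inter hV', ⟨hxV, hxV'⟩, fun y hy => hVs ⟨hy.1.1, hVs' ⟨hy.1.2, hy.2⟩⟩⟩
      obtain ⟨V, hV, hxV, hVs⟩ := mem_nhdsWithin.1 h2
      refine ⟨V ∩ closure Ω, inter_mem (mem_nhdsWithin_of_mem_nhds (hV.mem_nhds hxV))
        self_mem_nhdsWithin, ‖f' x‖ + 1, fun y hy => ?_⟩
      have hyu : y ∈ {y | ‖f' y‖ < ‖f' x‖ + 1} ∩ u := hVs hy.1
      have hyn : u ∈ 𝓝 y := by
        filter_upwards [hV.mem_nhds hy.1.1, hΩ.mem_nhds hy.2] with z hz hz'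
        exact (hVs ⟨hz, subset_closure hz'⟩).2
      rw [((hf' y hyu.2).hasFDerivAt hyn).fderiv]
      exact hyu.1.le
  obtain ⟨M, hM⟩ := this
  exact ⟨max M 0, le_max_right _ _,
    fun x hx => (hM x ⟨subset_closure hx, hx⟩).trans (le_max_left _ _)⟩

section extension

variable {Ω : Set (Rn (n + 1))} {X : Rn n → Rn n} {Y : Rn (n + 1) → Rn (n + 1)}

lemma emb_notMem_of_subset_upperHalf (hΩH : Ω ⊆ upperHalf n) (x : Rn n) : emb x ∉ Ω := fun h => by
  have : 0 < height (emb x) := hΩH h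
  simp at this

/-- Extended by zero outside `Ω`, an extension field vanishes off a compact subset of `Ω ∪ ∂⁰Ω`. -/
lemma IsExtensionField.exists_compact (hY : IsExtensionField Ω X Y) :
    ∃ K : Set (Rn (n + 1)), IsCompact K ∧ K ⊆ Ω ∪ emb '' flatBdry Ω ∧
      ∀ x ∉ K, Ω.indicator Y x = 0 := by
  obtain ⟨K, hK, hKs, hK0⟩ := hY.compact_support
  refine ⟨K, hK, hKs, fun x hx => ?_⟩
  by_cases hxΩ : x ∈ Ω
  · rw [indicator_of_mem hxΩ, hK0 x ⟨subset_closure hxΩ, hx⟩]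
  · rw [indicator_of_notMem hxΩ]

lemma IsExtensionField.eventuallyEq_zero (hY : IsExtensionField Ω X Y) {x : Rn (n + 1)}
    (hx : x ∉ Ω) (hx' : x ∉ emb '' flatBdry Ω) : Ω.indicator Y =ᶠ[𝓝 x] 0 := by
  obtain ⟨K, hK, hKs, hK0⟩ := hY.exists_compact
  have hxK : x ∉ K := fun h => (hKs h).elim hx hx'
  filter_upwards [hK.isClosed.isOpen_compl.mem_nhds hxK] with y hy
  exact hK0 y hy

/-- Extended by zero outside `Ω`, an extension field is `C¹` in the open half-space. -/
lemma IsExtensionField.contDiffAt (hY : IsExtensionField Ω X Y) (hΩ : IsOpen Ω)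
    {x : Rn (n + 1)} (hx : 0 < height x) : ContDiffAt ℝ 1 (Ω.indicator Y) x := by
  by_cases hxΩ : x ∈ Ω
  · have h1 : ContDiffAt ℝ 1 Y x :=
      hY.contDiffOn.contDiffAt (mem_of_superset (hΩ.mem_nhds hxΩ) subset_closure)
    refine h1.congr_of_eventuallyEq ?_
    filter_upwards [hΩ.mem_nhds hxΩ] with y hy
    rw [indicator_of_mem hy]
  · refine (contDiffAt_const (c := (0 : Rn (n + 1)))).congr_of_eventuallyEq
      (hY.eventuallyEq_zero hxΩ ?_)
    rintro ⟨z, -, rfl⟩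
    simp at hx

lemma IsExtensionField.exists_norm_le (hY : IsExtensionField Ω X Y)
    (hb : Bornology.IsBounded Ω) : ∃ B : ℝ, 0 ≤ B ∧ ∀ x, ‖Ω.indicator Y x‖ ≤ B := by
  obtain ⟨B, hB⟩ := hb.isCompact_closure.exists_bound_of_continuousOn hY.contDiffOn.continuousOn
  refine ⟨max B 0, le_max_right _ _, fun x => ?_⟩
  by_cases hx : x ∈ Ω
  · rw [indicator_of_mem hx]
    exact (hB x (subset_closure hx)).trans (le_max_left _ _)
  · simp [indicator_of_notMem hx]

lemma tendsto_up_nhds (x : Rn n) : Tendsto (fun s : ℝ => up x s) (𝓝[>] 0) (𝓝 (emb x)) := by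
  have h1 : Continuous fun s : ℝ => up x s := continuous_up.comp (continuous_const.prodMk continuous_id)
  exact (h1.tendsto 0).mono_left nhdsWithin_le_nhds

/-- An extension field has boundary values `(X, 0)` on all of `ℝⁿ`. -/
lemma IsExtensionField.tendsto_up (hY : IsExtensionField Ω X Y) (hΩH : Ω ⊆ upperHalf n)
    (hX : tsupport X ⊆ flatBdry Ω) (x : Rn n) :
    Tendsto (fun s : ℝ => Ω.indicator Y (up x s)) (𝓝[>] 0) (𝓝 (emb (X x))) := by
  by_cases hx : x ∈ flatBdry Ω
  · obtain ⟨hf, r, hr, hball⟩ := hx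
    have h1 : ContinuousWithinAt Y (closure Ω) (emb x) :=
      hY.contDiffOn.continuousOn _ (frontier_subset_closure hf)
    have h2 : ∀ᶠ s in 𝓝[>] (0 : ℝ), up x s ∈ Ω := by
      filter_upwards [tendsto_up_nhds x (Metric.ball_mem_nhds _ hr), self_mem_nhdsWithin]
        with s hs hs0
      exact hball ⟨hs, by simpa [upperHalf] using hs0⟩
    rw [← hY.eq_on_flatBdry x ⟨hf, r, hr, hball⟩]
    have h3 : Tendsto (fun s : ℝ => up x s) (𝓝[>] 0) (𝓝[closure Ω] (emb x)) :=
      tendsto_nhdsWithin_iff.2 ⟨tendsto_up_nhds x, h2.mono fun s hs => subset_closure hs⟩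
    refine (h1.tendsto.comp h3).congr' ?_
    filter_upwards [h2] with s hs
    simp [indicator_of_mem hs]
  · have h1 : X x = 0 := image_eq_zero_of_notMem_tsupport fun h => hx (hX h)
    have h2 : emb x ∉ emb '' flatBdry Ω := by
      rintro ⟨z, hz, hzx⟩
      exact hx (emb_injective hzx ▸ hz)
    have h3 := tendsto_up_nhds x
      (hY.eventuallyEq_zero (emb_notMem_of_subset_upperHalf hΩH x) h2)
    have h4 : emb (0 : Rn n) = 0 := (embL n).map_zero
    rw [h1, h4]
    refine tendsto_const_nhds.congr' ?_
    filter_upwards [h3] with s hs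
    exact hs.symm

lemma IsExtensionField.measurable (hY : IsExtensionField Ω X Y) (hΩ : IsOpen Ω) :
    Measurable (Ω.indicator Y) := by
  classical
  rw [← piecewise_eq_indicator]
  exact ContinuousOn.measurable_piecewise (hY.contDiffOn.continuousOn.mono subset_closure)
    continuousOn_const hΩ.measurableSet

end extension

/-- A smooth cutoff vanishing on `(-∞, 1]` and equal to `1` on `[2, ∞)`. -/
noncomputable def cutoff (τ : ℝ) : ℝ := Real.smoothTransition (τ - 1)

lemma contDiff_cutoff : ContDiff ℝ 1 cutoff :=
  Real.smoothTransition.contDiff.comp (contDiff_id.sub contDiff_const)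

lemma cutoff_eq_zero {τ : ℝ} (h : τ ≤ 1) : cutoff τ = 0 :=
  Real.smoothTransition.zero_of_nonpos (by linarith)

lemma cutoff_eq_one {τ : ℝ} (h : 2 ≤ τ) : cutoff τ = 1 :=
  Real.smoothTransition.one_of_one_le (by linarith)

lemma abs_cutoff_le (τ : ℝ) : |cutoff τ| ≤ 1 := by
  rw [cutoff, abs_of_nonneg (Real.smoothTransition.nonneg _)]
  exact Real.smoothTransition.le_one _

lemma deriv_cutoff_eq_zero {τ : ℝ} (h : τ ∉ Icc (1 : ℝ) 2) : deriv cutoff τ = 0 := by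
  rw [mem_Icc, not_and_or, not_le, not_le] at h
  rcases h with h | h
  · have : cutoff =ᶠ[𝓝 τ] fun _ => 0 := by
      filter_upwards [gt_mem_nhds h] with s hs
      exact cutoff_eq_zero (le_of_lt hs)
    rw [this.deriv_eq, deriv_const]
  · have : cutoff =ᶠ[𝓝 τ] fun _ => 1 := by
      filter_upwards [lt_mem_nhds h] with s hs
      exact cutoff_eq_one (le_of_lt hs)
    rw [this.deriv_eq, deriv_const]

lemma continuous_deriv_cutoff : Continuous (deriv cutoff) :=
  contDiff_cutoff.continuous_deriv le_rfl

lemma hasCompactSupport_deriv_cutoff : HasCompactSupport (deriv cutoff) :=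
  HasCompactSupport.intro isCompact_Icc fun _ h => deriv_cutoff_eq_zero h

lemma integral_deriv_cutoff : ∫ τ, deriv cutoff τ = 1 := by
  have h1 : ∫ τ, deriv cutoff τ = ∫ τ in Icc (1 : ℝ) 2, deriv cutoff τ :=
    (setIntegral_eq_integral_of_forall_compl_eq_zero fun _ h => deriv_cutoff_eq_zero h).symm
  rw [h1, integral_Icc_eq_integral_Ioc, ← intervalIntegral.integral_of_le (by norm_num),
    intervalIntegral.integral_deriv_eq_sub
      (fun x _ => contDiff_cutoff.differentiable (by norm_num) x)
      (continuous_deriv_cutoff.intervalIntegrable _ _), cutoff_eq_one le_rfl,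
    cutoff_eq_zero le_rfl, sub_zero]

/-! ### The stress functional of a smooth map -/

lemma fderiv_apply_eq_sum {k : ℕ} (u : Rn k → Rn m) (x y : Rn k) :
    fderiv ℝ u x y = ∑ i, y i • pderiv u i x := by
  conv_lhs => rw [← sum_apply_smul_single y, map_sum]
  simp [pderiv]

lemma measurable_stressField {k : ℕ} (u : Rn k → Rn m) {Y : Rn k → Rn k} (hY : Measurable Y)
    (j : Fin k) : Measurable (stressField u Y j) := by
  have h0 : ∀ i, Measurable fun x => Y x i := fun i =>
    (EuclideanSpace.proj i : Rn k →L[ℝ] ℝ).continuous.measurable.comp hY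
  have h1 : Measurable fun x => fderiv ℝ u x (Y x) := by
    simp_rw [fderiv_apply_eq_sum u]
    exact Finset.measurable_sum _ fun i _ => (h0 i).smul (measurable_pderiv u i)
  have h2 : Measurable (gradSq u) :=
    Finset.measurable_sum _ fun i _ => (measurable_pderiv u i).norm.pow_const 2
  exact ((measurable_pderiv u j).inner h1).sub ((h2.const_mul (1 / 2)).mul (h0 j))

lemma gradSq_nonneg {k : ℕ} (u : Rn k → Rn m) (x : Rn k) : 0 ≤ gradSq u x :=
  Finset.sum_nonneg fun _ _ => by positivity

lemma gradSq_le {k : ℕ} {u : Rn k → Rn m} {x : Rn k} {M : ℝ} (hM : ‖fderiv ℝ u x‖ ≤ M) :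
    gradSq u x ≤ k * M ^ 2 := by
  calc gradSq u x ≤ ∑ _i : Fin k, M ^ 2 := Finset.sum_le_sum fun i _ => by
        gcongr
        exact (norm_apply_single_le _ i).trans hM
    _ = k * M ^ 2 := by simp

/-- The stress-energy flux is bounded where the gradient and the field are. -/
lemma abs_stressField_le {k : ℕ} {u : Rn k → Rn m} {Y : Rn k → Rn k} {x : Rn k} {M B : ℝ}
    (hM : ‖fderiv ℝ u x‖ ≤ M) (hB : ‖Y x‖ ≤ B) (j : Fin k) :
    |stressField u Y j x| ≤ M * (M * B) + 1 / 2 * (k * M ^ 2) * B := by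
  have hM0 : 0 ≤ M := (norm_nonneg _).trans hM
  have hB0 : 0 ≤ B := (norm_nonneg _).trans hB
  have hg := gradSq_nonneg u x
  refine (abs_sub _ _).trans (add_le_add ?_ ?_)
  · refine (abs_real_inner_le_norm _ _).trans ?_
    gcongr
    · exact (norm_apply_single_le _ j).trans hM
    · exact (ContinuousLinearMap.le_opNorm _ _).trans (by gcongr)
  · rw [abs_mul, abs_of_nonneg (by positivity)]
    gcongr
    · exact gradSq_le hM
    · exact (PiLp.norm_apply_le (Y x) j).trans hB

section

variable {v : Rn n → Rn m} {Ω : Set (Rn (n + 1))} {X : Rn n → Rn n} {Y : Rn (n + 1) → Rn (n + 1)}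

/-- The flux of the stress-energy tensor through `ℝⁿ`: the field is tangential there, so the term
`½|∇vᵉ|² Y_{n+1}` drops out. -/
lemma tendsto_stressField_up (hn : 1 ≤ n) (hv : ContDiff ℝ ((⊤ : ℕ∞) : WithTop ℕ∞) v)
    (hc : HasCompactSupport v) (hΩH : Ω ⊆ upperHalf n) (hX : tsupport X ⊆ flatBdry Ω)
    (hY : IsExtensionField Ω X Y) (x : Rn n) :
    Tendsto (fun s => stressField (harmExt v) (Ω.indicator Y) (Fin.last n) (up x s)) (𝓝[>] 0)
      (𝓝 (inner ℝ (fderiv ℝ v x (X x)) (normalDeriv v x))) := by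
  obtain ⟨M, hM0, hM⟩ := exists_norm_fderiv_harmExt_le hn hv hc
  have hpos : ∀ᶠ s in 𝓝[>] (0 : ℝ), 0 < height (up x s) := by
    filter_upwards [self_mem_nhdsWithin] with s hs
    simpa using hs
  have hYt := hY.tendsto_up hΩH hX x
  have h1 : Tendsto (fun s => fderiv ℝ (harmExt v) (up x s) (Ω.indicator Y (up x s))) (𝓝[>] 0)
      (𝓝 (fderiv ℝ v x (X x))) := by
    have h2 : Tendsto (fun s => fderiv ℝ (harmExt v) (up x s)
        (Ω.indicator Y (up x s) - emb (X x))) (𝓝[>] 0) (𝓝 0) := by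
      have h3 : Tendsto (fun s => M * ‖Ω.indicator Y (up x s) - emb (X x)‖) (𝓝[>] 0) (𝓝 0) := by
        have := (hYt.sub_const (emb (X x))).norm.const_mul M
        simpa using this
      refine squeeze_zero_norm' ?_ h3
      filter_upwards [hpos] with s hs
      exact (ContinuousLinearMap.le_opNorm _ _).trans (by gcongr; exact hM _ hs)
    have h4 := h2.add (tendsto_fderiv_harmExt_emb hv hc x (X x))
    rw [zero_add] at h4
    refine h4.congr fun s => ?_
    rw [← map_add, sub_add_cancel]
  have h5 : Tendsto (fun s => 1 / 2 * gradSq (harmExt v) (up x s) *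
      Ω.indicator Y (up x s) (Fin.last n)) (𝓝[>] 0) (𝓝 0) := by
    have h6 : Tendsto (fun s => Ω.indicator Y (up x s) (Fin.last n)) (𝓝[>] 0) (𝓝 0) := by
      have := ((heightL n).continuous.tendsto _).comp hYt
      rw [heightL_apply, height_emb] at this
      exact this
    have h7 : Tendsto (fun s => 1 / 2 * (((n + 1 : ℕ) : ℝ) * M ^ 2) *
        |Ω.indicator Y (up x s) (Fin.last n)|) (𝓝[>] 0) (𝓝 0) := by
      have := h6.abs.const_mul (1 / 2 * (((n + 1 : ℕ) : ℝ) * M ^ 2))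
      simpa using this
    refine squeeze_zero_norm' ?_ h7
    filter_upwards [hpos] with s hs
    have hg := gradSq_nonneg (harmExt v) (up x s)
    rw [Real.norm_eq_abs, abs_mul, abs_of_nonneg (by positivity)]
    gcongr
    exact gradSq_le (hM _ hs)
  have h8 := ((tendsto_pderiv_last_harmExt hn hv hc x).inner h1).sub h5
  rw [sub_zero, real_inner_comm] at h8
  exact h8

lemma contDiffAt_stressField (hv : ContDiff ℝ ((⊤ : ℕ∞) : WithTop ℕ∞) v)
    (hc : HasCompactSupport v) (hΩ : IsOpen Ω) (hY : IsExtensionField Ω X Y) (j : Fin (n + 1))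
    {x : Rn (n + 1)} (hx : 0 < height x) :
    ContDiffAt ℝ 1 (stressField (harmExt v) (Ω.indicator Y) j) x := by
  have hu := (contDiffOn_harmExt hv hc).contDiffAt (isOpen_upperHalf.mem_nhds hx)
  have hu1 : ContDiffAt ℝ 1 (fderiv ℝ (harmExt v)) x := hu.fderiv_right (m := 1) (by norm_cast)
  have hY1 := hY.contDiffAt hΩ hx
  have hp : ∀ i, ContDiffAt ℝ 1 (pderiv (harmExt v) i) x := fun i =>
    hu1.clm_apply contDiffAt_const
  have hg : ContDiffAt ℝ 1 (gradSq (harmExt v)) x :=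
    ContDiffAt.sum fun i _ => (hp i).norm_sq ℝ
  have hYj : ContDiffAt ℝ 1 (fun x => Ω.indicator Y x j) x :=
    (EuclideanSpace.proj j : Rn (n + 1) →L[ℝ] ℝ).contDiff.contDiffAt.comp x hY1
  exact ((hp j).inner ℝ (hu1.clm_apply hY1)).sub ((contDiffAt_const.mul hg).mul hYj)

/-- The divergence theorem for the stress-energy tensor, away from the boundary: the cutoff vanishes
for heights below `δ`, and its gradient produces the flux through the layer of heights between `δ` and
`2δ`. -/
lemma integral_cutoff_stress (hv : ContDiff ℝ ((⊤ : ℕ∞) : WithTop ℕ∞) v)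
    (hc : HasCompactSupport v) (hΩ : IsOpen Ω) (hΩH : Ω ⊆ upperHalf n)
    (hY : IsExtensionField Ω X Y) (hs : IntegrableOn (stressIntegrand (harmExt v) Y) Ω)
    {δ : ℝ} (hδ : 0 < δ) :
    Integrable (fun x => δ⁻¹ * deriv cutoff (δ⁻¹ * height x) *
        stressField (harmExt v) (Ω.indicator Y) (Fin.last n) x) ∧
      ∫ x in Ω, cutoff (δ⁻¹ * height x) * (-(1 / 2) * stressIntegrand (harmExt v) Y x) =
      -∫ x, δ⁻¹ * deriv cutoff (δ⁻¹ * height x) *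
        stressField (harmExt v) (Ω.indicator Y) (Fin.last n) x := by
  set W := stressField (harmExt v) (Ω.indicator Y) with hW
  obtain ⟨K, hK, hKs, hK0⟩ := hY.exists_compact
  have hW0 : ∀ j, ∀ x, Ω.indicator Y x = 0 → W j x = 0 := fun j x hx => by
    simp [hW, stressField, hx]
  set f : Fin (n + 1) → Rn (n + 1) → ℝ := fun j x => cutoff (δ⁻¹ * height x) * W j x with hf
  -- the cutoff field is identically zero near and below `ℝⁿ`
  have hlow : ∀ j x, height x ≤ 0 → f j =ᶠ[𝓝 x] 0 := by
    intro j x hx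
    have h1 : {y : Rn (n + 1) | height y < δ} ∈ 𝓝 x :=
      (isOpen_lt continuous_height continuous_const).mem_nhds (hx.trans_lt hδ)
    filter_upwards [h1] with y hy
    have h2 : δ⁻¹ * height y ≤ 1 := by
      rw [inv_mul_le_iff₀ hδ, mul_one]; exact le_of_lt hy
    simp [hf, cutoff_eq_zero h2]
  have hη : ContDiff ℝ 1 fun x : Rn (n + 1) => cutoff (δ⁻¹ * height x) :=
    contDiff_cutoff.comp (contDiff_const.mul (heightL n).contDiff)
  have hfC : ∀ j, ContDiff ℝ 1 (f j) := by
    intro j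
    rw [contDiff_iff_contDiffAt]
    intro x
    rcases lt_or_ge 0 (height x) with hx | hx
    · exact hη.contDiffAt.mul (contDiffAt_stressField hv hc hΩ hY j hx)
    · exact (contDiffAt_const (c := (0 : ℝ))).congr_of_eventuallyEq (hlow j x hx)
  have hfc : ∀ j, HasCompactSupport (f j) := fun j => HasCompactSupport.intro hK fun x hx => by
    simp [hf, hW0 j x (hK0 x hx)]
  have hdiv : ∀ x ∈ Ω, ∑ j, fderiv ℝ (f j) x (EuclideanSpace.single j 1) =
      cutoff (δ⁻¹ * height x) * (-(1 / 2) * stressIntegrand (harmExt v) Y x) +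
        δ⁻¹ * deriv cutoff (δ⁻¹ * height x) * W (Fin.last n) x := by
    intro x hx
    have hx0 : 0 < height x := hΩH hx
    have hu := (contDiffOn_harmExt hv hc).contDiffAt (isOpen_upperHalf.mem_nhds hx0)
    have hη' : HasFDerivAt (fun x : Rn (n + 1) => cutoff (δ⁻¹ * height x))
        ((deriv cutoff (δ⁻¹ * height x)) • (δ⁻¹ • heightL n)) x :=
      ((contDiff_cutoff.differentiable (by norm_num) _).hasDerivAt).comp_hasFDerivAt x
        ((heightL n).hasFDerivAt.const_mul δ⁻¹)
    have hd : ∀ j, fderiv ℝ (f j) x (EuclideanSpace.single j 1) =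
        cutoff (δ⁻¹ * height x) * fderiv ℝ (W j) x (EuclideanSpace.single j 1) +
          W j x * (deriv cutoff (δ⁻¹ * height x) * (δ⁻¹ *
            height (EuclideanSpace.single j (1 : ℝ) : Rn (n + 1)))) := by
      intro j
      have h1 := (hη'.mul ((contDiffAt_stressField hv hc hΩ hY j hx0).differentiableAt
        (by norm_num)).hasFDerivAt).fderiv
      have h2 : fderiv ℝ (f j) x = _ := h1
      rw [h2]
      simp [heightL_apply, hW]
    have hstress : stressIntegrand (harmExt v) (Ω.indicator Y) x =
        stressIntegrand (harmExt v) Y x := by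
      have : fderiv ℝ (Ω.indicator Y) x = fderiv ℝ Y x := by
        refine Filter.EventuallyEq.fderiv_eq ?_
        filter_upwards [hΩ.mem_nhds hx] with y hy
        rw [indicator_of_mem hy]
      rw [stressIntegrand_eq, stressIntegrand_eq, this]
    simp_rw [hd]
    rw [Finset.sum_add_distrib, ← Finset.mul_sum, hW, sum_fderiv_stressField
      (hu.of_le (by norm_cast)) ((hY.contDiffAt hΩ hx0).differentiableAt (by norm_num))
      (sum_fderiv_fderiv_harmExt hv hc hx0), hstress]
    congr 1
    rw [Finset.sum_eq_single (Fin.last n)]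
    · simp [height]; ring
    · intro j _ hj
      simp [height, hj.symm]
    · simp
  have hout : ∀ x ∉ Ω, ∑ j, fderiv ℝ (f j) x (EuclideanSpace.single j 1) = 0 := by
    intro x hx
    refine Finset.sum_eq_zero fun j _ => ?_
    have : f j =ᶠ[𝓝 x] fun _ => 0 := by
      by_cases hx' : x ∈ emb '' flatBdry Ω
      · obtain ⟨z, -, rfl⟩ := hx'
        exact hlow j _ (by simp)
      · filter_upwards [hY.eventuallyEq_zero hx hx'] with y hy
        simp [hf, hW0 j y hy]
    rw [this.fderiv_eq]
    simp
  have hfi := fun j => integral_fderiv_apply_eq_zero (hfC j) (hfc j) (EuclideanSpace.single j 1)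
  have hsum : ∫ x, ∑ j, fderiv ℝ (f j) x (EuclideanSpace.single j 1) = 0 := by
    rw [integral_finsetSum _ fun j _ => (hfi j).1]
    exact Finset.sum_eq_zero fun j _ => (hfi j).2
  have hsumi : Integrable fun x => ∑ j, fderiv ℝ (f j) x (EuclideanSpace.single j 1) :=
    integrable_finsetSum _ fun j _ => (hfi j).1
  rw [← setIntegral_eq_integral_of_forall_compl_eq_zero hout,
    setIntegral_congr_fun hΩ.measurableSet hdiv] at hsum
  have i1 : IntegrableOn (fun x => cutoff (δ⁻¹ * height x) *
      (-(1 / 2) * stressIntegrand (harmExt v) Y x)) Ω := by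
    refine Integrable.bdd_mul (c := 1) (hs.const_mul _)
      hη.continuous.aestronglyMeasurable (ae_of_all _ fun x => abs_cutoff_le _)
  have i2 : IntegrableOn (fun x => δ⁻¹ * deriv cutoff (δ⁻¹ * height x) * W (Fin.last n) x) Ω := by
    have h1 := (hsumi.integrableOn (s := Ω)).congr_fun hdiv hΩ.measurableSet
    refine (h1.sub i1).congr (ae_of_all _ fun x => ?_)
    simp
  have hWΩ : ∀ x ∉ Ω, δ⁻¹ * deriv cutoff (δ⁻¹ * height x) * W (Fin.last n) x = 0 := fun x hx => by
    rw [hW0 _ x (indicator_of_notMem hx Y), mul_zero]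
  rw [integral_add i1 i2, setIntegral_eq_integral_of_forall_compl_eq_zero hWΩ] at hsum
  refine ⟨(integrableOn_iff_integrable_of_support_subset fun x hx => ?_).1 i2, by linarith⟩
  by_contra h
  exact hx (hWΩ x h)

/-- The stress functional of a smooth map, as a boundary integral: let the layer in the divergence
theorem shrink to `ℝⁿ`. -/
theorem stressFunctional_smooth (hn : 1 ≤ n) (hv : ContDiff ℝ ((⊤ : ℕ∞) : WithTop ℕ∞) v)
    (hc : HasCompactSupport v) (hΩ : IsOpen Ω) (hΩb : Bornology.IsBounded Ω)
    (hΩH : Ω ⊆ upperHalf n) (hX : tsupport X ⊆ flatBdry Ω) (hY : IsExtensionField Ω X Y)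
    (hs : IntegrableOn (stressIntegrand (harmExt v) Y) Ω) :
    stressFunctional Ω Y v = -∫ x, inner ℝ (fderiv ℝ v x (X x)) (normalDeriv v x) := by
  set W := stressField (harmExt v) (Ω.indicator Y) (Fin.last n) with hW
  obtain ⟨M, hM0, hM⟩ := exists_norm_fderiv_harmExt_le hn hv hc
  obtain ⟨B, hB0, hB⟩ := hY.exists_norm_le hΩb
  set C := M * (M * B) + 1 / 2 * (((n + 1 : ℕ) : ℝ) * M ^ 2) * B with hC
  have hC0 : 0 ≤ C := by positivity
  have hWm : Measurable W := measurable_stressField _ (hY.measurable hΩ) _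
  have hWb : ∀ x, |W x| ≤ C := by
    intro x
    by_cases hx : x ∈ Ω
    · exact abs_stressField_le (hM x (hΩH hx)) (hB x) _
    · have : W x = 0 := by simp [hW, stressField, indicator_of_notMem hx]
      rw [this, abs_zero]; exact hC0
  obtain ⟨R, hR⟩ := hΩb.subset_closedBall (0 : Rn (n + 1))
  have hW0 : ∀ x : Rn n, x ∉ Metric.closedBall (0 : Rn n) R → ∀ s, W (up x s) = 0 := by
    intro x hx s
    have : up x s ∉ Ω := fun h => hx (by
      have h1 := hR h
      rw [mem_closedBall_zero_iff] at h1 ⊢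
      have h2 := norm_horiz_le (up x s)
      rw [horiz_up] at h2
      exact h2.trans h1)
    simp [hW, stressField, indicator_of_notMem this]
  set G : ℝ → Rn n → ℝ := fun δ x => ∫ τ, deriv cutoff τ * W (up x (δ * τ)) with hG
  have hbd : ∀ δ x τ, ‖deriv cutoff τ * W (up x (δ * τ))‖ ≤ |deriv cutoff τ| * C := fun δ x τ => by
    rw [norm_mul, Real.norm_eq_abs, Real.norm_eq_abs]
    gcongr
    exact hWb _
  have hηi : Integrable (deriv cutoff) :=
    continuous_deriv_cutoff.integrable_of_hasCompactSupport hasCompactSupport_deriv_cutoff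
  have hηC : Integrable fun τ => |deriv cutoff τ| * C := hηi.abs.mul_const C
  -- the rescaled height `τ = s / δ`
  have e1 : ∀ δ : ℝ, 0 < δ → ∫ x in Ω, cutoff (δ⁻¹ * height x) *
      (-(1 / 2) * stressIntegrand (harmExt v) Y x) = -∫ x, G δ x := by
    intro δ hδ
    obtain ⟨h1, h2⟩ := integral_cutoff_stress hv hc hΩ hΩH hY hs hδ
    rw [h2, integral_eq_integral_up, Measure.volume_eq_prod, integral_prod]
    · congr 2; ext1 x
      have h3 := Measure.integral_comp_mul_left
        (fun τ => deriv cutoff τ * W (up x (δ * τ))) δ⁻¹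
      simp only [mul_inv_cancel_left₀ hδ.ne', inv_inv, abs_of_pos hδ, smul_eq_mul] at h3
      have h4 : G δ x = δ⁻¹ * (δ * ∫ τ, deriv cutoff τ * W (up x (δ * τ))) := by
        rw [inv_mul_cancel_left₀ hδ.ne']
      rw [h4, ← h3, ← integral_const_mul]
      congr 1; ext1 s
      simp only [height_up, hW]
      ring
    · exact (integrable_iff_integrable_up _).1 h1
  have t1 : Tendsto (fun δ => ∫ x, G δ x) (𝓝[>] 0)
      (𝓝 (∫ x, inner ℝ (fderiv ℝ v x (X x)) (normalDeriv v x))) := by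
    refine tendsto_integral_filter_of_dominated_convergence
      ((Metric.closedBall (0 : Rn n) R).indicator fun _ => ∫ τ, |deriv cutoff τ| * C) ?_ ?_ ?_ ?_
    · refine Eventually.of_forall fun δ => ?_
      have h1 : Continuous fun p : Rn n × ℝ => up p.1 (δ * p.2) :=
        continuous_up.comp (continuous_fst.prodMk (continuous_const.mul continuous_snd))
      have h2 : Measurable fun p : Rn n × ℝ => deriv cutoff p.2 * W (up p.1 (δ * p.2)) :=
        (continuous_deriv_cutoff.measurable.comp measurable_snd).mul (hWm.comp h1.measurable)
      exact (h2.stronglyMeasurable.integral_prod_right').aestronglyMeasurable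
    · refine Eventually.of_forall fun δ => ae_of_all _ fun x => ?_
      by_cases hx : x ∈ Metric.closedBall (0 : Rn n) R
      · rw [indicator_of_mem hx]
        exact norm_integral_le_of_norm_le hηC (ae_of_all _ fun τ => hbd δ x τ)
      · rw [indicator_of_notMem hx]
        simp [hG, hW0 x hx]
    · rw [integrable_indicator_iff Metric.isClosed_closedBall.measurableSet]
      exact integrableOn_const measure_closedBall_lt_top.ne
    · refine ae_of_all _ fun x => ?_
      have h1 : Tendsto (fun δ => G δ x) (𝓝[>] 0) (𝓝 (∫ τ, deriv cutoff τ *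
          inner ℝ (fderiv ℝ v x (X x)) (normalDeriv v x))) := by
        refine tendsto_integral_filter_of_dominated_convergence
          (fun τ => |deriv cutoff τ| * C) ?_ ?_ hηC ?_
        · refine Eventually.of_forall fun δ => Measurable.aestronglyMeasurable ?_
          have h1 : Continuous fun τ : ℝ => up x (δ * τ) :=
            continuous_up.comp (continuous_const.prodMk (continuous_const.mul continuous_id))
          exact continuous_deriv_cutoff.measurable.mul (hWm.comp h1.measurable)
        · exact Eventually.of_forall fun δ => ae_of_all _ fun τ => hbd δ x τ
        · refine ae_of_all _ fun τ => ?_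
          by_cases hτ : τ ∈ Icc (1 : ℝ) 2
          · refine ((tendsto_stressField_up hn hv hc hΩH hX hY x).comp ?_).const_mul _
            have hτ0 : 0 < τ := one_pos.trans_le hτ.1
            refine tendsto_nhdsWithin_iff.2 ⟨?_, ?_⟩
            · have : Continuous fun δ : ℝ => δ * τ := by fun_prop
              have := this.tendsto 0
              rw [zero_mul] at this
              exact this.mono_left nhdsWithin_le_nhds
            · filter_upwards [self_mem_nhdsWithin] with δ hδ
              exact mul_pos hδ hτ0
          · simp [deriv_cutoff_eq_zero hτ]
      rwa [integral_mul_const, integral_deriv_cutoff, one_mul] at h1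
  have t2 : Tendsto (fun δ : ℝ => ∫ x in Ω, cutoff (δ⁻¹ * height x) *
      (-(1 / 2) * stressIntegrand (harmExt v) Y x)) (𝓝[>] 0)
      (𝓝 (∫ x in Ω, -(1 / 2) * stressIntegrand (harmExt v) Y x)) := by
    refine tendsto_integral_filter_of_dominated_convergence
      (fun x => ‖-(1 / 2) * stressIntegrand (harmExt v) Y x‖) ?_ ?_ (hs.const_mul _).norm ?_
    · refine Eventually.of_forall fun δ => AEStronglyMeasurable.mul ?_
        (hs.const_mul _).aestronglyMeasurable
      exact (contDiff_cutoff.continuous.comp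
        (continuous_const.mul continuous_height)).aestronglyMeasurable
    · refine Eventually.of_forall fun δ => ae_of_all _ fun x => ?_
      rw [norm_mul]
      exact mul_le_of_le_one_left (norm_nonneg _) (abs_cutoff_le _)
    · refine (ae_restrict_iff' hΩ.measurableSet).2 (ae_of_all _ fun x hx => ?_)
      have hx0 : 0 < height x := hΩH hx
      refine tendsto_const_nhds.congr' ?_
      have h1 : Iio (height x / 2) ∈ 𝓝[>] (0 : ℝ) :=
        nhdsWithin_le_nhds (Iio_mem_nhds (by positivity))
      filter_upwards [h1, self_mem_nhdsWithin] with δ hδ hδ0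
      have hδ0 : 0 < δ := hδ0
      have hδ : δ < height x / 2 := hδ
      rw [cutoff_eq_one, one_mul]
      rw [le_inv_mul_iff₀ hδ0]
      linarith
  have t3 := t2.congr' (f₂ := fun δ => -∫ x, G δ x) (by
    filter_upwards [self_mem_nhdsWithin] with δ hδ
    exact e1 δ hδ)
  have := tendsto_nhds_unique t3 t1.neg
  rw [stressFunctional, ← this, integral_const_mul]

end

/-! ### First variation of the energy -/

section geometry

variable {ω : Set (Rn n)} {Ω : Set (Rn (n + 1))}

/-- The closure of `Ω` touches `ℝⁿ` only in the closure of `∂⁰Ω`. -/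
lemma IsAdmissible.closure_subset (hΩ : IsAdmissible Ω) :
    closure Ω ⊆ upperHalf n ∪ emb '' closure (flatBdry Ω) := by
  intro x hx
  rw [closure_eq_self_union_frontier] at hx
  rcases hx with hx | hx
  · exact Or.inl (hΩ.subset_upperHalf hx)
  · rw [hΩ.frontier_eq] at hx
    exact hx.imp And.right id

lemma IsAdmissible.isCompact_closure_flatBdry (hΩ : IsAdmissible Ω) :
    IsCompact (closure (flatBdry Ω)) := by
  obtain ⟨R, hR⟩ := hΩ.isBounded.closure.subset_closedBall (0 : Rn (n + 1))
  refine ((Metric.isBounded_closedBall (x := (0 : Rn n)) (r := R)).subset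
    fun x hx => ?_).isCompact_closure
  have := hR (frontier_subset_closure hx.1)
  rw [mem_closedBall_zero_iff, norm_emb] at this
  simpa using this

/-- A neighbourhood of the flat boundary well inside `ω`; away from it, `Ω` stays at a positive
distance from `ℝⁿ`. -/
lemma IsAdmissible.exists_nhd (hΩ : IsAdmissible Ω) (hω : IsOpen ω)
    (hΩω : closure (flatBdry Ω) ⊆ ω) :
    ∃ (ω' : Set (Rn n)) (δ : ℝ), IsOpen ω' ∧ Bornology.IsBounded ω' ∧ ω'.Nonempty ∧ 0 < δ ∧
      closure (flatBdry Ω) ⊆ ω' ∧ ω' ⊆ ω ∧ (∀ x ∈ ω', ∀ s : Rn n, ‖s‖ < δ → s + x ∈ ω) ∧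
      ∃ η : ℝ, 0 < η ∧ ∀ x ∈ Ω, horiz x ∈ ω' ∨ η ≤ height x := by
  have hF := hΩ.isCompact_closure_flatBdry
  obtain ⟨δ, hδ, hδω⟩ := hF.exists_thickening_subset_open hω hΩω
  have hFsub : closure (flatBdry Ω) ⊆ Metric.thickening (δ / 2) (closure (flatBdry Ω)) :=
    Metric.self_subset_thickening (by positivity) _
  refine ⟨Metric.thickening (δ / 2) (closure (flatBdry Ω)), δ / 2, Metric.isOpen_thickening,
    hF.isBounded.thickening, hΩ.flatBdry_nonempty.mono (subset_closure.trans hFsub), by positivity,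
    hFsub, (Metric.thickening_mono (by linarith) _).trans hδω, fun x hx s hs => ?_, ?_⟩
  · refine hδω ?_
    rw [Metric.mem_thickening_iff] at hx ⊢
    obtain ⟨z, hz, hxz⟩ := hx
    refine ⟨z, hz, ?_⟩
    calc dist (s + x) z ≤ dist (s + x) x + dist x z := dist_triangle _ _ _
      _ < δ / 2 + δ / 2 := by
          refine add_lt_add ?_ hxz
          rwa [dist_eq_norm, add_sub_cancel_right]
      _ = δ := by ring
  · set ω' := Metric.thickening (δ / 2) (closure (flatBdry Ω))
    have hc : IsCompact (closure Ω ∩ {x | horiz x ∉ ω'}) :=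
      hΩ.isBounded.isCompact_closure.inter_right
        ((Metric.isOpen_thickening.preimage continuous_horiz).isClosed_compl)
    obtain ⟨η, hη, hηb⟩ := hc.exists_forall_le' (f := height) (a := 0)
      continuous_height.continuousOn fun x hx => by
        rcases hΩ.closure_subset hx.1 with h | ⟨z, hz, rfl⟩
        · exact h
        · exact absurd (hFsub hz) (by simpa using hx.2)
    refine ⟨η, hη, fun x hx => or_iff_not_imp_left.2 fun h => hηb x ⟨subset_closure hx, h⟩⟩

end geometry

lemma IsQuadratic.const_mul {ω : Set (Rn n)} {q : (Rn n → Rn m) → ℝ} (hq : IsQuadratic ω q)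
    (c : ℝ) : IsQuadratic ω fun v => c * q v := by
  intro a b ha hb l hl
  have := hq a b ha hb l hl
  simp only at this ⊢
  rw [this]; ring

section firstVariation

variable {v : Rn n → Rn m} {ω ω' : Set (Rn n)} {Ω : Set (Rn (n + 1))} {X : Rn n → Rn n}
  {φ : ℝ → Rn n → Rn n} {Y : Rn (n + 1) → Rn (n + 1)}

/-- Pairs of points that are not moved do not contribute to the variation of the energy. -/
lemma pairEnergy_sub_eq_of_subset {w : Rn n → Rn m} (hv : FiniteEnergy v ω)
    (hw : FiniteEnergy w ω) (hω : MeasurableSet ω) (h : ω' ⊆ ω)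
    (he : ∀ x ∉ ω', w x = v x) :
    (pairEnergy w ω).toReal - (pairEnergy v ω).toReal =
      (pairEnergy w ω').toReal - (pairEnergy v ω').toReal := by
  have hmv := hv.1.aestronglyMeasurable
  have hmw := hw.1.aestronglyMeasurable
  rw [toReal_pairEnergy hmw hw.2, toReal_pairEnergy hmv hv.2,
    toReal_pairEnergy hmw (hw.mono h).2, toReal_pairEnergy hmv (hv.mono h).2,
    ← integral_sub (integrableOn_realDensity hmw hw.2) (integrableOn_realDensity hmv hv.2),
    ← integral_sub (integrableOn_realDensity hmw (hw.mono h).2)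
      (integrableOn_realDensity hmv (hv.mono h).2)]
  refine setIntegral_eq_of_subset_of_forall_sdiff_eq_zero (measurableSet_touch hω) (touch_mono h)
    fun p hp => ?_
  have hp2 := hp.2
  simp only [touch, mem_ofPred_eq, not_or] at hp2
  simp [realDensity, he _ hp2.1, he _ hp2.2]

lemma memHhat_comp_flow (hω : IsOpen ω) (hv : MemHhat v ω) (hX1 : ContDiff ℝ 1 X)
    (hXc : HasCompactSupport X) (hXω : tsupport X ⊆ ω) (hφ : IsFlow X φ) (t : ℝ) :
    MemHhat (fun x => v (φ t x)) ω := by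
  obtain ⟨L, hL⟩ := hX1.lipschitzWith_of_hasCompactSupport hXc (by norm_num)
  have hb := hφ.isBiLipschitz hL t
  have hm := aestronglyMeasurable_of_isCompact hv.1
  refine ⟨hb.memLp_comp hv.1, ?_⟩
  have h1 := hv.2
  rw [halfEnergy_eq _ hω.measurableSet] at h1 ⊢
  have hγ := gammaConst_pos n
  have h2 : pairEnergy v ω < ∞ := by
    refine lt_of_le_of_ne le_top fun h => ?_
    rw [h, ENNReal.mul_top (by simpa using hγ)] at h1
    exact lt_irrefl _ h1
  refine ENNReal.mul_lt_top ENNReal.ofReal_lt_top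
    ((hb.pairEnergy_comp_le hm hω.measurableSet (hφ.mem_iff hL hXω t)).trans_lt ?_)
  exact ENNReal.mul_lt_top (by simp) h2

/-- The gradient of the extension is square integrable on `Ω`. -/
lemma integrableOn_sq_norm_fderiv_harmExt (hω : IsOpen ω) (hΩ : IsAdmissible Ω)
    (hΩω : closure (flatBdry Ω) ⊆ ω) (hv : MemHhat v ω) :
    IntegrableOn (fun x => ‖fderiv ℝ (harmExt v) x‖ ^ 2) Ω := by
  obtain ⟨ω', δ, hω', hωb', hne', hδ, hF, hsub, hshift, η, hη, hsplit⟩ := hΩ.exists_nhd hω hΩω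
  have hvE := (hv.finiteEnergy hω (hne'.mono hsub)).mono hsub
  obtain ⟨C, hC, hCb⟩ := exists_dirichlet_bound (m := m) hω' hωb' hne' hΩ.isBounded
    hΩ.isOpen.measurableSet hΩ.subset_upperHalf hη hsplit
  exact integrableOn_sq_norm_fderiv hvE (hCb v hvE)

/-- The first variation of the energy of `v` is the stress functional of its extension: both sides
are quadratic and bounded by the energy, and they agree on smooth maps, which are dense. -/
theorem hasDerivAt_halfEnergy (hn : 1 ≤ n) (hω : IsOpen ω) (hωb : Bornology.IsBounded ω)
    (hΩ : IsAdmissible Ω) (hΩω : closure (flatBdry Ω) ⊆ ω) (hv : MemHhat v ω)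
    (hX1 : ContDiff ℝ 1 X) (hXc : HasCompactSupport X) (hXΩ : tsupport X ⊆ flatBdry Ω)
    (hφ : IsFlow X φ) (hY : IsExtensionField Ω X Y) :
    IntegrableOn (stressIntegrand (harmExt v) Y) Ω ∧
      HasDerivAt (fun t => (halfEnergy (fun x => v (φ t x)) ω).toReal)
        (-(1 / 2) * ∫ x in Ω, stressIntegrand (harmExt v) Y x) 0 := by
  obtain ⟨ω', δ, hω', hωb', hne', hδ, hF, hsub, hshift, η, hη, hsplit⟩ := hΩ.exists_nhd hω hΩω
  have hvE := hv.finiteEnergy hω (hne'.mono hsub)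
  have hΩm := hΩ.isOpen.measurableSet
  have hXω' : tsupport X ⊆ ω' := (hXΩ.trans subset_closure).trans hF
  obtain ⟨C, hC, hCb⟩ := exists_dirichlet_bound (m := m) hω' hωb' hne' hΩ.isBounded hΩm
    hΩ.subset_upperHalf hη hsplit
  obtain ⟨M, hM, hMb⟩ := exists_norm_fderiv_le hΩ.isOpen hΩ.isBounded hY.contDiffOn
  obtain ⟨L, hL⟩ := hX1.lipschitzWith_of_hasCompactSupport hXc (by norm_num)
  have hγ := gammaConst_pos n
  have hsi : ∀ w : Rn n → Rn m, FiniteEnergy w ω' →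
      IntegrableOn (stressIntegrand (harmExt w) Y) Ω := fun w hw =>
    integrableOn_stressIntegrand hΩm (integrableOn_sq_norm_fderiv hw (hCb w hw)) hMb
  refine ⟨hsi v (hvE.mono hsub), ?_⟩
  obtain ⟨w, hw, hwc, hwE, hwlim⟩ := exists_smooth_approx hvE hω hωb (hne'.mono hsub)
    hω'.measurableSet hδ hshift
  -- `C1` bounds the difference quotients, `C2` the stress functional
  set C1 := (3 * n + 1) * L * Real.exp (2 * ((3 * n + 1) * L)) with hC1
  set C2 := 4 / gammaConst n * ((((n + 1 : ℕ) : ℝ) ^ 2 * ((n + 1 : ℕ) + 2)) * M * C) with hC2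
  have hC10 : 0 ≤ C1 := by positivity
  have key : Tendsto (fun t => ((pairEnergy (fun x => v (φ t x)) ω').toReal -
      (pairEnergy v ω').toReal) / t) (𝓝[≠] 0) (𝓝 (4 / gammaConst n * stressFunctional Ω Y v)) := by
    refine tendsto_of_isQuadratic (C := max C1 C2) (ω := ω')
      (q := fun t v => ((pairEnergy (fun x => v (φ t x)) ω').toReal -
        (pairEnergy v ω').toReal) / t)
      (R := fun v => 4 / gammaConst n * stressFunctional Ω Y v)
      (hC10.trans (le_max_left _ _)) ?_
      ((isQuadratic_stressFunctional hΩm hΩ.subset_upperHalf hMb hCb).const_mul _) ?_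
      (hvE.mono hsub) hwE hwlim ?_
    · have h1 : ∀ᶠ t : ℝ in 𝓝[≠] 0, |t| ≤ 1 := by
        refine nhdsWithin_le_nhds ?_
        filter_upwards [Metric.closedBall_mem_nhds (0 : ℝ) one_pos] with t ht
        simpa using ht
      filter_upwards [h1, self_mem_nhdsWithin] with t ht ht0
      refine ⟨isQuadratic_comp_flow hφ hL hω' hne' hXω' t, fun v hv => ?_⟩
      refine (abs_energy_quotient_le hv hφ hL hω' hne' hXω' ht0 ht).trans ?_
      gcongr
      exact le_max_left _ _
    · intro v hv
      rw [abs_mul, abs_of_pos (by positivity)]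
      calc _ ≤ 4 / gammaConst n * (((((n + 1 : ℕ) : ℝ) ^ 2 * ((n + 1 : ℕ) + 2)) * M * C) *
            (pairEnergy v ω').toReal) := by
            gcongr
            exact abs_stressFunctional_le hΩm hC hM hMb hv (hCb v hv)
        _ = C2 * (pairEnergy v ω').toReal := by rw [hC2]; ring
        _ ≤ _ := by gcongr; exact le_max_right _ _
    · intro k
      have h1 := tendsto_energy_quotient hn (hw k) (hwc k) (hwE k) hX1 hXc hφ hL hXω'
      rw [stressFunctional_smooth hn (hw k) (hwc k) hΩ.isOpen hΩ.isBounded hΩ.subset_upperHalf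
        hXΩ hY (hsi _ (hwE k))]
      convert h1 using 2
      ring
  -- return from `ω'` to `ω`: the flow moves no point outside `ω'`
  rw [hasDerivAt_iff_tendsto_slope]
  have key2 := key.const_mul (gammaConst n / 4)
  rw [← mul_assoc, show gammaConst n / 4 * (4 / gammaConst n) = 1 by field_simp, one_mul] at key2
  refine key2.congr fun t => ?_
  have hφE : FiniteEnergy (fun x => v (φ t x)) ω :=
    hvE.comp_flow hφ hL hω (hne'.mono hsub) (hXω'.trans hsub) t
  have h0 : (fun x => v (φ 0 x)) = v := by ext1 x; rw [hφ.map_zero]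
  have hE : ∀ w : Rn n → Rn m, (halfEnergy w ω).toReal =
      gammaConst n / 4 * (pairEnergy w ω).toReal := fun w => by
    rw [halfEnergy_eq _ hω.measurableSet, ENNReal.toReal_mul, ENNReal.toReal_ofReal (by positivity)]
  rw [slope_def_field, h0, hE, hE, sub_zero, ← mul_sub,
    pairEnergy_sub_eq_of_subset hvE hφE hω.measurableSet hsub fun x hx => by
      rw [hφ.eq_self hL (image_eq_zero_of_notMem_tsupport fun h => hx (hXω' h))]]
  ring

end firstVariation

/-! ### One-parameter groups and their boundary values -/

section group

variable {k : ℕ} {Φ : ℝ → Rn k → Rn k}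

/-- The generating vector field of a one-parameter group. -/
noncomputable def generator (Φ : ℝ → Rn k → Rn k) (x : Rn k) : Rn k :=
  fderiv ℝ (fun p : ℝ × Rn k => Φ p.1 p.2) (0, x) (1, 0)

lemma IsDiffeoGroup.map_neg_map (hΦ : IsDiffeoGroup Φ) (t : ℝ) (x : Rn k) :
    Φ (-t) (Φ t x) = x := by
  rw [← hΦ.map_add, neg_add_cancel, hΦ.map_zero]

lemma IsDiffeoGroup.map_map_neg (hΦ : IsDiffeoGroup Φ) (t : ℝ) (x : Rn k) :
    Φ t (Φ (-t) x) = x := by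
  rw [← hΦ.map_add, add_neg_cancel, hΦ.map_zero]

lemma IsDiffeoGroup.continuous_time (hΦ : IsDiffeoGroup Φ) (x : Rn k) :
    Continuous fun t => Φ t x :=
  hΦ.contDiff.continuous.comp (continuous_id.prodMk continuous_const)

lemma IsDiffeoGroup.differentiable (hΦ : IsDiffeoGroup Φ) :
    Differentiable ℝ fun p : ℝ × Rn k => Φ p.1 p.2 :=
  hΦ.contDiff.differentiable (by simp)

/-- By the group law, the orbits are integral curves of the generator. -/
lemma IsDiffeoGroup.hasDerivAt (hΦ : IsDiffeoGroup Φ) (t : ℝ) (x : Rn k) :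
    HasDerivAt (fun s => Φ s x) (generator Φ (Φ t x)) t := by
  have h1 : HasDerivAt (fun s : ℝ => (s - t, Φ t x)) ((1 : ℝ), (0 : Rn k)) t :=
    ((hasDerivAt_id t).sub_const t).prodMk (hasDerivAt_const t _)
  have h2 : HasFDerivAt (fun p : ℝ × Rn k => Φ p.1 p.2)
      (fderiv ℝ (fun p : ℝ × Rn k => Φ p.1 p.2) (0, Φ t x)) ((fun s : ℝ => (s - t, Φ t x)) t) := by
    simp only [sub_self]
    exact (hΦ.differentiable _).hasFDerivAt
  refine (h2.comp_hasDerivAt t h1).congr_of_eventuallyEq (Eventually.of_forall fun s => ?_)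
  simp only [Function.comp]
  rw [← hΦ.map_add, sub_add_cancel]

lemma IsDiffeoGroup.contDiff_generator (hΦ : IsDiffeoGroup Φ) :
    ContDiff ℝ 1 (generator Φ) := by
  have h1 : ContDiff ℝ 1 (fderiv ℝ fun p : ℝ × Rn k => Φ p.1 p.2) :=
    hΦ.contDiff.fderiv_right (by norm_cast)
  exact (h1.comp (contDiff_const.prodMk contDiff_id)).clm_apply contDiff_const

/-- A common compact support of the maps `Φ t - id`: the times fixing a given point form a closed
subgroup of `ℝ`, which is everything as soon as it contains `1` and `√2`. -/
def fixSupport (Φ : ℝ → Rn k → Rn k) : Set (Rn k) :=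
  tsupport (fun x => Φ 1 x - x) ∪ tsupport (fun x => Φ √2 x - x)

lemma IsDiffeoGroup.isCompact_fixSupport (hΦ : IsDiffeoGroup Φ) : IsCompact (fixSupport Φ) :=
  IsCompact.union (hΦ.compact_support 1) (hΦ.compact_support √2)

lemma IsDiffeoGroup.eq_self (hΦ : IsDiffeoGroup Φ) {x : Rn k} (hx : x ∉ fixSupport Φ) (t : ℝ) :
    Φ t x = x := by
  have hx1 : Φ 1 x = x := by
    have := image_eq_zero_of_notMem_tsupport fun h => hx (Or.inl h)
    exact sub_eq_zero.1 this
  have hx2 : Φ √2 x = x := by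
    have := image_eq_zero_of_notMem_tsupport fun h => hx (Or.inr h)
    exact sub_eq_zero.1 this
  -- the times fixing `x`
  let G : AddSubgroup ℝ :=
    { carrier := {t | Φ t x = x}
      zero_mem' := hΦ.map_zero x
      add_mem' := fun {s t} (hs : Φ s x = x) (ht : Φ t x = x) => by
        change Φ (s + t) x = x
        rw [hΦ.map_add, ht, hs]
      neg_mem' := fun {t} (ht : Φ t x = x) => by
        change Φ (-t) x = x
        conv_lhs => rw [← ht]
        exact hΦ.map_neg_map t x }
  have hG : IsClosed (G : Set ℝ) := isClosed_eq (hΦ.continuous_time x) continuous_const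
  have hd : Dense (AddSubgroup.closure {√2, (1 : ℝ)} : Set ℝ) := by
    rw [dense_addSubgroupClosure_pair_iff, div_one]
    exact irrational_sqrt_two
  have hle : AddSubgroup.closure {√2, (1 : ℝ)} ≤ G := by
    rw [AddSubgroup.closure_le]
    rintro s (rfl | rfl)
    exacts [hx2, hx1]
  have : (G : Set ℝ) = univ := by
    have h1 := (hd.mono hle).closure_eq
    rwa [hG.closure_eq] at h1
  have ht : t ∈ (G : Set ℝ) := by rw [this]; exact mem_univ t
  exact ht

lemma IsDiffeoGroup.generator_eq_zero (hΦ : IsDiffeoGroup Φ) {x : Rn k}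
    (hx : x ∉ fixSupport Φ) : generator Φ x = 0 := by
  have h1 := hΦ.hasDerivAt 0 x
  have h2 : (fun s => Φ s x) = fun _ => x := by ext1 s; exact hΦ.eq_self hx s
  rw [hΦ.map_zero, h2] at h1
  exact h1.unique (hasDerivAt_const 0 x)

end group

section boundary

variable {Φ : ℝ → Rn (n + 1) → Rn (n + 1)} {Ω : Set (Rn (n + 1))}

/-- The group induced on `ℝⁿ` by a group on `ℝⁿ⁺¹` that preserves `ℝⁿ`. -/
noncomputable def boundaryGroup (Φ : ℝ → Rn (n + 1) → Rn (n + 1)) (t : ℝ) (x : Rn n) : Rn n :=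
  horiz (Φ t (emb x))

/-- The vector field induced on `ℝⁿ`. -/
noncomputable def boundaryField (Φ : ℝ → Rn (n + 1) → Rn (n + 1)) (x : Rn n) : Rn n :=
  horiz (generator Φ (emb x))

variable (hΦ : IsDiffeoGroup Φ)
  (hR : ∀ t x, Φ t (emb x) ∈ range (emb : Rn n → Rn (n + 1)))

include hR in
lemma emb_boundaryGroup (t : ℝ) (x : Rn n) : emb (boundaryGroup Φ t x) = Φ t (emb x) := by
  obtain ⟨z, hz⟩ := hR t x
  rw [boundaryGroup, ← hz, horiz_emb]

include hΦ in
lemma isCompact_preimage_fixSupport : IsCompact (emb ⁻¹' fixSupport Φ : Set (Rn n)) := by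
  have h1 := hΦ.isCompact_fixSupport
  obtain ⟨R, hR⟩ := h1.isBounded.subset_closedBall (0 : Rn (n + 1))
  refine Metric.isCompact_of_isClosed_isBounded (h1.isClosed.preimage continuous_emb)
    ((Metric.isBounded_closedBall (x := (0 : Rn n)) (r := R)).subset fun x hx => ?_)
  have := hR hx
  rw [mem_closedBall_zero_iff, norm_emb] at this
  simpa using this

include hΦ in
lemma boundaryGroup_eq_self {x : Rn n} (hx : x ∉ emb ⁻¹' fixSupport Φ) (t : ℝ) :
    boundaryGroup Φ t x = x := by
  rw [boundaryGroup, hΦ.eq_self hx, horiz_emb]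

include hΦ hR in
lemma isDiffeoGroup_boundaryGroup : IsDiffeoGroup (boundaryGroup Φ) where
  contDiff := (horizL n).contDiff.comp (hΦ.contDiff.comp
    (contDiff_fst.prodMk ((embL n).contDiff.comp contDiff_snd)))
  map_zero x := by rw [boundaryGroup, hΦ.map_zero, horiz_emb]
  map_add s t x := by
    apply emb_injective
    rw [emb_boundaryGroup hR, emb_boundaryGroup hR, emb_boundaryGroup hR, hΦ.map_add]
  compact_support t := HasCompactSupport.intro (isCompact_preimage_fixSupport hΦ) fun x hx => by
    rw [boundaryGroup_eq_self hΦ hx, sub_self]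

include hΦ in
lemma tsupport_boundaryGroup_subset (t : ℝ) :
    tsupport (fun x => boundaryGroup Φ t x - x) ⊆ emb ⁻¹' fixSupport Φ :=
  closure_minimal (fun x hx => by
    by_contra h
    exact hx (by simp [boundaryGroup_eq_self hΦ h])) (isCompact_preimage_fixSupport hΦ).isClosed

include hΦ hR in
lemma isFlow_boundaryGroup : IsFlow (boundaryField Φ) (boundaryGroup Φ) where
  map_zero := (isDiffeoGroup_boundaryGroup hΦ hR).map_zero
  hasDerivAt t x := by
    rw [boundaryField, emb_boundaryGroup hR]
    exact (horizL n).hasFDerivAt.comp_hasDerivAt t (hΦ.hasDerivAt t (emb x))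

include hΦ in
lemma contDiff_boundaryField : ContDiff ℝ 1 (boundaryField Φ) :=
  (horizL n).contDiff.comp (hΦ.contDiff_generator.comp (embL n).contDiff)

include hΦ in
lemma boundaryField_eq_zero {x : Rn n} (hx : x ∉ emb ⁻¹' fixSupport Φ) :
    boundaryField Φ x = 0 := by
  rw [boundaryField, hΦ.generator_eq_zero hx]
  exact (horizL n).map_zero

include hΦ in
lemma tsupport_boundaryField_subset : tsupport (boundaryField Φ) ⊆ emb ⁻¹' fixSupport Φ :=
  closure_minimal (fun x hx => by
    by_contra h
    exact hx (boundaryField_eq_zero hΦ h)) (isCompact_preimage_fixSupport hΦ).isClosed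

include hΦ hR in
lemma generator_emb (x : Rn n) : generator Φ (emb x) = emb (boundaryField Φ x) := by
  have h1 : HasDerivAt (fun s => height (Φ s (emb x))) (height (generator Φ (Φ 0 (emb x)))) 0 :=
    (heightL n).hasFDerivAt.comp_hasDerivAt 0 (hΦ.hasDerivAt 0 (emb x))
  have h2 : (fun s => height (Φ s (emb x))) = fun _ => 0 := by
    ext1 s
    rw [← emb_boundaryGroup hR, height_emb]
  rw [h2, hΦ.map_zero] at h1
  exact (emb_horiz (h1.unique (hasDerivAt_const 0 0))).symm

variable (hS : ∀ t, tsupport (fun x => Φ t x - x) ∩ {x | 0 ≤ height x} ⊆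
  Ω ∪ emb '' flatBdry Ω)

include hS in
lemma fixSupport_inter_subset :
    fixSupport Φ ∩ {x | 0 ≤ height x} ⊆ Ω ∪ emb '' flatBdry Ω := by
  rintro x ⟨hx | hx, h0⟩
  exacts [hS 1 ⟨hx, h0⟩, hS √2 ⟨hx, h0⟩]

include hS in
lemma preimage_fixSupport_subset (hΩH : Ω ⊆ upperHalf n) :
    emb ⁻¹' fixSupport Φ ⊆ flatBdry Ω := by
  intro x hx
  rcases fixSupport_inter_subset hS ⟨hx, by simp⟩ with h | ⟨z, hz, hzx⟩
  · exact absurd h (emb_notMem_of_subset_upperHalf hΩH x)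
  · exact emb_injective hzx ▸ hz

include hΦ hR hS in
/-- The generator of `Φ` is an admissible extension of the generator of its boundary values. -/
lemma isExtensionField_generator (hΩ : IsAdmissible Ω) :
    IsExtensionField Ω (boundaryField Φ) (generator Φ) where
  contDiffOn := hΦ.contDiff_generator.contDiffOn
  compact_support := by
    refine ⟨fixSupport Φ ∩ {x | 0 ≤ height x}, hΦ.isCompact_fixSupport.inter_right
      (isClosed_le continuous_const continuous_height), fixSupport_inter_subset hS, fun x hx => ?_⟩
    have h0 : 0 ≤ height x := by
      rcases hΩ.closure_subset hx.1 with h | ⟨z, -, rfl⟩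
      · exact le_of_lt h
      · simp
    exact hΦ.generator_eq_zero fun h => hx.2 ⟨h, h0⟩
  eq_on_flatBdry x _ := generator_emb hΦ hR x

include hΦ hR in
/-- An orbit cannot cross `ℝⁿ`, which is invariant. -/
lemma map_mem_upperHalf (t : ℝ) {x : Rn (n + 1)} (hx : x ∈ upperHalf n) :
    Φ t x ∈ upperHalf n := by
  have hne : ∀ s, height (Φ s x) ≠ 0 := by
    intro s hs
    obtain ⟨z, hz⟩ := hR (-s) (horiz (Φ s x))
    rw [emb_horiz hs, hΦ.map_neg_map] at hz
    have hx0 : 0 < height x := hx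
    rw [← hz, height_emb] at hx0
    exact lt_irrefl _ hx0
  by_contra h
  have hc : Continuous fun s => height (Φ s x) := continuous_height.comp (hΦ.continuous_time x)
  have h0 : 0 ≤ height (Φ 0 x) := by rw [hΦ.map_zero]; exact le_of_lt hx
  have ht : height (Φ t x) ≤ 0 := not_lt.1 h
  obtain ⟨s, hs⟩ := mem_range_of_exists_le_of_exists_ge hc ⟨t, ht⟩ ⟨0, h0⟩
  exact hne s hs

include hΦ hR hS in
/-- A point outside `Ω` in the half-space is fixed by `Φ`, hence is not reached from `Ω`. -/
lemma map_mem_of_mem (hΩH : Ω ⊆ upperHalf n) (t : ℝ) {x : Rn (n + 1)} (hx : x ∈ Ω) :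
    Φ t x ∈ Ω := by
  by_contra h
  have h1 := map_mem_upperHalf hΦ hR t (hΩH hx)
  have h0 : 0 ≤ height (Φ t x) := le_of_lt h1
  have h2 : Φ t x ∉ fixSupport Φ := fun h' => by
    rcases fixSupport_inter_subset hS ⟨h', h0⟩ with h3 | ⟨z, -, hz⟩
    · exact h h3
    · have h4 : 0 < height (Φ t x) := h1
      rw [← hz, height_emb] at h4
      exact lt_irrefl _ h4
  have h3 := hΦ.eq_self h2 (-t)
  rw [hΦ.map_neg_map] at h3
  exact h (h3 ▸ hx)

include hΦ hR hS in
lemma image_eq_self (hΩH : Ω ⊆ upperHalf n) (t : ℝ) : Φ t '' Ω = Ω := by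
  refine Subset.antisymm (image_subset_iff.2 fun x hx => map_mem_of_mem hΦ hR hS hΩH t hx)
    fun x hx => ⟨Φ (-t) x, map_mem_of_mem hΦ hR hS hΩH (-t) hx, hΦ.map_map_neg t x⟩

end boundary

/-! ### The Dirichlet integrand along a one-parameter group -/

section determinant

variable {k : ℕ}

lemma det_eq_sum (D : Rn k →L[ℝ] Rn k) : D.det = ∑ σ : Equiv.Perm (Fin k),
    (Equiv.Perm.sign σ : ℝ) * ∏ i, D (EuclideanSpace.single i 1) (σ i) := by
  have h1 := LinearMap.det_toMatrix (EuclideanSpace.basisFun (Fin k) ℝ).toBasis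
    (D : Rn k →ₗ[ℝ] Rn k)
  rw [ContinuousLinearMap.det, ← h1, Matrix.det_apply]
  refine Finset.sum_congr rfl fun σ _ => ?_
  rw [Units.smul_def, zsmul_eq_mul]
  rfl

/-- Jacobi's formula at the identity. -/
lemma hasDerivAt_det {M : ℝ → Rn k →L[ℝ] Rn k} {N : Rn k →L[ℝ] Rn k} {t : ℝ}
    (hM : HasDerivAt M N t) (h0 : M t = ContinuousLinearMap.id ℝ (Rn k)) :
    HasDerivAt (fun s => (M s).det) (∑ i, N (EuclideanSpace.single i 1) i) t := by
  have he : ∀ i j : Fin k, HasDerivAt (fun s => M s (EuclideanSpace.single i 1) j)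
      (N (EuclideanSpace.single i 1) j) t := fun i j =>
    ((EuclideanSpace.proj j : Rn k →L[ℝ] ℝ).comp (ContinuousLinearMap.apply ℝ (Rn k)
      (EuclideanSpace.single i 1 : Rn k))).hasFDerivAt.comp_hasDerivAt t hM
  simp_rw [det_eq_sum]
  have h1 : HasDerivAt (fun s => ∑ σ : Equiv.Perm (Fin k),
      (Equiv.Perm.sign σ : ℝ) * ∏ i, M s (EuclideanSpace.single i 1) (σ i))
      (∑ σ : Equiv.Perm (Fin k), (Equiv.Perm.sign σ : ℝ) *
        ∑ i, (∏ j ∈ Finset.univ.erase i, M t (EuclideanSpace.single j 1) (σ j)) •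
          N (EuclideanSpace.single i 1) (σ i)) t :=
    HasDerivAt.fun_sum fun σ _ => (HasDerivAt.fun_finsetProd fun i _ => he i (σ i)).const_mul _
  refine h1.congr_deriv ?_
  rw [Finset.sum_eq_single 1]
  · simp only [Equiv.Perm.sign_one, Units.val_one, Int.cast_one, one_mul, Equiv.Perm.one_apply]
    refine Finset.sum_congr rfl fun i _ => ?_
    rw [Finset.prod_eq_one, one_smul]
    intro j _
    simp [h0]
  · intro σ _ hσ
    rw [Finset.sum_eq_zero, mul_zero]
    intro i _
    -- a permutation other than the identity moves an index `j ≠ i`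
    obtain ⟨j, hj, hji⟩ : ∃ j, σ j ≠ j ∧ j ≠ i := by
      obtain ⟨j, hj⟩ : ∃ j, σ j ≠ j := by
        by_contra! h
        exact hσ (Equiv.ext h)
      by_cases hji : j = i
      · exact ⟨σ j, fun h => hj (σ.injective h), fun h => hj (h.trans hji.symm)⟩
      · exact ⟨j, hj, hji⟩
    rw [Finset.prod_eq_zero (Finset.mem_erase.2 ⟨hji, Finset.mem_univ j⟩), zero_smul]
    simp [h0, hj]
  · simp

lemma contDiff_det {E : Type*} [NormedAddCommGroup E] [NormedSpace ℝ E]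
    {M : E → Rn k →L[ℝ] Rn k} (hM : ContDiff ℝ 1 M) : ContDiff ℝ 1 fun p => (M p).det := by
  simp_rw [det_eq_sum]
  refine ContDiff.sum fun σ _ => contDiff_const.mul (contDiff_prod fun i _ => ?_)
  exact (EuclideanSpace.proj (σ i) : Rn k →L[ℝ] ℝ).contDiff.comp
    (hM.clm_apply contDiff_const)

end determinant

section pullback

variable {k : ℕ} {Φ : ℝ → Rn k → Rn k}

/-- The differential of `Φ t` at `x`. -/
noncomputable def spaceDeriv (Φ : ℝ → Rn k → Rn k) (t : ℝ) (x : Rn k) : Rn k →L[ℝ] Rn k :=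
  (fderiv ℝ (fun p : ℝ × Rn k => Φ p.1 p.2) (t, x)).comp (ContinuousLinearMap.inr ℝ ℝ (Rn k))

lemma IsDiffeoGroup.hasFDerivAt (hΦ : IsDiffeoGroup Φ) (t : ℝ) (x : Rn k) :
    HasFDerivAt (Φ t) (spaceDeriv Φ t x) x :=
  (hΦ.differentiable (t, x)).hasFDerivAt.comp x (hasFDerivAt_prodMk_right t x)

lemma IsDiffeoGroup.contDiff_spaceDeriv (hΦ : IsDiffeoGroup Φ) :
    ContDiff ℝ 1 fun p : ℝ × Rn k => spaceDeriv Φ p.1 p.2 := by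
  have h1 : ContDiff ℝ 1 (fderiv ℝ fun p : ℝ × Rn k => Φ p.1 p.2) :=
    hΦ.contDiff.fderiv_right (by norm_cast)
  exact h1.clm_comp contDiff_const

lemma IsDiffeoGroup.spaceDeriv_zero (hΦ : IsDiffeoGroup Φ) (x : Rn k) :
    spaceDeriv Φ 0 x = ContinuousLinearMap.id ℝ (Rn k) := by
  have h1 := hΦ.hasFDerivAt 0 x
  have h2 : Φ 0 = id := funext hΦ.map_zero
  rw [h2] at h1
  exact h1.unique (hasFDerivAt_id x)

/-- The differential of `Φ t` evolves by the differential of the generator. -/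
lemma IsDiffeoGroup.hasDerivAt_spaceDeriv (hΦ : IsDiffeoGroup Φ) (x : Rn k) :
    HasDerivAt (fun t => spaceDeriv Φ t x) (fderiv ℝ (generator Φ) x) 0 := by
  set F : ℝ × Rn k → Rn k := fun p => Φ p.1 p.2 with hF
  have h1 : ContDiff ℝ 1 (fderiv ℝ F) := hΦ.contDiff.fderiv_right (by norm_cast)
  have h2 : HasFDerivAt (fderiv ℝ F) (fderiv ℝ (fderiv ℝ F) (0, x)) (0, x) :=
    (h1.differentiable (by norm_num) _).hasFDerivAt
  -- time and space derivatives commute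
  have hsymm : ∀ a b, fderiv ℝ (fderiv ℝ F) (0, x) a b = fderiv ℝ (fderiv ℝ F) (0, x) b a :=
    fun a b => (((contDiff_infty.1 hΦ.contDiff 2).contDiffAt).isSymmSndFDerivAt (by simp)).eq a b
  have h3 : HasDerivAt (fun t : ℝ => fderiv ℝ F (t, x)) (fderiv ℝ (fderiv ℝ F) (0, x) (1, 0)) 0 :=
    h2.comp_hasDerivAt (0 : ℝ) ((hasDerivAt_id (0 : ℝ)).prodMk (hasDerivAt_const (0 : ℝ) x))
  have h4 : HasFDerivAt (generator Φ) ((ContinuousLinearMap.apply ℝ (Rn k) ((1 : ℝ), (0 : Rn k))).comp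
      ((fderiv ℝ (fderiv ℝ F) (0, x)).comp (ContinuousLinearMap.inr ℝ ℝ (Rn k)))) x :=
    (ContinuousLinearMap.apply ℝ (Rn k) ((1 : ℝ), (0 : Rn k))).hasFDerivAt.comp x
      (h2.comp x (hasFDerivAt_prodMk_right 0 x))
  refine (h3.clm_comp (hasDerivAt_const (0 : ℝ) (ContinuousLinearMap.inr ℝ ℝ (Rn k)))).congr_deriv ?_
  rw [h4.fderiv]
  ext1 w
  simp [hsymm (1, 0)]

/-- The differential of `Φ t`, read at the image point. -/
noncomputable def pullDeriv (Φ : ℝ → Rn k → Rn k) (t : ℝ) (y : Rn k) : Rn k →L[ℝ] Rn k :=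
  spaceDeriv Φ t (Φ (-t) y)

/-- The Jacobian determinant of the inverse of `Φ t`. -/
noncomputable def pullJac (Φ : ℝ → Rn k → Rn k) (t : ℝ) (y : Rn k) : ℝ := (spaceDeriv Φ (-t) y).det

lemma IsDiffeoGroup.contDiff_pullDeriv (hΦ : IsDiffeoGroup Φ) :
    ContDiff ℝ 1 fun p : ℝ × Rn k => pullDeriv Φ p.1 p.2 := by
  have h1 : ContDiff ℝ 1 fun p : ℝ × Rn k => Φ (-p.1) p.2 :=
    (hΦ.contDiff.of_le (by norm_cast)).comp (contDiff_fst.neg.prodMk contDiff_snd)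
  exact hΦ.contDiff_spaceDeriv.comp (contDiff_fst.prodMk h1)

lemma IsDiffeoGroup.contDiff_pullJac (hΦ : IsDiffeoGroup Φ) :
    ContDiff ℝ 1 fun p : ℝ × Rn k => pullJac Φ p.1 p.2 :=
  contDiff_det (hΦ.contDiff_spaceDeriv.comp (contDiff_fst.neg.prodMk contDiff_snd))

lemma IsDiffeoGroup.pullDeriv_comp (hΦ : IsDiffeoGroup Φ) (t : ℝ) (y : Rn k) :
    (pullDeriv Φ t y).comp (spaceDeriv Φ (-t) y) = ContinuousLinearMap.id ℝ (Rn k) := by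
  have h1 := (hΦ.hasFDerivAt t (Φ (-t) y)).comp y (hΦ.hasFDerivAt (-t) y)
  have h2 : Φ t ∘ Φ (-t) = id := funext fun x => hΦ.map_map_neg t x
  rw [h2] at h1
  exact h1.unique (hasFDerivAt_id y)

/-- The Jacobian never vanishes and equals `1` at time zero. -/
lemma IsDiffeoGroup.pullJac_pos (hΦ : IsDiffeoGroup Φ) (t : ℝ) (y : Rn k) : 0 < pullJac Φ t y := by
  have hne : ∀ s, pullJac Φ s y ≠ 0 := fun s h => by
    have h1 := congrArg ContinuousLinearMap.det (hΦ.pullDeriv_comp s y)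
    change LinearMap.det ((pullDeriv Φ s y : Rn k →ₗ[ℝ] Rn k) ∘ₗ
      (spaceDeriv Φ (-s) y : Rn k →ₗ[ℝ] Rn k)) =
      LinearMap.det ((ContinuousLinearMap.id ℝ (Rn k) : Rn k →L[ℝ] Rn k) : Rn k →ₗ[ℝ] Rn k) at h1
    rw [LinearMap.det_comp] at h1
    have h2 : LinearMap.det ((spaceDeriv Φ (-s) y : Rn k →L[ℝ] Rn k) : Rn k →ₗ[ℝ] Rn k) = 0 := h
    rw [h2, mul_zero] at h1
    simp at h1
  have h0 : pullJac Φ 0 y = 1 := by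
    rw [pullJac, neg_zero, hΦ.spaceDeriv_zero]
    simp [ContinuousLinearMap.det]
  by_contra h
  have hc : Continuous fun s => pullJac Φ s y :=
    hΦ.contDiff_pullJac.continuous.comp (continuous_id.prodMk continuous_const)
  obtain ⟨s, hs⟩ := mem_range_of_exists_le_of_exists_ge hc ⟨t, not_lt.1 h⟩
    ⟨0, by rw [h0]; exact zero_le_one⟩
  exact hne s hs

lemma IsDiffeoGroup.hasDerivAt_pullJac (hΦ : IsDiffeoGroup Φ) (y : Rn k) :
    HasDerivAt (fun t => pullJac Φ t y) (-divergence (generator Φ) y) 0 := by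
  have h1 : HasDerivAt (fun t : ℝ => spaceDeriv Φ (-t) y) (-fderiv ℝ (generator Φ) y) 0 := by
    have h2 : HasDerivAt (fun t => spaceDeriv Φ t y) (fderiv ℝ (generator Φ) y) (-0 : ℝ) := by
      rw [neg_zero]; exact hΦ.hasDerivAt_spaceDeriv y
    exact (h2.scomp (0 : ℝ) (hasDerivAt_neg (0 : ℝ))).congr_deriv (by simp)
  refine (hasDerivAt_det h1 (by rw [neg_zero, hΦ.spaceDeriv_zero])).congr_deriv ?_
  simp [divergence, pderiv]

lemma IsDiffeoGroup.hasDerivAt_pullDeriv (hΦ : IsDiffeoGroup Φ) (y : Rn k) :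
    HasDerivAt (fun t => pullDeriv Φ t y) (fderiv ℝ (generator Φ) y) 0 := by
  have hd : DifferentiableAt ℝ (fun t => pullDeriv Φ t y) 0 :=
    (hΦ.contDiff_pullDeriv.comp (contDiff_id.prodMk contDiff_const)).differentiable
      (by norm_num) 0
  have h1 : HasDerivAt (fun t : ℝ => spaceDeriv Φ (-t) y) (-fderiv ℝ (generator Φ) y) 0 := by
    have h2 : HasDerivAt (fun t => spaceDeriv Φ t y) (fderiv ℝ (generator Φ) y) (-0 : ℝ) := by
      rw [neg_zero]; exact hΦ.hasDerivAt_spaceDeriv y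
    exact (h2.scomp (0 : ℝ) (hasDerivAt_neg (0 : ℝ))).congr_deriv (by simp)
  have h2 := hd.hasDerivAt.clm_comp h1
  have h3 : (fun t => (pullDeriv Φ t y).comp (spaceDeriv Φ (-t) y)) =
      fun _ => ContinuousLinearMap.id ℝ (Rn k) := by ext1 t; exact hΦ.pullDeriv_comp t y
  rw [h3] at h2
  have h4 := h2.unique (hasDerivAt_const (0 : ℝ) _)
  have h5 : pullDeriv Φ 0 y = ContinuousLinearMap.id ℝ (Rn k) := hΦ.spaceDeriv_zero _
  rw [neg_zero, hΦ.spaceDeriv_zero, h5, ContinuousLinearMap.comp_id,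
    ContinuousLinearMap.id_comp, ← sub_eq_add_neg, sub_eq_zero] at h4
  rw [← h4]
  exact hd.hasDerivAt

/-- The integrand of the Dirichlet energy of `u ∘ Φ t` after the change of variables. -/
noncomputable def pullEnergy (u : Rn k → Rn m) (Φ : ℝ → Rn k → Rn k) (t : ℝ) (y : Rn k) : ℝ :=
  (∑ j, ‖fderiv ℝ u y (pullDeriv Φ t y (EuclideanSpace.single j 1))‖ ^ 2) * pullJac Φ t y

lemma measurable_pullEnergy (u : Rn k → Rn m) (hΦ : IsDiffeoGroup Φ) (t : ℝ) :
    Measurable (pullEnergy u Φ t) := by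
  have hA : Continuous fun y => pullDeriv Φ t y :=
    hΦ.contDiff_pullDeriv.continuous.comp (continuous_const.prodMk continuous_id)
  have hJ : Continuous fun y => pullJac Φ t y :=
    hΦ.contDiff_pullJac.continuous.comp (continuous_const.prodMk continuous_id)
  unfold pullEnergy
  simp_rw [fderiv_apply_eq_sum u]
  refine Measurable.mul (Finset.measurable_sum _ fun j _ => ?_) hJ.measurable
  refine Measurable.pow_const (Measurable.norm (Finset.measurable_sum _ fun i _ => ?_)) 2
  have h1 : Measurable fun y => pullDeriv Φ t y (EuclideanSpace.single j 1) i :=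
    ((EuclideanSpace.proj i : Rn k →L[ℝ] ℝ).continuous.comp
      (hA.clm_apply continuous_const)).measurable
  exact h1.smul (measurable_pderiv u i)

/-- The integrand is differentiable in time, with derivative of the order of `|∇u|²`; at `t = 0`
its derivative is minus the stress integrand of the generator. -/
lemma exists_hasDerivAt_pullEnergy (u : Rn k → Rn m) (hΦ : IsDiffeoGroup Φ) {Ω : Set (Rn k)}
    (hΩ : Bornology.IsBounded Ω) :
    ∃ (h' : ℝ → Rn k → ℝ) (C : ℝ),
      (∀ t y, HasDerivAt (fun s => pullEnergy u Φ s y) (h' t y) t) ∧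
      (∀ t ∈ Icc (-1 : ℝ) 1, ∀ y ∈ Ω, |h' t y| ≤ C * ‖fderiv ℝ u y‖ ^ 2) ∧
      (∀ y, h' 0 y = -stressIntegrand u (generator Φ) y) := by
  set A' : ℝ → Rn k → Rn k →L[ℝ] Rn k := fun t y =>
    fderiv ℝ (fun p : ℝ × Rn k => pullDeriv Φ p.1 p.2) (t, y) (1, 0) with hA'
  set J' : ℝ → Rn k → ℝ := fun t y =>
    fderiv ℝ (fun p : ℝ × Rn k => pullJac Φ p.1 p.2) (t, y) (1, 0) with hJ'
  have hline : ∀ t (y : Rn k), HasDerivAt (fun s : ℝ => (s, y)) ((1 : ℝ), (0 : Rn k)) t := fun t y =>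
    (hasDerivAt_id t).prodMk (hasDerivAt_const t y)
  have dA : ∀ t y, HasDerivAt (fun s => pullDeriv Φ s y) (A' t y) t := fun t y => by
    have h1 : HasFDerivAt (fun p : ℝ × Rn k => pullDeriv Φ p.1 p.2) _ (t, y) :=
      (hΦ.contDiff_pullDeriv.differentiable (by norm_num) (t, y)).hasFDerivAt
    exact h1.comp_hasDerivAt t (hline t y)
  have dJ : ∀ t y, HasDerivAt (fun s => pullJac Φ s y) (J' t y) t := fun t y => by
    have h1 : HasFDerivAt (fun p : ℝ × Rn k => pullJac Φ p.1 p.2) _ (t, y) :=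
      (hΦ.contDiff_pullJac.differentiable (by norm_num) (t, y)).hasFDerivAt
    exact h1.comp_hasDerivAt t (hline t y)
  set e : Fin k → Rn k := fun j => EuclideanSpace.single j 1 with he
  have hen : ∀ j, ‖e j‖ = 1 := fun j => by simp [he]
  have hK : IsCompact (Icc (-1 : ℝ) 1 ×ˢ closure Ω) := isCompact_Icc.prod hΩ.isCompact_closure
  obtain ⟨B1, hB1⟩ := hK.exists_bound_of_continuousOn
    hΦ.contDiff_pullDeriv.continuous.continuousOn
  obtain ⟨B2, hB2⟩ := hK.exists_bound_of_continuousOn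
    (f := fun p : ℝ × Rn k => A' p.1 p.2)
    ((hΦ.contDiff_pullDeriv.continuous_fderiv (by norm_num)).clm_apply
      continuous_const).continuousOn
  obtain ⟨B3, hB3⟩ := hK.exists_bound_of_continuousOn hΦ.contDiff_pullJac.continuous.continuousOn
  obtain ⟨B4, hB4⟩ := hK.exists_bound_of_continuousOn
    (f := fun p : ℝ × Rn k => J' p.1 p.2)
    ((hΦ.contDiff_pullJac.continuous_fderiv (by norm_num)).clm_apply
      continuous_const).continuousOn
  refine ⟨fun t y => (∑ j, 2 * inner ℝ (fderiv ℝ u y (pullDeriv Φ t y (e j)))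
      (fderiv ℝ u y (A' t y (e j)))) * pullJac Φ t y +
      (∑ j, ‖fderiv ℝ u y (pullDeriv Φ t y (e j))‖ ^ 2) * J' t y,
    (k * (2 * (B1 * B2))) * B3 + (k * B1 ^ 2) * B4, fun t y => ?_, fun t ht y hy => ?_, fun y => ?_⟩
  · have h1 : ∀ j, HasDerivAt (fun s => fderiv ℝ u y (pullDeriv Φ s y (e j)))
        (fderiv ℝ u y (A' t y (e j))) t := fun j =>
      ((fderiv ℝ u y).comp (ContinuousLinearMap.apply ℝ (Rn k) (e j))).hasFDerivAt.comp_hasDerivAt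
        t (dA t y)
    exact (HasDerivAt.fun_sum fun j _ => (h1 j).norm_sq).mul (dJ t y)
  · have hp : (t, y) ∈ Icc (-1 : ℝ) 1 ×ˢ closure Ω := ⟨ht, subset_closure hy⟩
    have b1 := hB1 _ hp
    have b2 := hB2 _ hp
    have b3 := hB3 _ hp
    have b4 := hB4 _ hp
    rw [Real.norm_eq_abs] at b3 b4
    simp only at b1 b2 b3 b4
    have p1 := (norm_nonneg _).trans b1
    have p2 := (norm_nonneg _).trans b2
    have p3 := (abs_nonneg _).trans b3
    have p4 := (abs_nonneg _).trans b4
    have n1 : ∀ j, ‖fderiv ℝ u y (pullDeriv Φ t y (e j))‖ ≤ ‖fderiv ℝ u y‖ * B1 := fun j => by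
      refine (ContinuousLinearMap.le_opNorm _ _).trans ?_
      gcongr
      refine (ContinuousLinearMap.le_opNorm _ _).trans ?_
      rw [hen, mul_one]; exact b1
    have n2 : ∀ j, ‖fderiv ℝ u y (A' t y (e j))‖ ≤ ‖fderiv ℝ u y‖ * B2 := fun j => by
      refine (ContinuousLinearMap.le_opNorm _ _).trans ?_
      gcongr
      refine (ContinuousLinearMap.le_opNorm _ _).trans ?_
      rw [hen, mul_one]; exact b2
    have s1 : |∑ j, 2 * inner ℝ (fderiv ℝ u y (pullDeriv Φ t y (e j)))
        (fderiv ℝ u y (A' t y (e j)))| ≤ k * (2 * (B1 * B2)) * ‖fderiv ℝ u y‖ ^ 2 := by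
      refine (Finset.abs_sum_le_sum_abs _ _).trans ?_
      calc _ ≤ ∑ _j : Fin k, 2 * ((‖fderiv ℝ u y‖ * B1) * (‖fderiv ℝ u y‖ * B2)) := by
            refine Finset.sum_le_sum fun j _ => ?_
            rw [abs_mul, abs_two]
            gcongr
            refine (abs_real_inner_le_norm _ _).trans ?_
            gcongr
            exacts [n1 j, n2 j]
        _ = _ := by simp; ring
    have s2 : |∑ j, ‖fderiv ℝ u y (pullDeriv Φ t y (e j))‖ ^ 2| ≤
        k * B1 ^ 2 * ‖fderiv ℝ u y‖ ^ 2 := by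
      rw [abs_of_nonneg (Finset.sum_nonneg fun _ _ => by positivity)]
      calc _ ≤ ∑ _j : Fin k, (‖fderiv ℝ u y‖ * B1) ^ 2 := by
            refine Finset.sum_le_sum fun j _ => ?_
            gcongr
            exact n1 j
        _ = _ := by simp; ring
    refine (abs_add_le _ _).trans ?_
    rw [abs_mul, abs_mul]
    calc _ ≤ (k * (2 * (B1 * B2)) * ‖fderiv ℝ u y‖ ^ 2) * B3 +
          (k * B1 ^ 2 * ‖fderiv ℝ u y‖ ^ 2) * B4 := by gcongr
      _ = _ := by ring
  · have a0 : A' 0 y = fderiv ℝ (generator Φ) y := (dA 0 y).unique (hΦ.hasDerivAt_pullDeriv y)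
    have j0 : J' 0 y = -divergence (generator Φ) y := (dJ 0 y).unique (hΦ.hasDerivAt_pullJac y)
    have i0 : pullDeriv Φ 0 y = ContinuousLinearMap.id ℝ (Rn k) := hΦ.spaceDeriv_zero _
    have d0 : pullJac Φ 0 y = 1 := by
      rw [pullJac, neg_zero, hΦ.spaceDeriv_zero]
      simp [ContinuousLinearMap.det]
    have e3 : ∀ j, inner ℝ (fderiv ℝ u y (e j)) (fderiv ℝ u y (fderiv ℝ (generator Φ) y (e j))) =
        ∑ i, inner ℝ (pderiv u i y) (pderiv u j y) * pderiv (generator Φ) j y i := by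
      intro j
      rw [fderiv_apply_eq_sum u y (fderiv ℝ (generator Φ) y (e j)), inner_sum]
      refine Finset.sum_congr rfl fun i _ => ?_
      rw [inner_smul_right, real_inner_comm, mul_comm]
      rfl
    simp only [a0, j0, i0, d0, ContinuousLinearMap.id_apply, mul_one]
    rw [← Finset.mul_sum]
    simp_rw [e3]
    rw [Finset.sum_comm, stressIntegrand, gradSq]
    simp only [pderiv, he]
    ring

end pullback

/-! ### Inner variation of the Dirichlet energy -/

section dirichlet

variable {u : Rn (n + 1) → Rn m} {Φ : ℝ → Rn (n + 1) → Rn (n + 1)} {Ω : Set (Rn (n + 1))}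

lemma gradSq_comp_eq (hΦ : IsDiffeoGroup Φ) (t : ℝ) {x : Rn (n + 1)}
    (hu : DifferentiableAt ℝ u (Φ t x)) :
    gradSq (fun x => u (Φ t x)) x =
      ∑ j, ‖fderiv ℝ u (Φ t x) (spaceDeriv Φ t x (EuclideanSpace.single j 1))‖ ^ 2 := by
  have h1 : HasFDerivAt (fun x => u (Φ t x)) ((fderiv ℝ u (Φ t x)).comp (spaceDeriv Φ t x)) x :=
    hu.hasFDerivAt.comp x (hΦ.hasFDerivAt t x)
  simp [gradSq, pderiv, h1.fderiv]

/-- Change of variables in the Dirichlet energy. -/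
lemma dirichlet_change_of_variables (hΦ : IsDiffeoGroup Φ) (hΩ : MeasurableSet Ω)
    (hu : ∀ x ∈ Ω, DifferentiableAt ℝ u x) (hΩΦ : ∀ t, Φ t '' Ω = Ω) (t : ℝ) :
    (IntegrableOn (gradSq fun x => u (Φ t x)) Ω ↔ IntegrableOn (pullEnergy u Φ t) Ω) ∧
      ∫ x in Ω, gradSq (fun x => u (Φ t x)) x = ∫ y in Ω, pullEnergy u Φ t y := by
  have hd : ∀ x ∈ Ω, HasFDerivWithinAt (Φ (-t)) (spaceDeriv Φ (-t) x) Ω x := fun x _ =>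
    (hΦ.hasFDerivAt (-t) x).hasFDerivWithinAt
  have hinj : InjOn (Φ (-t)) Ω := fun x _ y _ h => by
    have := congrArg (Φ t) h
    rwa [hΦ.map_map_neg, hΦ.map_map_neg] at this
  have he : ∀ y ∈ Ω, |(spaceDeriv Φ (-t) y).det| • gradSq (fun x => u (Φ t x)) (Φ (-t) y) =
      pullEnergy u Φ t y := fun y hy => by
    rw [gradSq_comp_eq hΦ t (by rw [hΦ.map_map_neg]; exact hu y hy), hΦ.map_map_neg]
    have h1 : |(spaceDeriv Φ (-t) y).det| = pullJac Φ t y := abs_of_pos (hΦ.pullJac_pos t y)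
    rw [h1, smul_eq_mul, mul_comm]
    rfl
  have h1 := integrableOn_image_iff_integrableOn_abs_det_fderiv_smul volume hΩ hd hinj
    (gradSq fun x => u (Φ t x))
  have h2 := integral_image_eq_integral_abs_det_fderiv_smul volume hΩ hd hinj
    (gradSq fun x => u (Φ t x))
  rw [hΩΦ] at h1 h2
  exact ⟨h1.trans (integrableOn_congr_fun he hΩ), h2.trans (setIntegral_congr_fun hΩ he)⟩

lemma integrableOn_pullEnergy (hΦ : IsDiffeoGroup Φ) (hΩb : Bornology.IsBounded Ω)
    (hΩ : MeasurableSet Ω) (hi : IntegrableOn (fun x => ‖fderiv ℝ u x‖ ^ 2) Ω) (t : ℝ) :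
    IntegrableOn (pullEnergy u Φ t) Ω := by
  have hA : Continuous fun y => pullDeriv Φ t y :=
    hΦ.contDiff_pullDeriv.continuous.comp (continuous_const.prodMk continuous_id)
  have hJ : Continuous fun y => pullJac Φ t y :=
    hΦ.contDiff_pullJac.continuous.comp (continuous_const.prodMk continuous_id)
  obtain ⟨B, hB⟩ := hΩb.isCompact_closure.exists_bound_of_continuousOn hA.continuousOn
  obtain ⟨B', hB'⟩ := hΩb.isCompact_closure.exists_bound_of_continuousOn hJ.continuousOn
  refine (hi.const_mul (((n + 1 : ℕ) : ℝ) * B ^ 2 * B')).mono'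
    (measurable_pullEnergy u hΦ t).aestronglyMeasurable
    ((ae_restrict_iff' hΩ).2 (ae_of_all _ fun y hy => ?_))
  have b1 := hB y (subset_closure hy)
  have b2 := hB' y (subset_closure hy)
  have p1 := (norm_nonneg _).trans b1
  have hs : ∑ j, ‖fderiv ℝ u y (pullDeriv Φ t y (EuclideanSpace.single j 1))‖ ^ 2 ≤
      ((n + 1 : ℕ) : ℝ) * B ^ 2 * ‖fderiv ℝ u y‖ ^ 2 := by
    calc _ ≤ ∑ _j : Fin (n + 1), (‖fderiv ℝ u y‖ * B) ^ 2 := by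
          refine Finset.sum_le_sum fun j _ => ?_
          gcongr
          refine (ContinuousLinearMap.le_opNorm _ _).trans ?_
          gcongr
          exact (norm_apply_single_le _ j).trans b1
      _ = _ := by simp; ring
  have hs0 : 0 ≤ ∑ j, ‖fderiv ℝ u y (pullDeriv Φ t y (EuclideanSpace.single j 1))‖ ^ 2 :=
    Finset.sum_nonneg fun _ _ => by positivity
  rw [pullEnergy, norm_mul, Real.norm_of_nonneg hs0]
  calc _ ≤ (((n + 1 : ℕ) : ℝ) * B ^ 2 * ‖fderiv ℝ u y‖ ^ 2) * B' := by gcongr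
    _ = _ := by ring

/-- The inner variation of the Dirichlet energy. The change of variables puts the whole dependence on
`t` into the smooth map `Φ`, so that no second derivative of `u` is needed. -/
theorem hasDerivAt_dirichlet (hΦ : IsDiffeoGroup Φ) (hΩb : Bornology.IsBounded Ω)
    (hΩ : MeasurableSet Ω) (hu : ∀ x ∈ Ω, DifferentiableAt ℝ u x) (hΩΦ : ∀ t, Φ t '' Ω = Ω)
    (hi : IntegrableOn (fun x => ‖fderiv ℝ u x‖ ^ 2) Ω) :
    (∀ t, IntegrableOn (gradSq fun x => u (Φ t x)) Ω) ∧
      HasDerivAt (fun t => 1 / 2 * ∫ x in Ω, gradSq (fun x => u (Φ t x)) x)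
        (-(1 / 2) * ∫ x in Ω, stressIntegrand u (generator Φ) x) 0 := by
  have hcv := dirichlet_change_of_variables hΦ hΩ hu hΩΦ
  refine ⟨fun t => (hcv t).1.2 (integrableOn_pullEnergy hΦ hΩb hΩ hi t), ?_⟩
  obtain ⟨h', C, hd, hb, h0⟩ := exists_hasDerivAt_pullEnergy u hΦ hΩb
  have key := (hasDerivAt_integral_of_dominated_loc_of_deriv_le (μ := volume.restrict Ω)
    (F := pullEnergy u Φ) (F' := h') (x₀ := (0 : ℝ)) (s := Icc (-1) 1)
    (bound := fun y => C * ‖fderiv ℝ u y‖ ^ 2)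
    (Icc_mem_nhds (by norm_num) (by norm_num))
    (Eventually.of_forall fun t => (measurable_pullEnergy u hΦ t).aestronglyMeasurable)
    (integrableOn_pullEnergy hΦ hΩb hΩ hi 0) (by
      have : h' 0 = fun y => -stressIntegrand u (generator Φ) y := funext h0
      rw [this]
      exact (measurable_stressIntegrand u _).neg.aestronglyMeasurable)
    ((ae_restrict_iff' hΩ).2 (ae_of_all _ fun y hy t ht => hb t ht y hy)) (hi.const_mul C)
    (ae_of_all _ fun y t _ => hd t y)).2
  have h1 := key.const_mul (1 / 2)
  have h2 : (fun t => 1 / 2 * ∫ x in Ω, gradSq (fun x => u (Φ t x)) x) =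
      fun t => 1 / 2 * ∫ y in Ω, pullEnergy u Φ t y := by
    ext1 t; rw [(hcv t).2]
  rw [h2]
  refine h1.congr_deriv ?_
  simp_rw [h0]
  rw [integral_neg]
  ring

end dirichlet

end HalfHarmonic

theorem mainTheorem11 (n m : ℕ) (hn : 1 ≤ n)
    (ω : Set (Rn n)) (hω : IsOpen ω) (hωb : Bornology.IsBounded ω)
    (Ω : Set (Rn (n + 1))) (hΩ : IsAdmissible Ω) (hΩω : closure (flatBdry Ω) ⊆ ω)
    (v : Rn n → Rn m) (hv : MemHhat v ω) :
    (∀ (X : Rn n → Rn n) (φ : ℝ → Rn n → Rn n), ContDiff ℝ 1 X → HasCompactSupport X →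
      tsupport X ⊆ flatBdry Ω → IsFlow X φ →
        (∀ t, MemHhat (fun x => v (φ t x)) ω) ∧
        ∀ Y : Rn (n + 1) → Rn (n + 1), IsExtensionField Ω X Y →
          IntegrableOn (stressIntegrand (harmExt v) Y) Ω ∧
          HasDerivAt (fun t => (halfEnergy (fun x => v (φ t x)) ω).toReal)
            (-(1 / 2) * ∫ x in Ω, stressIntegrand (harmExt v) Y x) 0) ∧
    (IsHalfStationary v ω → IsDirichletStationary (harmExt v) Ω) := by
  have hflat : flatBdry Ω ⊆ ω := subset_closure.trans hΩω
  refine ⟨fun X φ hX1 hXc hXΩ hφ =>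
    ⟨fun t => memHhat_comp_flow hω hv hX1 hXc (hXΩ.trans hflat) hφ t, fun Y hY =>
      hasDerivAt_halfEnergy hn hω hωb hΩ hΩω hv hX1 hXc hXΩ hφ hY⟩, ?_⟩
  intro hst Φ hΦ hR hS
  have hΩH := hΩ.subset_upperHalf
  have hpre : emb ⁻¹' fixSupport Φ ⊆ flatBdry Ω := preimage_fixSupport_subset hS hΩH
  have hXsub := tsupport_boundaryField_subset hΦ
  have hXc : HasCompactSupport (boundaryField Φ) :=
    (isCompact_preimage_fixSupport hΦ).of_isClosed_subset (isClosed_tsupport _) hXsub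
  -- the boundary values of `Φ` are admissible in the definition of stationarity of `v`
  have h1 := hst (boundaryGroup Φ) (isDiffeoGroup_boundaryGroup hΦ hR) fun t =>
    ((tsupport_boundaryGroup_subset hΦ t).trans hpre).trans hflat
  have h2 := (hasDerivAt_halfEnergy hn hω hωb hΩ hΩω hv (contDiff_boundaryField hΦ) hXc
    (hXsub.trans hpre) (isFlow_boundaryGroup hΦ hR)
    (isExtensionField_generator hΦ hR hS hΩ)).2
  have hvP := (hv.finiteEnergy hω (hΩ.flatBdry_nonempty.mono hflat)).poissonIntegrable
  obtain ⟨h3, h4⟩ := hasDerivAt_dirichlet (u := harmExt v) hΦ hΩ.isBounded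
    hΩ.isOpen.measurableSet
    (fun x hx => (hasFDerivAt_harmExt hvP (hΩH hx)).differentiableAt)
    (image_eq_self hΦ hR hS hΩH) (integrableOn_sq_norm_fderiv_harmExt hω hΩ hΩω hv)
  -- both derivatives equal `-½ ∫ stressIntegrand`, and that of `𝓔` vanishes
  rw [h2.unique h1] at h4
  exact ⟨h3, h4⟩
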